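/- **Setting.** Let $T$ be a locally compact Polish space with Borel $\sigma$-algebra, and let $\sigma$ be a non-atomic Radon measure on $T$. Let $A\subset T^2$ be a symmetric Borel set that contains the diagonal and satisfies $\sigma^{\otimes 2}(A)=0$, and let $Q:T^2\setminus A\to\{z\in\mathbb C:|z|=1\}$ be measurable with $Q(s,t)=\overline{Q(t,s)}$. Let $\nu$ be a probability measure on $\mathbb R$ with $\int e^{\varepsilon|x|}\,\nu(dx)<\infty$ for some $\varepsilon>0$. Let $B_0(T)$ be the set of bounded measurable functions $f:T\to\mathbb R$ with compact support, let $\mathcal H=L^2(T,\sigma)$ and $\mathcal G=L^2(T\times\mathbb R,\sigma\otimes\nu)$ (complex spaces), and extend $Q$ by $Q(t_1,x_1,t_2,x_2)=Q(t_1,t_2)$. *$Q$-symmetric powers and Fock space.* For $E=L^2(X,\mu)$ with $(X,\mu)=(T,\sigma)$ or $(T\times\mathbb R,\sigma\otimes\nu)$, and a permutation $\pi$ of $\{1,\dots,n\}$, put $Q_\pi(z_1,\dots,z_n)=\prod_{i<j,\ \pi(i)>\pi(j)}Q(z_i,z_j)$ and, for $f\in E^{\otimes n}=L^2(X^n,\mu^{\otimes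 n})$, $$P_nf=\frac1{n!}\sum_{\pi}Q_{\pi^{-1}}(z_1,\dots,z_n)\,f(z_{\pi(1)},\dots,z_{\pi(n)}),\qquad E^{\circledast n}=P_nE^{\otimes n}.$$ For a Hilbert space $\mathscr H$ and $C>0$, let $\mathscr H\,C$ be $\mathscr H$ with its inner product multiplied by $C$. The $Q$-Fock space over $\mathcal G$ is $\mathcal F=\bigoplus_{n\ge0}\mathcal G^{\circledast n}\,n!$, with vacuum $\Omega=(1,0,0,\dots)$. Let $\mathfrak D\subset\mathcal F$ consist of the finite sequences whose $n$-particle components are finite sums of elements $P_n[f(t_1,\dots,t_n)x_1^{i_1}\cdots x_n^{i_n}]$ with $f\in\mathcal H^{\otimes n}$. *Operators.* For $f\in B_0(T)$ and a real polynomial $p$, the operators $a^+(f\otimes p)$, $a^-(f\otimes p)$ and $a^0(f\otimes p)$ on $\mathfrak D$ are defined as follows: $a^+(f\otimes p)F^{(n)}=P_{n+1}[(f\otimes p)\otimes F^{(n)}]$; $a^-(f\otimes p)$ is the restriction of the adjoint of $a^+(f\otimes p)$ in $\mathcal F$; $a^0(f\otimes p)F^{(n)}$ is the product of $F^{(n)}$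 with the function $\sum_{j=1}^nf(t_j)p(x_j)$. The $Q$-Lévy process is $\langle f,\xi\rangle=a^+(f\otimes1)+a^0(f\otimes x)+a^-(f\otimes1)$, $f\in B_0(T)$. Let $\mathscr P$ be the complex unital algebra generated by all operators $\langle f,\xi\rangle$, let $\tau(p)=(p\,\Omega,\Omega)$, and let $L^2(\tau)$ be the completion of $\mathscr P$ (modulo elements of norm zero) for the inner product $(p,q)\mapsto\tau(q^*p)=(p\,\Omega,q\,\Omega)$. Let $I:L^2(\tau)\to\mathcal F$ be the isometry extending $p\mapsto p\,\Omega$. *Orthogonalized power jump processes.* Let $(p^{(k)})_{k\ge0}$ be the monic orthogonal polynomials of $\nu$ (with $p^{(k)}=0$ for $k\ge N$ if the support of $\nu$ consists of $N$ points), $C_k=\int|p^{(k)}|^2\,d\nu$, and $$Y_k(f)=a^+(f\otimes p^{(k)})+a^0(f\otimes x\,p^{(k)})+a^-(f\otimes p^{(k)}),\qquad Y_k(\Delta)=Y_k(\chi_\Delta).$$ **Theorem.** 1. The isometry $I:L^2(\tau)\to\mathcal F$ is surjective, hence unitary. 2. For every $n\ge0$ and $(k_1,\dots,k_n)\in\mathbb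 Z_+^n$ there is exactly one bounded linear operator $$\mathcal H^{\otimes n}\ni f\mapsto\int_{T^n}f(t_1,\dots,t_n)\,Y_{k_1}(dt_1)\cdots Y_{k_n}(dt_n)\in L^2(\tau)$$ that maps $\chi_{\Delta_1}\otimes\cdots\otimes\chi_{\Delta_n}$ to $Y_{k_1}(\Delta_1)\cdots Y_{k_n}(\Delta_n)$, i.e. to the element of $L^2(\tau)$ with image $Y_{k_1}(\Delta_1)\cdots Y_{k_n}(\Delta_n)\Omega$ under $I$, for all mutually disjoint pre-compact Borel sets $\Delta_1,\dots,\Delta_n$. 3. For a finitely supported $\alpha=(\alpha_0,\alpha_1,\dots)\in\mathbb Z_+^\infty$ write $|\alpha|=\sum_i\alpha_i$, and let $$J_\alpha(f)=\int_{T^{|\alpha|}}f(t_1,\dots,t_{|\alpha|})\,Y_0(dt_1)\cdots Y_0(dt_{\alpha_0})\,Y_1(dt_{\alpha_0+1})\cdots Y_1(dt_{\alpha_0+\alpha_1})\cdots.$$ If $C_i=0$ for some $i$ with $\alpha_i>0$, then $J_\alpha=0$. For every other $\alpha$ put $$\mathbb F_\alpha=\Big(\mathcal H^{\circledast\alpha_0}\otimes\mathcal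 H^{\circledast\alpha_1}\otimes\mathcal H^{\circledast\alpha_2}\otimes\cdots\Big)\prod_{i\ge0}\alpha_i!\,C_i^{\alpha_i},$$ a space of functions in $L^2(T^{|\alpha|},\sigma^{\otimes|\alpha|})$ with a weighted inner product. Then $$\bigoplus_\alpha\mathbb F_\alpha\ni(f_\alpha)_\alpha\ \mapsto\ \sum_\alpha J_\alpha(f_\alpha)\in L^2(\tau)$$ (the sum is over the remaining $\alpha$ and converges unconditionally in $L^2(\tau)$) is a unitary operator onto $L^2(\tau)$. If the support of $\nu$ is infinite, all finitely supported $\alpha$ occur. -/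

import Mathlib

open MeasureTheory Polynomial
open scoped ENNReal ComplexConjugate

noncomputable section
namespace QLevy

universe u
variable {X : Type u} [MeasurableSpace X]

/-- A measurable Hermitian kernel of modulus one, defined everywhere on `X × X`. -/
structure HermKernel (X : Type u) [MeasurableSpace X] where
  /-- the function `Q(s, t)` -/
  toFun : X → X → ℂ
  measurable_toFun : Measurable fun p : X × X => toFun p.1 p.2
  norm_eq_one : ∀ s t, ‖toFun s t‖ = 1
  herm : ∀ s t, toFun s t = conj (toFun t s)

theorem HermKernel.mul_swap (K : HermKernel X) (s t : X) : K.toFun s t * K.toFun t s = 1 := by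
  rw [K.herm s t, mul_comm, Complex.mul_conj, Complex.normSq_eq_norm_sq, K.norm_eq_one]
  simp

/-- The complex space `L²(Xⁿ, μⁿ)`, i.e. the `n`-th Hilbert tensor power of `L²(X, μ)`. -/
abbrev L2 (μ : Measure X) (n : ℕ) : Type u := Lp ℂ 2 (Measure.pi fun _ : Fin n => μ)

/-- `Q_π(t₁, …, tₙ) = ∏_{i < j, π(i) > π(j)} Q(tᵢ, tⱼ)`. -/
def qPerm (K : HermKernel X) {n : ℕ} (π : Equiv.Perm (Fin n)) (t : Fin n → X) : ℂ :=
  ∏ p : Fin n × Fin n, if p.1 < p.2 ∧ π p.2 < π p.1 then K.toFun (t p.1) (t p.2) else 1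

theorem norm_qPerm (K : HermKernel X) {n : ℕ} (π : Equiv.Perm (Fin n)) (t : Fin n → X) :
    ‖qPerm K π t‖ = 1 := by
  unfold qPerm
  rw [norm_prod]
  refine Finset.prod_eq_one fun p _ => ?_
  split_ifs
  · exact K.norm_eq_one _ _
  · simp

theorem measurable_qPerm (K : HermKernel X) {n : ℕ} (π : Equiv.Perm (Fin n)) :
    Measurable (qPerm K π) := by
  unfold qPerm
  refine Finset.measurable_prod _ fun p _ => ?_
  split_ifs
  · exact K.measurable_toFun.comp
      (f := fun t : Fin n → X => (t p.1, t p.2)) (by fun_prop)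
  · exact measurable_const

theorem qPerm_one (K : HermKernel X) {n : ℕ} (t : Fin n → X) :
    qPerm K (1 : Equiv.Perm (Fin n)) t = 1 := by
  unfold qPerm
  refine Finset.prod_eq_one fun p _ => if_neg ?_
  rintro ⟨h1, h2⟩
  exact lt_asymm h1 h2

theorem qPerm_mul (K : HermKernel X) {n : ℕ} (r s : Equiv.Perm (Fin n)) (t : Fin n → X) :
    qPerm K (r * s) t = qPerm K s t * qPerm K r (fun j => t (s⁻¹ j)) := by
  have h2 : qPerm K r (fun j => t (s⁻¹ j)) = ∏ p : Fin n × Fin n,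
      if s p.1 < s p.2 ∧ r (s p.2) < r (s p.1) then K.toFun (t p.1) (t p.2) else 1 := by
    unfold qPerm
    rw [← (Equiv.prodCongr s s).prod_comp]
    simp
  have hne : ∀ a b, K.toFun a b ≠ 0 := fun a b h => by
    have := K.norm_eq_one a b
    simp [h] at this
  rw [h2]
  unfold qPerm
  rw [← Finset.prod_mul_distrib]
  rw [← div_eq_one_iff_eq (Finset.prod_ne_zero_iff.2 fun p _ => by
    refine mul_ne_zero ?_ ?_ <;> split_ifs <;> simp [hne]), ← Finset.prod_div_distrib]
  have key : ∀ p : Fin n × Fin n, p.1 = p.2 → ((if p.1 < p.2 ∧ (r * s) p.2 < (r * s) p.1 then K.toFun (t p.1) (t p.2) else 1) /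
      ((if p.1 < p.2 ∧ s p.2 < s p.1 then K.toFun (t p.1) (t p.2) else 1) *
        if s p.1 < s p.2 ∧ r (s p.2) < r (s p.1) then K.toFun (t p.1) (t p.2) else 1)) = 1 := by
    rintro ⟨a, b⟩ (rfl : a = b)
    simp
  refine Finset.prod_involution (fun p _ => p.swap) ?_ ?_ (fun _ _ => Finset.mem_univ _)
    (fun _ _ => Prod.swap_swap _)
  · rintro ⟨a, b⟩ -
    have e1 := K.mul_swap (t a) (t b)
    have e2 : ∀ x y : Fin n, x < y ∨ x = y ∨ y < x := fun x y => lt_trichotomy x y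
    rcases e2 a b with h | h | h
    · have hs : s a ≠ s b := fun h' => h.ne (s.injective h')
      have hr : r (s a) ≠ r (s b) := fun h' => hs (r.injective h')
      rcases lt_or_gt_of_ne hs with h' | h' <;> rcases lt_or_gt_of_ne hr with h'' | h'' <;>
        simp [h, h', h'', h.not_gt, h'.not_gt, h''.not_gt, hne]
      rw [← mul_inv, e1, inv_one]
    · subst h; simp
    · have hs : s a ≠ s b := fun h' => h.ne' (s.injective h')
      have hr : r (s a) ≠ r (s b) := fun h' => hs (r.injective h')
      rcases lt_or_gt_of_ne hs with h' | h' <;> rcases lt_or_gt_of_ne hr with h'' | h'' <;>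
        simp [h, h', h'', h.not_gt, h'.not_gt, h''.not_gt, hne]
      rw [← mul_inv, e1, inv_one]
  · intro p _ hp h
    exact hp (key p (congrArg Prod.snd h))

theorem memLp_mulUnit {Y : Type u} [MeasurableSpace Y] {m : Measure Y} {w : Y → ℂ}
    (hw : Measurable w) (h1 : ∀ y, ‖w y‖ = 1) (F : Lp ℂ 2 m) : MemLp (fun y => w y * F y) 2 m :=
  (Lp.memLp F).of_le (hw.aestronglyMeasurable.mul (Lp.aestronglyMeasurable F))
    (Filter.Eventually.of_forall fun y => by simp [h1 y])

/-- Multiplication by a measurable function of modulus one. -/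
def mulUnit {Y : Type u} [MeasurableSpace Y] (m : Measure Y) (w : Y → ℂ) (hw : Measurable w)
    (h1 : ∀ y, ‖w y‖ = 1) : Lp ℂ 2 m →ₗᵢ[ℂ] Lp ℂ 2 m where
  toFun F := (memLp_mulUnit hw h1 F).toLp
  map_add' F G := by
    rw [← MemLp.toLp_add, MemLp.toLp_eq_toLp_iff]
    filter_upwards [Lp.coeFn_add F G] with y hy
    rw [hy, Pi.add_apply, Pi.add_apply, mul_add]
  map_smul' c F := by
    rw [RingHom.id_apply, ← MemLp.toLp_const_smul, MemLp.toLp_eq_toLp_iff]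
    filter_upwards [Lp.coeFn_smul c F] with y hy
    rw [hy, Pi.smul_apply, Pi.smul_apply, smul_eq_mul, smul_eq_mul, mul_left_comm]
  norm_map' F := by
    refine (Lp.norm_toLp _ (memLp_mulUnit hw h1 F)).trans ?_
    rw [ Lp.norm_def]
    congr 1
    exact eLpNorm_congr_norm_ae (Filter.Eventually.of_forall fun y => by simp [h1 y])

theorem mulUnit_ae {Y : Type u} [MeasurableSpace Y] (m : Measure Y) (w : Y → ℂ) (hw : Measurable w)
    (h1 : ∀ y, ‖w y‖ = 1) (F : Lp ℂ 2 m) : mulUnit m w hw h1 F =ᵐ[m] fun y => w y * F y :=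
  (memLp_mulUnit hw h1 F).coeFn_toLp

theorem measurePreserving_comp_perm (μ : Measure X) [SigmaFinite μ] {n : ℕ}
    (π : Equiv.Perm (Fin n)) :
    MeasurePreserving (fun (t : Fin n → X) (j : Fin n) => t (π j))
      (Measure.pi fun _ : Fin n => μ) (Measure.pi fun _ : Fin n => μ) := by
  have := measurePreserving_piCongrLeft (α := fun _ : Fin n => X) (fun _ => μ) π.symm
  convert this using 1
  ext t j
  have := Equiv.piCongrLeft_apply_apply (P := fun _ : Fin n => X) π.symm t (π j)
  simp at this
  exact this.symm

variable (K : HermKernel X) (μ : Measure X) [SigmaFinite μ]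

/-- The unitary operator `(Ψ_π f)(t₁, …, tₙ) = Q_{π⁻¹}(t₁, …, tₙ) f(t_{π(1)}, …, t_{π(n)})`
representing the permutation `π` on `L²(Xⁿ, μⁿ)`. -/
def psi {n : ℕ} (π : Equiv.Perm (Fin n)) : L2 μ n →ₗᵢ[ℂ] L2 μ n :=
  (mulUnit _ (qPerm K π⁻¹) (measurable_qPerm K π⁻¹) (norm_qPerm K π⁻¹)).comp
    (Lp.compMeasurePreservingₗᵢ ℂ _ (measurePreserving_comp_perm μ π))

theorem psi_ae {n : ℕ} (π : Equiv.Perm (Fin n)) (F : L2 μ n) :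
    psi K μ π F =ᵐ[Measure.pi fun _ : Fin n => μ]
      fun t => qPerm K π⁻¹ t * F (fun j => t (π j)) := by
  refine (mulUnit_ae _ (qPerm K π⁻¹) (measurable_qPerm K π⁻¹) (norm_qPerm K π⁻¹) _).trans ?_
  filter_upwards [Lp.coeFn_compMeasurePreserving F (measurePreserving_comp_perm μ π)] with t ht
  change qPerm K π⁻¹ t * (Lp.compMeasurePreserving _ (measurePreserving_comp_perm μ π) F) t = _
  rw [ht]
  rfl

theorem psi_mul {n : ℕ} (π ρ : Equiv.Perm (Fin n)) (F : L2 μ n) :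
    psi K μ π (psi K μ ρ F) = psi K μ (π * ρ) F := by
  refine Lp.ext ?_
  filter_upwards [psi_ae K μ π (psi K μ ρ F), psi_ae K μ (π * ρ) F,
    (measurePreserving_comp_perm μ π).quasiMeasurePreserving.ae (psi_ae K μ ρ F)] with t h1 h2 h3
  rw [h1, h2, h3, mul_inv_rev, qPerm_mul, inv_inv, mul_assoc]
  rfl

/-- The `Q`-symmetrization operator `Pₙ = (1/n!) ∑_π Ψ_π`. -/
def symP (n : ℕ) : L2 μ n →L[ℂ] L2 μ n :=
  ((n.factorial : ℂ)⁻¹) • ∑ π : Equiv.Perm (Fin n), (psi K μ π).toContinuousLinearMap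

theorem symP_apply (n : ℕ) (F : L2 μ n) :
    symP K μ n F = ((n.factorial : ℂ)⁻¹) • ∑ π : Equiv.Perm (Fin n), psi K μ π F := by
  simp [symP]

theorem psi_symP {n : ℕ} (π : Equiv.Perm (Fin n)) (F : L2 μ n) :
    psi K μ π (symP K μ n F) = symP K μ n F := by
  rw [symP_apply, map_smul, map_sum]
  congr 1
  simp_rw [psi_mul]
  exact Equiv.sum_comp (Equiv.mulLeft π) (fun ρ => psi K μ ρ F)

theorem symP_of_psi {n : ℕ} {F : L2 μ n} (h : ∀ π, psi K μ π F = F) : symP K μ n F = F := by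
  rw [symP_apply, Finset.sum_congr rfl fun π _ => h π, Finset.sum_const, Finset.card_univ,
    Fintype.card_perm, Fintype.card_fin, ← Nat.cast_smul_eq_nsmul ℂ, smul_smul,
    inv_mul_cancel₀ (by exact_mod_cast n.factorial_ne_zero), one_smul]

/-- The `n`-th `Q`-symmetric tensor power of `L²(X, μ)`: the range of the projection `Pₙ`. -/
def qSym (n : ℕ) : Submodule ℂ (L2 μ n) := LinearMap.range (symP K μ n).toLinearMap

theorem mem_qSym {n : ℕ} {F : L2 μ n} : F ∈ qSym K μ n ↔ ∀ π, psi K μ π F = F := by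
  constructor
  · rintro ⟨G, rfl⟩ π
    exact psi_symP K μ π G
  · intro h
    exact ⟨F, symP_of_psi K μ h⟩

theorem isClosed_qSym (n : ℕ) : IsClosed (qSym K μ n : Set (L2 μ n)) := by
  have : (qSym K μ n : Set (L2 μ n)) = ⋂ π, {F | psi K μ π F = F} := by
    ext F
    simp [mem_qSym]
  rw [this]
  exact isClosed_iInter fun π => isClosed_eq (psi K μ π).continuous continuous_id

instance (n : ℕ) : CompleteSpace (qSym K μ n) := (isClosed_qSym K μ n).completeSpace_coe


section Tensor

theorem measurePreserving_head_tail (n : ℕ) :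
    MeasurePreserving (fun t : Fin (n + 1) → X => (t 0, fun j : Fin n => t j.succ))
      (Measure.pi fun _ : Fin (n + 1) => μ) (μ.prod (Measure.pi fun _ : Fin n => μ)) :=
  measurePreserving_piFinSuccAbove (fun _ : Fin (n + 1) => μ) 0

theorem measurePreserving_cons (n : ℕ) :
    MeasurePreserving (fun p : X × (Fin n → X) => (Fin.cons p.1 p.2 : Fin (n + 1) → X))
      (μ.prod (Measure.pi fun _ : Fin n => μ)) (Measure.pi fun _ : Fin (n + 1) => μ) := by
  have := (measurePreserving_piFinSuccAbove (fun _ : Fin (n + 1) => μ) 0).symm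
  convert this using 1
  ext p j
  simp [MeasurableEquiv.piFinSuccAbove, Fin.insertNthEquiv]

theorem quasiMeasurePreserving_head (n : ℕ) :
    Measure.QuasiMeasurePreserving (fun t : Fin (n + 1) → X => t 0)
      (Measure.pi fun _ : Fin (n + 1) => μ) μ :=
  Measure.quasiMeasurePreserving_fst.comp (measurePreserving_head_tail μ n).quasiMeasurePreserving

theorem quasiMeasurePreserving_tail (n : ℕ) :
    Measure.QuasiMeasurePreserving (fun (t : Fin (n + 1) → X) (j : Fin n) => t j.succ)
      (Measure.pi fun _ : Fin (n + 1) => μ) (Measure.pi fun _ : Fin n => μ) :=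
  Measure.quasiMeasurePreserving_snd.comp (measurePreserving_head_tail μ n).quasiMeasurePreserving

variable {μ}

theorem memLp_mul_prod {Y Z : Type*} [MeasurableSpace Y] [MeasurableSpace Z] {m : Measure Y}
    {m' : Measure Z} [SFinite m'] {f : Y → ℂ} {g : Z → ℂ} (hf : MemLp f 2 m) (hg : MemLp g 2 m') :
    MemLp (fun p : Y × Z => f p.1 * g p.2) 2 (m.prod m') := by
  have meas : AEStronglyMeasurable (fun p : Y × Z => f p.1 * g p.2) (m.prod m') :=
    hf.1.comp_fst.mul hg.1.comp_snd
  rw [memLp_two_iff_integrable_sq_norm meas]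
  simp_rw [norm_mul, mul_pow]
  exact ((memLp_two_iff_integrable_sq_norm hf.1).1 hf).mul_prod
    ((memLp_two_iff_integrable_sq_norm hg.1).1 hg)

theorem memLp_tens (h : Lp ℂ 2 μ) {n : ℕ} (F : L2 μ n) :
    MemLp (fun t : Fin (n + 1) → X => h (t 0) * F (fun j => t j.succ)) 2
      (Measure.pi fun _ : Fin (n + 1) => μ) :=
  (memLp_mul_prod (Lp.memLp h) (Lp.memLp F)).comp_measurePreserving
    (measurePreserving_head_tail μ n)

theorem norm_sq_L2 {Y : Type u} [MeasurableSpace Y] {m : Measure Y} (F : Lp ℂ 2 m) :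
    ‖F‖ ^ 2 = ∫ y, ‖F y‖ ^ 2 ∂m := by
  rw [@norm_sq_eq_re_inner ℂ, L2.inner_def, ← integral_re (L2.integrable_inner F F)]
  simp_rw [← norm_sq_eq_re_inner]

/-- The operator `F ↦ h ⊗ F` from `L²(Xⁿ, μⁿ)` to `L²(Xⁿ⁺¹, μⁿ⁺¹)`, as a linear map. -/
def tensLin (h : Lp ℂ 2 μ) (n : ℕ) : L2 μ n →ₗ[ℂ] L2 μ (n + 1) where
  toFun F := (memLp_tens h F).toLp
  map_add' F G := by
    rw [← MemLp.toLp_add, MemLp.toLp_eq_toLp_iff]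
    filter_upwards [(quasiMeasurePreserving_tail μ n).ae (Lp.coeFn_add F G)] with t ht
    rw [Pi.add_apply, ht, Pi.add_apply, mul_add]
  map_smul' c F := by
    rw [RingHom.id_apply, ← MemLp.toLp_const_smul, MemLp.toLp_eq_toLp_iff]
    filter_upwards [(quasiMeasurePreserving_tail μ n).ae (Lp.coeFn_smul c F)] with t ht
    rw [Pi.smul_apply, ht, Pi.smul_apply, smul_eq_mul, smul_eq_mul, mul_left_comm]

theorem tensLin_ae (h : Lp ℂ 2 μ) {n : ℕ} (F : L2 μ n) :
    tensLin h n F =ᵐ[Measure.pi fun _ : Fin (n + 1) => μ]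
      fun t => h (t 0) * F (fun j => t j.succ) :=
  (memLp_tens h F).coeFn_toLp

theorem norm_tensLin (h : Lp ℂ 2 μ) {n : ℕ} (F : L2 μ n) : ‖tensLin h n F‖ = ‖h‖ * ‖F‖ := by
  rw [← sq_eq_sq₀ (norm_nonneg _) (by positivity), mul_pow, norm_sq_L2, norm_sq_L2, norm_sq_L2,
    ← integral_prod_mul]
  have : ∫ t, ‖tensLin h n F t‖ ^ 2 ∂(Measure.pi fun _ : Fin (n + 1) => μ) =
      ∫ t, (fun p : X × (Fin n → X) => ‖h p.1‖ ^ 2 * ‖F p.2‖ ^ 2) (t 0, fun j => t j.succ)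
        ∂(Measure.pi fun _ : Fin (n + 1) => μ) := by
    refine integral_congr_ae ?_
    filter_upwards [tensLin_ae h F] with t ht
    rw [ht, norm_mul, mul_pow]
  rw [this]
  exact (measurePreserving_piFinSuccAbove (fun _ : Fin (n + 1) => μ) 0).integral_comp'
    (fun p : X × (Fin n → X) => ‖h p.1‖ ^ 2 * ‖F p.2‖ ^ 2)

/-- The bounded operator `F ↦ h ⊗ F` from `L²(Xⁿ, μⁿ)` to `L²(Xⁿ⁺¹, μⁿ⁺¹)`. -/
def tens (h : Lp ℂ 2 μ) (n : ℕ) : L2 μ n →L[ℂ] L2 μ (n + 1) :=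
  (tensLin h n).mkContinuous ‖h‖ fun F => (norm_tensLin h F).le

theorem tens_ae (h : Lp ℂ 2 μ) {n : ℕ} (F : L2 μ n) :
    tens h n F =ᵐ[Measure.pi fun _ : Fin (n + 1) => μ]
      fun t => h (t 0) * F (fun j => t j.succ) := tensLin_ae h F

/-- The adjoint of `F ↦ h ⊗ F` integrates out the first variable against the conjugate of `h`. -/
theorem adjoint_tens_ae (h : Lp ℂ 2 μ) {n : ℕ} (F : L2 μ (n + 1)) :
    (ContinuousLinearMap.adjoint (tens h n)) F =ᵐ[Measure.pi fun _ : Fin n => μ]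
      fun t => ∫ s, conj (h s) * F (Fin.cons s t) ∂μ := by
  have main : ∀ S : Set (Fin n → X), MeasurableSet S → (Measure.pi fun _ : Fin n => μ) S < ∞ →
      IntegrableOn (fun t => ∫ s, conj (h s) * F (Fin.cons s t) ∂μ) S
        (Measure.pi fun _ : Fin n => μ) ∧
      ∫ t in S, (ContinuousLinearMap.adjoint (tens h n)) F t ∂(Measure.pi fun _ : Fin n => μ) =
      ∫ t in S, ∫ s, conj (h s) * F (Fin.cons s t) ∂μ ∂(Measure.pi fun _ : Fin n => μ) := by
    intro S hS hfin
    set g : L2 μ n := indicatorConstLp 2 hS hfin.ne (1 : ℂ) with hg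
    have hint := L2.integrable_inner (𝕜 := ℂ) (tens h n g) F
    have hae : (fun t => inner ℂ (tens h n g t) (F t)) =ᵐ[Measure.pi fun _ : Fin (n + 1) => μ]
        fun t => (fun p : X × (Fin n → X) => S.indicator
          (fun y => conj (h p.1) * F (Fin.cons p.1 y)) p.2) (t 0, fun j => t j.succ) := by
      filter_upwards [tens_ae h g, (quasiMeasurePreserving_tail μ n).ae
        (indicatorConstLp_coeFn (p := 2) (hs := hS) (hμs := hfin.ne) (c := (1 : ℂ)))] with t h1 h2
      have e : (Fin.cons (t 0) (fun j : Fin n => t j.succ) : Fin (n + 1) → X) = t :=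
        Fin.cons_self_tail t
      rw [h1, hg, h2]
      by_cases hm : (fun j : Fin n => t j.succ) ∈ S
      · simp [hm, e, mul_comm]
      · simp [hm]
    have hint' : Integrable (fun p : X × (Fin n → X) => S.indicator
        (fun y => conj (h p.1) * F (Fin.cons p.1 y)) p.2)
        (μ.prod (Measure.pi fun _ : Fin n => μ)) := by
      refine ((measurePreserving_piFinSuccAbove (fun _ : Fin (n + 1) => μ) 0).integrable_comp_emb
        (MeasurableEquiv.measurableEmbedding _)).1 ?_
      exact hint.congr hae
    have hind : ∀ y : Fin n → X, ∫ x, S.indicator (fun y => conj (h x) * F (Fin.cons x y)) y ∂μ =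
        S.indicator (fun y => ∫ x, conj (h x) * F (Fin.cons x y) ∂μ) y := by
      intro y
      by_cases hm : y ∈ S <;> simp [hm]
    constructor
    · have := hint'.integral_prod_right
      simp_rw [hind] at this
      exact (integrable_indicator_iff hS).1 this
    · rw [← L2.inner_indicatorConstLp_one (𝕜 := ℂ) hS hfin.ne, ← hg,
        ContinuousLinearMap.adjoint_inner_right, L2.inner_def, integral_congr_ae hae]
      refine ((measurePreserving_piFinSuccAbove (fun _ : Fin (n + 1) => μ) 0).integral_comp'
        (fun p : X × (Fin n → X) => S.indicator
          (fun y => conj (h p.1) * F (Fin.cons p.1 y)) p.2)).trans ?_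
      rw [integral_prod_symm _ hint', ← integral_indicator hS]
      exact integral_congr_ae (Filter.Eventually.of_forall hind)
  refine ae_eq_of_forall_setIntegral_eq_of_sigmaFinite
    (fun S hS hfin => ?_) (fun S hS hfin => (main S hS hfin).1) fun S hS hfin => (main S hS hfin).2
  exact integrableOn_Lp_of_measure_ne_top _ fact_one_le_two_ennreal.elim hfin.ne

end Tensor

section Levels

variable {K μ} in
theorem psi_one {n : ℕ} (F : L2 μ n) : psi K μ (1 : Equiv.Perm (Fin n)) F = F := by
  refine Lp.ext ?_
  filter_upwards [psi_ae K μ (1 : Equiv.Perm (Fin n)) F] with t ht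
  rw [ht, inv_one, qPerm_one, one_mul]
  rfl

theorem inner_symP_left {n : ℕ} (F G : L2 μ n) :
    inner ℂ (symP K μ n F) G = inner ℂ F (symP K μ n G) := by
  have h : ∀ π : Equiv.Perm (Fin n), inner ℂ (psi K μ π F) G = inner ℂ F (psi K μ π⁻¹ G) := by
    intro π
    rw [← (psi K μ π).inner_map_map F, psi_mul, mul_inv_cancel, psi_one]
  rw [symP_apply, symP_apply, inner_smul_left, inner_smul_right, sum_inner, inner_sum]
  congr 1
  · simp
  · simp_rw [h]
    exact Equiv.sum_comp (Equiv.inv (Equiv.Perm (Fin n))) (fun π => inner ℂ F (psi K μ π G))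

theorem symP_mem {n : ℕ} (F : L2 μ n) : symP K μ n F ∈ qSym K μ n := ⟨F, rfl⟩

theorem symP_of_mem {n : ℕ} {F : L2 μ n} (h : F ∈ qSym K μ n) : symP K μ n F = F :=
  symP_of_psi K μ ((mem_qSym K μ).1 h)

variable {μ}

/-- The creation operator `a⁺(h) F = h ⊛ F = P_{n+1}(h ⊗ F)` on the `n`-particle space. -/
def crea (h : Lp ℂ 2 μ) (n : ℕ) : qSym K μ n →L[ℂ] qSym K μ (n + 1) :=
  (((symP K μ (n + 1)).comp (tens h n)).comp (qSym K μ n).subtypeL).codRestrict _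
    fun _ => symP_mem K μ _

/-- The annihilation operator `a⁻(h)` from the `(n+1)`-particle to the `n`-particle space. It is the
adjoint of `a⁺(h)` for the inner products of the Fock space, which carry the weights `n!` and
`(n+1)!`; relative to the unweighted adjoint this gives the factor `n + 1`. -/
def anni (h : Lp ℂ 2 μ) (n : ℕ) : qSym K μ (n + 1) →L[ℂ] qSym K μ n :=
  ((n : ℂ) + 1) • ContinuousLinearMap.adjoint (crea K h n)

theorem coe_anni (h : Lp ℂ 2 μ) (n : ℕ) (F : qSym K μ (n + 1)) :
    (anni K h n F : L2 μ n) =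
      ((n : ℂ) + 1) • symP K μ n ((ContinuousLinearMap.adjoint (tens h n)) F) := by
  have : ContinuousLinearMap.adjoint (crea K h n) F =
      ⟨symP K μ n ((ContinuousLinearMap.adjoint (tens h n)) F), symP_mem K μ _⟩ := by
    refine ext_inner_right ℂ fun G => ?_
    rw [ContinuousLinearMap.adjoint_inner_left, Submodule.coe_inner, Submodule.coe_inner,
      inner_symP_left, symP_of_mem K μ G.2, ContinuousLinearMap.adjoint_inner_left]
    change inner ℂ (F : L2 μ (n + 1)) (symP K μ (n + 1) (tens h n G)) = _
    rw [← inner_symP_left, symP_of_mem K μ F.2]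
  rw [anni, smul_apply, this]
  rfl

end Levels

section Scaled

/-- For a Hilbert space `E` and a constant `c > 0`, the Hilbert space `E c`: it coincides with `E`
as a vector space and has the inner product of `E` multiplied by `c`. -/
def Scaled (_c : Set.Ioi (0 : ℝ)) (E : Type u) : Type u := E

variable (c : Set.Ioi (0 : ℝ)) (E : Type u) [NormedAddCommGroup E] [InnerProductSpace ℂ E]

instance : AddCommGroup (Scaled c E) := inferInstanceAs (AddCommGroup E)

instance : Module ℂ (Scaled c E) := inferInstanceAs (Module ℂ E)

/-- The identity map from `E` to `E c`. -/
def Scaled.of : E ≃ₗ[ℂ] Scaled c E := LinearEquiv.refl ℂ E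

/-- The inner product of `E` multiplied by `c`. -/
@[reducible] def Scaled.core : InnerProductSpace.Core ℂ (Scaled c E) where
  inner x y := ((c : ℝ) : ℂ) * inner ℂ ((Scaled.of c E).symm x) ((Scaled.of c E).symm y)
  conj_inner_symm x y := by simp
  re_inner_nonneg x := by
    rw [inner_self_eq_norm_sq_to_K]
    have : (0 : ℝ) < c := c.2
    have h : (((c : ℝ) : ℂ) * ((‖(Scaled.of c E).symm x‖ : ℂ)) ^ 2) =
        (((c : ℝ) * ‖(Scaled.of c E).symm x‖ ^ 2 : ℝ) : ℂ) := by push_cast; rfl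
    refine le_of_le_of_eq (b := (c : ℝ) * ‖(Scaled.of c E).symm x‖ ^ 2)
      (mul_nonneg this.le (by positivity)) ?_
    exact (congrArg Complex.re h).symm
  add_left x y z := by rw [map_add, inner_add_left, mul_add]
  smul_left x y r := by rw [map_smul, inner_smul_left, mul_left_comm]
  definite x h := by
    have hc : ((c : ℝ) : ℂ) ≠ 0 := by exact_mod_cast ne_of_gt c.2
    have := (mul_eq_zero.1 h).resolve_left hc
    rw [inner_self_eq_zero] at this
    exact (map_eq_zero_iff _ (Scaled.of c E).symm.injective).1 this

instance : NormedAddCommGroup (Scaled c E) := (Scaled.core c E).toNormedAddCommGroup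

instance : InnerProductSpace ℂ (Scaled c E) := InnerProductSpace.ofCore (Scaled.core c E).toCore

theorem Scaled.inner_of (x y : E) :
    inner ℂ (Scaled.of c E x) (Scaled.of c E y) = ((c : ℝ) : ℂ) * inner ℂ x y := rfl

theorem Scaled.norm_of (x : E) : ‖Scaled.of c E x‖ = √(c : ℝ) * ‖x‖ := by
  have hc : (0 : ℝ) ≤ c := le_of_lt c.2
  rw [← sq_eq_sq₀ (norm_nonneg _) (by positivity), mul_pow, Real.sq_sqrt hc,
    @norm_sq_eq_re_inner ℂ, @norm_sq_eq_re_inner ℂ, Scaled.inner_of]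
  simp

instance [CompleteSpace E] : CompleteSpace (Scaled c E) := by
  have hc : (0 : ℝ) < √(c : ℝ) := Real.sqrt_pos.2 c.2
  have hl : LipschitzWith (√(c : ℝ)).toNNReal (Scaled.of c E) :=
    AddMonoidHomClass.lipschitz_of_bound (Scaled.of c E) _ fun x => (Scaled.norm_of c E x).le
  have ha : AntilipschitzWith ((√(c : ℝ))⁻¹).toNNReal (Scaled.of c E) :=
    AddMonoidHomClass.antilipschitz_of_bound (Scaled.of c E) fun x => by
      rw [Scaled.norm_of, Real.coe_toNNReal _ (by positivity), inv_mul_cancel_left₀ hc.ne']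
  exact ((ha.isUniformInducing hl.uniformContinuous).completeSpace_congr
    (Scaled.of c E).surjective).1 inferInstance

end Scaled

section Fock

/-- The `n`-particle space `L²(X, μ)^{⊛ n} n!`. -/
def FockLevel (n : ℕ) : Type u :=
  Scaled ⟨(n.factorial : ℝ), Set.mem_Ioi.2 (by exact_mod_cast n.factorial_pos)⟩ (qSym K μ n)

instance (n : ℕ) : NormedAddCommGroup (FockLevel K μ n) :=
  inferInstanceAs (NormedAddCommGroup (Scaled _ (qSym K μ n)))

instance (n : ℕ) : InnerProductSpace ℂ (FockLevel K μ n) :=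
  inferInstanceAs (InnerProductSpace ℂ (Scaled _ (qSym K μ n)))

instance (n : ℕ) : CompleteSpace (FockLevel K μ n) :=
  inferInstanceAs (CompleteSpace (Scaled _ (qSym K μ n)))

/-- The identity map from `L²(X, μ)^{⊛ n}` to `L²(X, μ)^{⊛ n} n!`. -/
def FockLevel.of (n : ℕ) : qSym K μ n ≃ₗ[ℂ] FockLevel K μ n := Scaled.of _ _

/-- The `Q`-Fock space, the Hilbert direct sum of the spaces `L²(X, μ)^{⊛ n} n!`. -/
abbrev QFock : Type u := lp (fun n => FockLevel K μ n) 2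

end Fock


section Setting

variable {T : Type u} [MeasurableSpace T]

/-- The function `Q` of modulus one, defined and Hermitian outside a symmetric null set `A` that
contains the diagonal of `T × T`. -/
structure QFunction {T : Type u} [MeasurableSpace T] (σ : Measure T) where
  /-- the exceptional set -/
  A : Set (T × T)
  measurableSet_A : MeasurableSet A
  symm_A : ∀ s t, (s, t) ∈ A → (t, s) ∈ A
  diag_subset_A : ∀ t, (t, t) ∈ A
  null_A : (σ.prod σ) A = 0
  /-- the function `Q : T⁽²⁾ → S¹` -/
  Q : ↥Aᶜ → ℂ
  measurable_Q : Measurable Q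
  norm_Q : ∀ p, ‖Q p‖ = 1
  herm_Q : ∀ p q : ↥Aᶜ, q.1 = p.1.swap → Q p = conj (Q q)

open Classical in
/-- The extension of `Q` to all of `T × T` by the value one on the exceptional null set. -/
def QFunction.kernel {σ : Measure T} (Q : QFunction σ) : HermKernel T where
  toFun s t := if h : (s, t) ∈ Q.Aᶜ then Q.Q ⟨(s, t), h⟩ else 1
  measurable_toFun := Measurable.dite (s := Q.Aᶜ) (f := Q.Q) Q.measurable_Q
    (g := fun _ => (1 : ℂ)) measurable_const Q.measurableSet_A.compl
  norm_eq_one s t := by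
    split_ifs
    · exact Q.norm_Q _
    · simp
  herm s t := by
    by_cases h : (s, t) ∈ Q.Aᶜ
    · have h' : (t, s) ∈ Q.Aᶜ := fun hA => h (Q.symm_A _ _ hA)
      rw [dif_pos h, dif_pos h']
      exact Q.herm_Q _ _ rfl
    · have h' : (t, s) ∉ Q.Aᶜ := fun hA => h fun hB => hA (Q.symm_A _ _ hB)
      rw [dif_neg h, dif_neg h', map_one]

/-- The kernel `Q(t₁, x₁, t₂, x₂) = Q(t₁, t₂)` on `T × ℝ`. -/
def HermKernel.lift (K : HermKernel T) : HermKernel (T × ℝ) where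
  toFun z w := K.toFun z.1 w.1
  measurable_toFun := K.measurable_toFun.comp
    (f := fun p : (T × ℝ) × (T × ℝ) => (p.1.1, p.2.1)) (by fun_prop)
  norm_eq_one _ _ := K.norm_eq_one _ _
  herm _ _ := K.herm _ _

/-- The measure `ν` on `ℝ` has an exponential moment. -/
class HasExpMoment (ν : Measure ℝ) : Prop where
  exists_integrable : ∃ ε : ℝ, 0 < ε ∧ Integrable (fun x => Real.exp (ε * |x|)) ν

theorem integrable_pow (ν : Measure ℝ) [HasExpMoment ν] (n : ℕ) :
    Integrable (fun x : ℝ => x ^ n) ν := by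
  obtain ⟨ε, hε, h⟩ := HasExpMoment.exists_integrable (ν := ν)
  refine ProbabilityTheory.integrable_pow_of_integrable_exp_mul (X := fun x : ℝ => x) (t := ε)
    hε.ne' ?_ ?_ n
  · refine h.mono (by fun_prop) (Filter.Eventually.of_forall fun x => ?_)
    rw [Real.norm_eq_abs, Real.norm_eq_abs, Real.abs_exp, Real.abs_exp, Real.exp_le_exp]
    exact mul_le_mul_of_nonneg_left (le_abs_self x) hε.le
  · refine h.mono (by fun_prop) (Filter.Eventually.of_forall fun x => ?_)
    rw [Real.norm_eq_abs, Real.norm_eq_abs, Real.abs_exp, Real.abs_exp, Real.exp_le_exp]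
    nlinarith [neg_abs_le x]

theorem integrable_eval (ν : Measure ℝ) [HasExpMoment ν] (p : ℝ[X]) :
    Integrable (fun x : ℝ => p.eval x) ν := by
  simp_rw [eval_eq_sum_range]
  exact integrable_finsetSum _ fun i _ => (integrable_pow ν i).const_mul _

theorem memLp_eval (ν : Measure ℝ) [HasExpMoment ν] (p : ℝ[X]) :
    MemLp (fun x : ℝ => ((p.eval x : ℝ) : ℂ)) 2 ν := by
  have hm : AEStronglyMeasurable (fun x : ℝ => ((p.eval x : ℝ) : ℂ)) ν :=
    (Complex.continuous_ofReal.comp p.continuous).aestronglyMeasurable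
  rw [memLp_two_iff_integrable_sq_norm hm]
  refine (integrable_eval ν (p ^ 2)).congr (Filter.Eventually.of_forall fun x => ?_)
  simp

variable (σ : Measure T) [SigmaFinite σ] (ν : Measure ℝ) [IsProbabilityMeasure ν]

theorem quasiMeasurePreserving_fst_pi (n : ℕ) :
    Measure.QuasiMeasurePreserving (fun (z : Fin n → T × ℝ) (j : Fin n) => (z j).1)
      (Measure.pi fun _ : Fin n => σ.prod ν) (Measure.pi fun _ : Fin n => σ) :=
  Measure.quasiMeasurePreserving_fst.comp (measurePreserving_arrowProdEquivProdArrow T ℝ (Fin n)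
    (fun _ => σ) (fun _ => ν)).quasiMeasurePreserving

variable [HasExpMoment ν]

theorem memLp_polyElt {n : ℕ} (i : Fin n → ℕ) (f : L2 σ n) :
    MemLp (fun z : Fin n → T × ℝ => f (fun j => (z j).1) * ∏ j, ((z j).2 : ℂ) ^ i j) 2
      (Measure.pi fun _ : Fin n => σ.prod ν) := by
  have hp : MemLp (fun x : Fin n → ℝ => ∏ j, (x j : ℂ) ^ i j) 2 (Measure.pi fun _ => ν) := by
    have hm : Continuous fun x : Fin n → ℝ => ∏ j, (x j : ℂ) ^ i j := by fun_prop
    rw [memLp_two_iff_integrable_sq_norm hm.aestronglyMeasurable]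
    refine (Integrable.fintype_prod (𝕜 := ℝ) (f := fun (j : Fin n) (x : ℝ) => x ^ (2 * i j))
      fun j => integrable_pow ν _).congr (Filter.Eventually.of_forall fun x => ?_)
    simp only [norm_prod, norm_pow, Complex.norm_real, Real.norm_eq_abs, ← Finset.prod_pow]
    exact Finset.prod_congr rfl fun j _ => by
      rw [← pow_mul, mul_comm (i j) 2, pow_mul, pow_mul, sq_abs]
  exact (memLp_mul_prod (Lp.memLp f) hp).comp_measurePreserving
    (measurePreserving_arrowProdEquivProdArrow T ℝ (Fin n) (fun _ => σ) (fun _ => ν))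

variable {σ} in
/-- The function `f(t₁, …, tₙ) x₁^{i₁} ⋯ xₙ^{iₙ}` as an element of `L²((T × ℝ)ⁿ, (σ ⊗ ν)ⁿ)`. -/
def polyElt {n : ℕ} (i : Fin n → ℕ) (f : L2 σ n) : L2 (σ.prod ν) n :=
  (memLp_polyElt σ ν i f).toLp

theorem polyElt_ae {n : ℕ} (i : Fin n → ℕ) (f : L2 σ n) :
    polyElt ν i f =ᵐ[Measure.pi fun _ : Fin n => σ.prod ν]
      fun z => f (fun j => (z j).1) * ∏ j, ((z j).2 : ℂ) ^ i j :=
  (memLp_polyElt σ ν i f).coeFn_toLp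

/-- The linear span of all functions `f(t₁, …, tₙ) x₁^{i₁} ⋯ xₙ^{iₙ}` with `f ∈ L²(Tⁿ, σⁿ)`. -/
def polyPart (n : ℕ) : Submodule ℂ (L2 (σ.prod ν) n) :=
  Submodule.span ℂ {F | ∃ (i : Fin n → ℕ) (f : L2 σ n), F = polyElt ν i f}

theorem polyElt_mem {n : ℕ} (i : Fin n → ℕ) (f : L2 σ n) : polyElt ν i f ∈ polyPart σ ν n :=
  Submodule.subset_span ⟨i, f, rfl⟩

variable (K : HermKernel T)

/-- The `n`-particle part of the domain: the elements `Pₙ[∑ f_{i₁…iₙ}(t₁, …, tₙ) x₁^{i₁} ⋯ xₙ^{iₙ}]`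
(finite sums) with `f_{i₁…iₙ} ∈ L²(Tⁿ, σⁿ)`. -/
def dom (n : ℕ) : Submodule ℂ (L2 (σ.prod ν) n) :=
  (polyPart σ ν n).map (symP K.lift (σ.prod ν) n).toLinearMap

theorem psi_polyElt {n : ℕ} (π : Equiv.Perm (Fin n)) (i : Fin n → ℕ) (f : L2 σ n) :
    psi K.lift (σ.prod ν) π (polyElt ν i f) = polyElt ν (fun j => i (π⁻¹ j)) (psi K σ π f) := by
  refine Lp.ext ?_
  filter_upwards [psi_ae K.lift (σ.prod ν) π (polyElt ν i f),
    (measurePreserving_comp_perm (σ.prod ν) π).quasiMeasurePreserving.ae (polyElt_ae σ ν i f),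
    polyElt_ae σ ν (fun j => i (π⁻¹ j)) (psi K σ π f),
    (quasiMeasurePreserving_fst_pi σ ν n).ae (psi_ae K σ π f)] with z h1 h2 h3 h4
  have hq : qPerm K.lift π⁻¹ z = qPerm K π⁻¹ (fun j => (z j).1) := rfl
  have hp : ∏ j, ((z j).2 : ℂ) ^ i (π⁻¹ j) = ∏ j, ((z (π j)).2 : ℂ) ^ i j := by
    rw [← Equiv.prod_comp π (fun j => ((z j).2 : ℂ) ^ i (π⁻¹ j))]
    simp
  rw [h1, h2, h3, h4, hq, hp, mul_assoc]

theorem symP_mem_polyPart {n : ℕ} {F : L2 (σ.prod ν) n} (h : F ∈ polyPart σ ν n) :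
    symP K.lift (σ.prod ν) n F ∈ polyPart σ ν n := by
  rw [symP_apply]
  refine Submodule.smul_mem _ _ (Submodule.sum_mem _ fun π _ => ?_)
  have : polyPart σ ν n ≤ (polyPart σ ν n).comap (psi K.lift (σ.prod ν) π).toLinearMap := by
    refine Submodule.span_le.2 ?_
    rintro _ ⟨i, f, rfl⟩
    change psi K.lift (σ.prod ν) π (polyElt ν i f) ∈ polyPart σ ν n
    rw [psi_polyElt]
    exact polyElt_mem σ ν _ _
  exact this h

theorem mem_dom {n : ℕ} {F : L2 (σ.prod ν) n} :
    F ∈ dom σ ν K n ↔ F ∈ polyPart σ ν n ∧ F ∈ qSym K.lift (σ.prod ν) n := by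
  constructor
  · rintro ⟨G, hG, rfl⟩
    exact ⟨symP_mem_polyPart σ ν K hG, symP_mem _ _ _⟩
  · rintro ⟨h1, h2⟩
    exact ⟨F, h1, symP_of_mem _ _ h2⟩

theorem dom_le (n : ℕ) : dom σ ν K n ≤ qSym K.lift (σ.prod ν) n :=
  fun _ h => ((mem_dom σ ν K).1 h).2

end Setting


section Operators

/-- The bounded measurable real-valued functions on `T` with compact support. -/
structure B0 (T : Type u) [TopologicalSpace T] [MeasurableSpace T] where
  /-- the function itself -/
  toFun : T → ℝ
  measurable_toFun : Measurable toFun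
  bounded : ∃ C, ∀ t, |toFun t| ≤ C
  hasCompactSupport : HasCompactSupport toFun

variable {T : Type u} [TopologicalSpace T] [MeasurableSpace T]

/-- The indicator function of a measurable pre-compact set. -/
def B0.indicator (Δ : Set T) (hΔ : MeasurableSet Δ) (hc : IsCompact (closure Δ)) : B0 T where
  toFun := Δ.indicator fun _ => 1
  measurable_toFun := measurable_const.indicator hΔ
  bounded := ⟨1, fun t => by by_cases h : t ∈ Δ <;> simp [h]⟩
  hasCompactSupport := hc.of_isClosed_subset (isClosed_tsupport _)
    (closure_mono Set.support_indicator_subset)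

variable (σ : Measure T) [SigmaFinite σ] [IsFiniteMeasureOnCompacts σ]
  (ν : Measure ℝ) [IsProbabilityMeasure ν] [HasExpMoment ν] (K : HermKernel T)

theorem B0.memLp (f : B0 T) : MemLp (fun t => (f.toFun t : ℂ)) 2 σ := by
  obtain ⟨C, hC⟩ := f.bounded
  have hm : Measurable fun t => (f.toFun t : ℂ) := Complex.measurable_ofReal.comp f.measurable_toFun
  rw [memLp_two_iff_integrable_sq_norm hm.aestronglyMeasurable]
  have hs : Function.support (fun t => ‖(f.toFun t : ℂ)‖ ^ 2) ⊆ tsupport f.toFun := by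
    intro t ht
    refine subset_tsupport _ fun h => ht ?_
    simp [h]
  rw [← integrableOn_iff_integrable_of_support_subset hs]
  refine Measure.integrableOn_of_bounded (M := C ^ 2)
    (IsCompact.measure_lt_top f.hasCompactSupport).ne
    (hm.norm.pow_const 2).aestronglyMeasurable (Filter.Eventually.of_forall fun t => ?_)
  rw [norm_pow, norm_norm, Complex.norm_real, Real.norm_eq_abs]
  exact pow_le_pow_left₀ (abs_nonneg _) (hC t) 2

variable {σ} in
/-- The class of `f` in the complex space `L²(T, σ)`. -/
def B0.toL2 (f : B0 T) : Lp ℂ 2 σ := (f.memLp σ).toLp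

/-- The function `(f ⊗ p)(t, x) = f(t) p(x)` as an element of `L²(T × ℝ, σ ⊗ ν)`. -/
def tensorPoly (f : B0 T) (p : ℝ[X]) : Lp ℂ 2 (σ.prod ν) :=
  (memLp_mul_prod (f.memLp σ) (memLp_eval ν p)).toLp

theorem tensorPoly_ae (f : B0 T) (p : ℝ[X]) :
    tensorPoly σ ν f p =ᵐ[σ.prod ν] fun w => (f.toFun w.1 : ℂ) * ((p.eval w.2 : ℝ) : ℂ) :=
  (memLp_mul_prod (f.memLp σ) (memLp_eval ν p)).coeFn_toLp

/-- `φ` is a.e. equal to an element of `polyPart`. -/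
def IsPoly {T : Type u} [MeasurableSpace T] (σ : Measure T) [SigmaFinite σ] (ν : Measure ℝ)
    [IsProbabilityMeasure ν] [HasExpMoment ν] {n : ℕ} (φ : (Fin n → T × ℝ) → ℂ) : Prop :=
  ∃ G ∈ polyPart σ ν n, G =ᵐ[Measure.pi fun _ : Fin n => σ.prod ν] φ

section IsPoly

variable {T : Type u} [MeasurableSpace T] {σ : Measure T} [SigmaFinite σ] {ν : Measure ℝ}
    [IsProbabilityMeasure ν] [HasExpMoment ν] {n : ℕ}

theorem IsPoly.congr {φ ψ : (Fin n → T × ℝ) → ℂ} (h : IsPoly σ ν φ)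
    (e : φ =ᵐ[Measure.pi fun _ : Fin n => σ.prod ν] ψ) : IsPoly σ ν ψ := by
  obtain ⟨G, hG, hφ⟩ := h
  exact ⟨G, hG, hφ.trans e⟩

theorem IsPoly.add {φ ψ : (Fin n → T × ℝ) → ℂ} (h : IsPoly σ ν φ) (h' : IsPoly σ ν ψ) :
    IsPoly σ ν fun z => φ z + ψ z := by
  obtain ⟨G, hG, hφ⟩ := h
  obtain ⟨G', hG', hψ⟩ := h'
  exact ⟨G + G', Submodule.add_mem _ hG hG', (Lp.coeFn_add G G').trans (hφ.add hψ)⟩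

theorem IsPoly.const_mul {φ : (Fin n → T × ℝ) → ℂ} (h : IsPoly σ ν φ) (c : ℂ) :
    IsPoly σ ν fun z => c * φ z := by
  obtain ⟨G, hG, hφ⟩ := h
  exact ⟨c • G, Submodule.smul_mem _ c hG, (Lp.coeFn_smul c G).trans (hφ.const_smul c)⟩

theorem IsPoly.sum {ι : Type*} (s : Finset ι) {φ : ι → (Fin n → T × ℝ) → ℂ}
    (h : ∀ a ∈ s, IsPoly σ ν (φ a)) : IsPoly σ ν fun z => ∑ a ∈ s, φ a z := by
  classical
  induction s using Finset.induction_on with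
  | empty => exact ⟨0, Submodule.zero_mem _, by
      simp only [Finset.sum_empty]
      exact Lp.coeFn_zero ℂ 2 _⟩
  | insert a s ha ih =>
    simp_rw [Finset.sum_insert ha]
    exact (h a (Finset.mem_insert_self a s)).add
      (ih fun b hb => h b (Finset.mem_insert_of_mem hb))

theorem IsPoly.gen (i : Fin n → ℕ) (f : L2 σ n) :
    IsPoly σ ν fun z => f (fun j => (z j).1) * ∏ j, ((z j).2 : ℂ) ^ i j :=
  ⟨_, polyElt_mem σ ν i f, polyElt_ae σ ν i f⟩

theorem IsPoly.mem {F : L2 (σ.prod ν) n} (h : IsPoly σ ν F) : F ∈ polyPart σ ν n := by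
  obtain ⟨G, hG, hφ⟩ := h
  rwa [Lp.ext hφ] at hG

theorem eval_eq_sum_complex (p : ℝ[X]) (x : ℝ) :
    ((p.eval x : ℝ) : ℂ) = ∑ m ∈ Finset.range (p.natDegree + 1), (p.coeff m : ℂ) * (x : ℂ) ^ m := by
  rw [eval_eq_sum_range]
  push_cast
  rfl

end IsPoly

theorem tens_mem_polyPart (f : B0 T) (p : ℝ[X]) {n : ℕ} {F : L2 (σ.prod ν) n}
    (hF : F ∈ polyPart σ ν n) : tens (tensorPoly σ ν f p) n F ∈ polyPart σ ν (n + 1) := by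
  have : polyPart σ ν n ≤
      (polyPart σ ν (n + 1)).comap (tens (tensorPoly σ ν f p) n).toLinearMap := by
    refine Submodule.span_le.2 ?_
    rintro _ ⟨i, g, rfl⟩
    change tens (tensorPoly σ ν f p) n (polyElt ν i g) ∈ polyPart σ ν (n + 1)
    refine IsPoly.mem ?_
    refine (IsPoly.sum (Finset.range (p.natDegree + 1)) fun m _ =>
      (IsPoly.gen (Fin.cons m i : Fin (n + 1) → ℕ) (tens (f.toL2 (σ := σ)) n g)).const_mul
        (p.coeff m : ℂ)).congr ?_
    filter_upwards [tens_ae (tensorPoly σ ν f p) (polyElt ν i g),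
      (quasiMeasurePreserving_tail (σ.prod ν) n).ae (polyElt_ae σ ν i g),
      (quasiMeasurePreserving_head (σ.prod ν) n).ae (tensorPoly_ae σ ν f p),
      (quasiMeasurePreserving_fst_pi σ ν (n + 1)).ae (tens_ae (f.toL2 (σ := σ)) g),
      (quasiMeasurePreserving_fst_pi σ ν (n + 1)).ae ((quasiMeasurePreserving_head σ n).ae
        (f.memLp σ).coeFn_toLp)] with z h1 h2 h3 h4 h5
    rw [h1, h2, h3, eval_eq_sum_complex, h4, B0.toL2, h5, Finset.mul_sum, Finset.sum_mul]
    refine Finset.sum_congr rfl fun m _ => ?_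
    rw [Fin.prod_univ_succ]
    simp only [Fin.cons_zero, Fin.cons_succ]
    ring
  exact this hF

theorem adjoint_tens_mem_polyPart (f : B0 T) (p : ℝ[X]) {n : ℕ} {F : L2 (σ.prod ν) (n + 1)}
    (hF : F ∈ polyPart σ ν (n + 1)) :
    (ContinuousLinearMap.adjoint (tens (tensorPoly σ ν f p) n)) F ∈ polyPart σ ν n := by
  have : polyPart σ ν (n + 1) ≤ (polyPart σ ν n).comap
      (ContinuousLinearMap.adjoint (tens (tensorPoly σ ν f p) n)).toLinearMap := by
    refine Submodule.span_le.2 ?_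
    rintro _ ⟨i, g, rfl⟩
    change (ContinuousLinearMap.adjoint (tens (tensorPoly σ ν f p) n)) (polyElt ν i g) ∈
      polyPart σ ν n
    refine IsPoly.mem ?_
    refine ((IsPoly.gen (fun j => i j.succ)
      ((ContinuousLinearMap.adjoint (tens (f.toL2 (σ := σ)) n)) g)).const_mul
        (∫ x, ((p.eval x : ℝ) : ℂ) * (x : ℂ) ^ i 0 ∂ν)).congr ?_
    have hswap : ∀ᵐ z ∂(Measure.pi fun _ : Fin n => σ.prod ν), ∀ᵐ w ∂(σ.prod ν),
        polyElt ν i g (Fin.cons w z) = g (fun j => (Fin.cons w z : Fin (n + 1) → T × ℝ) j |>.1) *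
          ∏ j, (((Fin.cons w z : Fin (n + 1) → T × ℝ) j).2 : ℂ) ^ i j :=
      Measure.ae_ae_of_ae_prod (((measurePreserving_cons (σ.prod ν) n).comp
        Measure.measurePreserving_swap).quasiMeasurePreserving.ae (polyElt_ae σ ν i g))
    filter_upwards [adjoint_tens_ae (tensorPoly σ ν f p) (polyElt ν i g), hswap,
      (quasiMeasurePreserving_fst_pi σ ν n).ae (adjoint_tens_ae (f.toL2 (σ := σ)) g)] with z h1 h2 h3
    rw [h1, h3]
    have e1 : ∫ w, conj (tensorPoly σ ν f p w) * polyElt ν i g (Fin.cons w z) ∂(σ.prod ν) =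
        ∫ w : T × ℝ, ((f.toFun w.1 : ℂ) * g (Fin.cons w.1 fun j => (z j).1)) *
          ((((p.eval w.2 : ℝ) : ℂ) * (w.2 : ℂ) ^ i 0) *
            ∏ j : Fin n, ((z j).2 : ℂ) ^ i j.succ) ∂(σ.prod ν) := by
      refine integral_congr_ae ?_
      filter_upwards [h2, tensorPoly_ae σ ν f p] with w hw1 hw2
      have hc : (fun j => ((Fin.cons w z : Fin (n + 1) → T × ℝ) j).1) =
          (Fin.cons w.1 fun j => (z j).1 : Fin (n + 1) → T) := by
        funext j
        refine Fin.cases ?_ (fun j => ?_) j <;> simp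
      rw [hw1, hw2, hc, Fin.prod_univ_succ, map_mul, Complex.conj_ofReal, Complex.conj_ofReal]
      simp only [Fin.cons_zero, Fin.cons_succ]
      ring
    have e2 : ∫ s, conj (f.toL2 (σ := σ) s) * g (Fin.cons s fun j => (z j).1) ∂σ =
        ∫ s, (f.toFun s : ℂ) * g (Fin.cons s fun j => (z j).1) ∂σ := by
      refine integral_congr_ae ?_
      filter_upwards [(f.memLp σ).coeFn_toLp] with s hs
      rw [B0.toL2, hs, Complex.conj_ofReal]
    rw [e1, e2, integral_prod_mul (fun s => (f.toFun s : ℂ) * g (Fin.cons s fun j => (z j).1))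
      (fun x : ℝ => (((p.eval x : ℝ) : ℂ) * (x : ℂ) ^ i 0) *
        ∏ j : Fin n, ((z j).2 : ℂ) ^ i j.succ), integral_mul_const]
    ring
  exact this hF

/-- The function `∑ⱼ f(tⱼ) q(xⱼ)` on `(T × ℝ)ⁿ`. -/
def multiplier (f : B0 T) (q : ℝ[X]) {n : ℕ} (z : Fin n → T × ℝ) : ℂ :=
  ∑ j, (f.toFun (z j).1 : ℂ) * ((q.eval (z j).2 : ℝ) : ℂ)

theorem isPoly_multiplier (f : B0 T) (q : ℝ[X]) {n : ℕ} {F : L2 (σ.prod ν) n}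
    (hF : F ∈ polyPart σ ν n) : IsPoly σ ν fun z => multiplier f q z * F z := by
  induction hF using Submodule.span_induction with
  | mem F h =>
    obtain ⟨i, g, rfl⟩ := h
    obtain ⟨C, hC⟩ := f.bounded
    have hg : ∀ j : Fin n, MemLp (fun t : Fin n → T => (f.toFun (t j) : ℂ) * g t) 2
        (Measure.pi fun _ : Fin n => σ) := fun j => by
      have hm : Measurable fun t : Fin n → T => (f.toFun (t j) : ℂ) :=
        Complex.measurable_ofReal.comp (f.measurable_toFun.comp (measurable_pi_apply j))
      refine (Lp.memLp g).of_le_mul (c := C)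
        (hm.aestronglyMeasurable.mul (Lp.aestronglyMeasurable g))
        (Filter.Eventually.of_forall fun t => ?_)
      rw [norm_mul, Complex.norm_real, Real.norm_eq_abs]
      exact mul_le_mul_of_nonneg_right (hC _) (norm_nonneg _)
    refine (IsPoly.sum Finset.univ fun j _ => IsPoly.sum (Finset.range (q.natDegree + 1))
      fun m _ => (IsPoly.gen (σ := σ) (ν := ν) (fun l => i l + if l = j then m else 0)
        ((hg j).toLp)).const_mul (q.coeff m : ℂ)).congr ?_
    have hall : ∀ᵐ z ∂(Measure.pi fun _ : Fin n => σ.prod ν), ∀ j,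
        ((hg j).toLp : L2 σ n) (fun l => (z l).1) = (f.toFun (z j).1 : ℂ) * g (fun l => (z l).1) :=
      ae_all_iff.2 fun j => (quasiMeasurePreserving_fst_pi σ ν n).ae (hg j).coeFn_toLp
    filter_upwards [polyElt_ae σ ν i g, hall] with z h1 h2
    rw [h1, multiplier, Finset.sum_mul]
    refine Finset.sum_congr rfl fun j _ => ?_
    rw [eval_eq_sum_complex, Finset.mul_sum, Finset.sum_mul]
    refine Finset.sum_congr rfl fun m _ => ?_
    rw [h2]
    simp_rw [pow_add]
    rw [Finset.prod_mul_distrib]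
    have : ∏ l, ((z l).2 : ℂ) ^ (if l = j then m else 0) = ((z j).2 : ℂ) ^ m := by
      rw [Finset.prod_eq_single j] <;> simp +contextual
    rw [this]
    ring
  | zero =>
    refine ⟨0, Submodule.zero_mem _, ?_⟩
    filter_upwards [Lp.coeFn_zero ℂ 2 (Measure.pi fun _ : Fin n => σ.prod ν)] with z hz
    rw [hz]
    simp
  | add F G _ _ hF hG =>
    refine (hF.add hG).congr ?_
    filter_upwards [Lp.coeFn_add F G] with z hz
    rw [hz, Pi.add_apply, mul_add]
  | smul c F _ hF =>
    refine (hF.const_mul c).congr ?_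
    filter_upwards [Lp.coeFn_smul c F] with z hz
    rw [hz, Pi.smul_apply, smul_eq_mul, mul_left_comm]

end Operators


section DomainOperators

variable {T : Type u} [TopologicalSpace T] [MeasurableSpace T]
  (σ : Measure T) [SigmaFinite σ] [IsFiniteMeasureOnCompacts σ]
  (ν : Measure ℝ) [IsProbabilityMeasure ν] [HasExpMoment ν] (K : HermKernel T)

/-- `a⁺(f ⊗ p)` as a map of the `n`-particle part of the domain to the `(n+1)`-particle part. -/
def creaDom (f : B0 T) (p : ℝ[X]) (n : ℕ) : dom σ ν K n →ₗ[ℂ] dom σ ν K (n + 1) :=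
  ((qSym K.lift (σ.prod ν) (n + 1)).subtype ∘ₗ
    (crea K.lift (tensorPoly σ ν f p) n).toLinearMap ∘ₗ
    Submodule.inclusion (dom_le σ ν K n)).codRestrict _ fun F =>
      ⟨_, tens_mem_polyPart σ ν f p ((mem_dom σ ν K).1 F.2).1, rfl⟩

/-- `a⁻(f ⊗ p)` as a map of the `(n+1)`-particle part of the domain to the `n`-particle part. -/
def anniDom (f : B0 T) (p : ℝ[X]) (n : ℕ) : dom σ ν K (n + 1) →ₗ[ℂ] dom σ ν K n :=
  ((qSym K.lift (σ.prod ν) n).subtype ∘ₗ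
    (anni K.lift (tensorPoly σ ν f p) n).toLinearMap ∘ₗ
    Submodule.inclusion (dom_le σ ν K (n + 1))).codRestrict _ fun F => by
      change (anni K.lift (tensorPoly σ ν f p) n (Submodule.inclusion (dom_le σ ν K (n + 1)) F) :
        L2 (σ.prod ν) n) ∈ _
      rw [coe_anni]
      exact Submodule.smul_mem _ _
        ⟨_, adjoint_tens_mem_polyPart σ ν f p ((mem_dom σ ν K).1 F.2).1, rfl⟩

theorem memLp_multiplier (f : B0 T) (q : ℝ[X]) {n : ℕ} (F : dom σ ν K n) :
    MemLp (fun z => multiplier f q z * (F : L2 (σ.prod ν) n) z) 2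
      (Measure.pi fun _ : Fin n => σ.prod ν) := by
  obtain ⟨G, -, hG⟩ := isPoly_multiplier σ ν f q ((mem_dom σ ν K).1 F.2).1
  exact (memLp_congr_ae hG).1 (Lp.memLp G)

/-- `a⁰(f ⊗ q)` on the `n`-particle part of the domain: multiplication by the function
`f(t₁) q(x₁) + ⋯ + f(tₙ) q(xₙ)`. -/
def neutDom (f : B0 T) (q : ℝ[X]) (n : ℕ) : dom σ ν K n →ₗ[ℂ] dom σ ν K n where
  toFun F := ⟨(memLp_multiplier σ ν K f q F).toLp, by
    refine (mem_dom σ ν K).2 ⟨((isPoly_multiplier σ ν f q ((mem_dom σ ν K).1 F.2).1).congr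
      (memLp_multiplier σ ν K f q F).coeFn_toLp.symm).mem, (mem_qSym _ _).2 fun π => Lp.ext ?_⟩
    have hF := (mem_qSym _ _).1 ((mem_dom σ ν K).1 F.2).2 π
    filter_upwards [psi_ae K.lift (σ.prod ν) π (memLp_multiplier σ ν K f q F).toLp,
      (memLp_multiplier σ ν K f q F).coeFn_toLp,
      (measurePreserving_comp_perm (σ.prod ν) π).quasiMeasurePreserving.ae
        (memLp_multiplier σ ν K f q F).coeFn_toLp,
      psi_ae K.lift (σ.prod ν) π (F : L2 (σ.prod ν) n)] with z h1 h2 h3 h4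
    have hm : multiplier f q (fun j => z (π j)) = multiplier f q z :=
      Equiv.sum_comp π fun j => (f.toFun (z j).1 : ℂ) * ((q.eval (z j).2 : ℝ) : ℂ)
    rw [h1, h2, h3, hm, mul_left_comm, ← h4, hF]⟩
  map_add' F G := by
    refine Subtype.ext ?_
    change (memLp_multiplier σ ν K f q (F + G)).toLp = _ + _
    rw [← MemLp.toLp_add (memLp_multiplier σ ν K f q F) (memLp_multiplier σ ν K f q G),
      MemLp.toLp_eq_toLp_iff]
    filter_upwards [Lp.coeFn_add (F : L2 (σ.prod ν) n) G] with z hz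
    rw [Submodule.coe_add, hz, Pi.add_apply, Pi.add_apply, mul_add]
  map_smul' c F := by
    refine Subtype.ext ?_
    change (memLp_multiplier σ ν K f q (c • F)).toLp = c • _
    rw [← MemLp.toLp_const_smul c (memLp_multiplier σ ν K f q F), MemLp.toLp_eq_toLp_iff]
    filter_upwards [Lp.coeFn_smul c (F : L2 (σ.prod ν) n)] with z hz
    rw [Submodule.coe_smul, hz, Pi.smul_apply, Pi.smul_apply, smul_eq_mul, smul_eq_mul,
      mul_left_comm]

/-- The domain `𝔇` of all finite sequences whose `n`-particle components lie in `dom n`. -/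
def Dom : Type u := Π₀ n : ℕ, dom σ ν K n

instance : AddCommGroup (Dom σ ν K) := inferInstanceAs (AddCommGroup (Π₀ n : ℕ, dom σ ν K n))

instance : Module ℂ (Dom σ ν K) := inferInstanceAs (Module ℂ (Π₀ n : ℕ, dom σ ν K n))

/-- The creation operator `a⁺(f ⊗ p)` on the domain. -/
def aPlus (f : B0 T) (p : ℝ[X]) : Module.End ℂ (Dom σ ν K) :=
  DFinsupp.lsum ℂ fun n => DFinsupp.lsingle (n + 1) ∘ₗ creaDom σ ν K f p n

/-- The annihilation operator `a⁻(f ⊗ p)` on the domain; it maps the vacuum to zero. -/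
def aMinus (f : B0 T) (p : ℝ[X]) : Module.End ℂ (Dom σ ν K) :=
  DFinsupp.lsum ℂ fun n => match n with
    | 0 => 0
    | m + 1 => DFinsupp.lsingle m ∘ₗ anniDom σ ν K f p m

/-- The neutral operator `a⁰(f ⊗ q)` on the domain. -/
def aZero (f : B0 T) (q : ℝ[X]) : Module.End ℂ (Dom σ ν K) :=
  DFinsupp.mapRange.linearMap fun n => neutDom σ ν K f q n

/-- The operator `a⁺(f ⊗ p) + a⁰(f ⊗ x p) + a⁻(f ⊗ p)` on the domain. The choice `p = x^{k-1}` gives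
the `k`-th power jump process `X_k(f)`. -/
def jumpOp (p : ℝ[X]) (f : B0 T) : Module.End ℂ (Dom σ ν K) :=
  aPlus σ ν K f p + aZero σ ν K f (Polynomial.X * p) + aMinus σ ν K f p

/-- The `Q`-Lévy process `⟨f, ξ⟩ = a⁺(f ⊗ 1) + a⁰(f ⊗ x) + a⁻(f ⊗ 1)`. -/
def xi (f : B0 T) : Module.End ℂ (Dom σ ν K) :=
  aPlus σ ν K f 1 + aZero σ ν K f Polynomial.X + aMinus σ ν K f 1

/-- The constant function one as an element of the zero-particle space `L²(X⁰)`. -/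
def one0 {Y : Type u} [MeasurableSpace Y] (m : Measure Y) : L2 m 0 :=
  haveI : IsFiniteMeasure (Measure.pi fun _ : Fin 0 => m) := by
    rw [Measure.pi_of_empty]; infer_instance
  (memLp_const (1 : ℂ)).toLp

theorem one0_ae {Y : Type u} [MeasurableSpace Y] (m : Measure Y) :
    one0 m =ᵐ[Measure.pi fun _ : Fin 0 => m] fun _ => 1 :=
  haveI : IsFiniteMeasure (Measure.pi fun _ : Fin 0 => m) := by
    rw [Measure.pi_of_empty]; infer_instance
  (memLp_const (1 : ℂ)).coeFn_toLp

/-- The vacuum vector `Ω = (1, 0, 0, …)`. -/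
def vac : Dom σ ν K :=
  DFinsupp.single 0 ⟨one0 (σ.prod ν), (mem_dom σ ν K).2 ⟨by
    refine IsPoly.mem ((IsPoly.gen Fin.elim0 (one0 σ)).congr ?_)
    filter_upwards [one0_ae (σ.prod ν),
      (quasiMeasurePreserving_fst_pi σ ν 0).ae (one0_ae σ)] with z h1 h2
    rw [h1, h2]
    simp, (mem_qSym _ _).2 fun π => by rw [Subsingleton.elim π 1, psi_one]⟩⟩

/-- The inclusion of the `n`-particle part of the domain in the `n`-particle space. -/
def toLevel (n : ℕ) : dom σ ν K n →ₗ[ℂ] FockLevel K.lift (σ.prod ν) n :=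
  (FockLevel.of K.lift (σ.prod ν) n).toLinearMap ∘ₗ Submodule.inclusion (dom_le σ ν K n)

/-- The inclusion of the domain in the `Q`-Fock space over `L²(T × ℝ, σ ⊗ ν)`. -/
def toFock : Dom σ ν K →ₗ[ℂ] QFock K.lift (σ.prod ν) :=
  DFinsupp.lsum ℂ fun n =>
    lp.lsingle (𝕜 := ℂ) (E := fun n => FockLevel K.lift (σ.prod ν) n) 2 n ∘ₗ toLevel σ ν K n

/-- The unital algebra `𝒫` generated by the (Hermitian) operators `⟨f, ξ⟩`. -/
def PAlg : Type u := Algebra.adjoin ℂ (Set.range (xi σ ν K))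

instance : Ring (PAlg σ ν K) := inferInstanceAs (Ring (Algebra.adjoin ℂ (Set.range (xi σ ν K))))

instance : Algebra ℂ (PAlg σ ν K) :=
  inferInstanceAs (Algebra ℂ (Algebra.adjoin ℂ (Set.range (xi σ ν K))))

/-- The operator `p` on the domain. -/
def PAlg.toEnd : PAlg σ ν K →ₐ[ℂ] Module.End ℂ (Dom σ ν K) :=
  (Algebra.adjoin ℂ (Set.range (xi σ ν K))).val

/-- The vector `p Ω` of the `Q`-Fock space. -/
def PAlg.vec : PAlg σ ν K →ₗ[ℂ] QFock K.lift (σ.prod ν) :=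
  toFock σ ν K ∘ₗ (LinearMap.applyₗ (vac σ ν K)) ∘ₗ (PAlg.toEnd σ ν K).toLinearMap

/-- The scalar product `τ(p^* q) = (q Ω, p Ω)` on `𝒫` given by the vacuum state `τ`; following the
convention of the library it is conjugate linear in the first argument. -/
@[reducible] def PAlg.core : PreInnerProductSpace.Core ℂ (PAlg σ ν K) where
  inner p q := inner ℂ (PAlg.vec σ ν K p) (PAlg.vec σ ν K q)
  conj_inner_symm p q := inner_conj_symm _ _
  re_inner_nonneg p := inner_self_nonneg
  add_left p q r := by rw [map_add, inner_add_left]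
  smul_left p q c := by rw [map_smul, inner_smul_left]

instance : SeminormedAddCommGroup (PAlg σ ν K) :=
  @InnerProductSpace.Core.toSeminormedAddCommGroup ℂ (PAlg σ ν K) _ _ _ (PAlg.core σ ν K)

instance : InnerProductSpace ℂ (PAlg σ ν K) := InnerProductSpace.ofCore (PAlg.core σ ν K)

/-- The noncommutative space `L²(τ)`: the Hausdorff completion of `𝒫` (that is, the completion of
the quotient of `𝒫` by the elements of norm zero) for the scalar product `τ(p^* q)`. -/
abbrev L2Tau : Type u := UniformSpace.Completion (PAlg σ ν K)

theorem PAlg.norm_vec (p : PAlg σ ν K) : ‖PAlg.vec σ ν K p‖ = ‖p‖ := by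
  rw [← sq_eq_sq₀ (norm_nonneg _) (norm_nonneg _), @norm_sq_eq_re_inner ℂ,
    @norm_sq_eq_re_inner ℂ]
  rfl

/-- The map `p ↦ p Ω` as an isometry. -/
def PAlg.vecIsom : PAlg σ ν K →ₗᵢ[ℂ] QFock K.lift (σ.prod ν) :=
  ⟨PAlg.vec σ ν K, PAlg.norm_vec σ ν K⟩

/-- The isometry `I : L²(τ) → 𝓕^Q` extending `p ↦ p Ω`. -/
def gns : L2Tau σ ν K →ₗᵢ[ℂ] QFock K.lift (σ.prod ν) where
  toLinearMap := ((PAlg.vecIsom σ ν K).toContinuousLinearMap.extend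
    (UniformSpace.Completion.toComplL (𝕜 := ℂ) (E := PAlg σ ν K))).toLinearMap
  norm_map' x := by
    induction x using UniformSpace.Completion.induction_on with
    | hp => exact isClosed_eq (ContinuousLinearMap.continuous _).norm continuous_norm
    | ih p =>
      refine (congrArg norm (ContinuousLinearMap.extend_eq _
        UniformSpace.Completion.denseRange_coe
        (UniformSpace.Completion.isUniformInducing_coe _) p)).trans ?_
      rw [UniformSpace.Completion.norm_coe]
      exact PAlg.norm_vec σ ν K p

theorem gns_coe (p : PAlg σ ν K) : gns σ ν K (p : L2Tau σ ν K) = PAlg.vec σ ν K p :=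
  ContinuousLinearMap.extend_eq (PAlg.vecIsom σ ν K).toContinuousLinearMap
    (e := UniformSpace.Completion.toComplL) UniformSpace.Completion.denseRange_coe
    (UniformSpace.Completion.isUniformInducing_coe _) p

end DomainOperators

section Chaos

/-- The monic orthogonal polynomials `p⁽ᵏ⁾` of `ν`, obtained from the monomials by orthogonalization;
`p⁽ᵏ⁾ = 0` if the result vanishes `ν`-a.e., i.e. if the support of `ν` has at most `k` points. -/
def orthPoly (ν : Measure ℝ) (k : ℕ) : ℝ[X] :=
  let q : ℝ[X] := Polynomial.X ^ k - ∑ j : Fin k,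
    C ((∫ x, x ^ k * (orthPoly ν j).eval x ∂ν) / ∫ x, (orthPoly ν j).eval x ^ 2 ∂ν) * orthPoly ν j
  haveI := Classical.dec (∫ x, q.eval x ^ 2 ∂ν = 0)
  if ∫ x, q.eval x ^ 2 ∂ν = 0 then 0 else q
termination_by k
decreasing_by all_goals exact Fin.is_lt _

/-- `C_k = ∫ |p⁽ᵏ⁾(x)|² ν(dx)`. -/
def normC (ν : Measure ℝ) (k : ℕ) : ℝ := ∫ x, (orthPoly ν k).eval x ^ 2 ∂ν

variable {T : Type u} [TopologicalSpace T] [MeasurableSpace T]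
  (σ : Measure T) [SigmaFinite σ] [IsFiniteMeasureOnCompacts σ]
  (ν : Measure ℝ) [IsProbabilityMeasure ν] [HasExpMoment ν] (K : HermKernel T)

/-- The orthogonalized power jump process
`Y_k(f) = a⁺(f ⊗ p⁽ᵏ⁾) + a⁰(f ⊗ x p⁽ᵏ⁾) + a⁻(f ⊗ p⁽ᵏ⁾)`; by the three-term recursion,
`x p⁽ᵏ⁾ = p⁽ᵏ⁺¹⁾ + b_k p⁽ᵏ⁾ + a_k p⁽ᵏ⁻¹⁾`. -/
def powerJumpY (k : ℕ) (f : B0 T) : Module.End ℂ (Dom σ ν K) := jumpOp σ ν K (orthPoly ν k) f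

/-- The bounded operator `S : L²(Tⁿ, σⁿ) → L²(τ)` is the multiple stochastic integral
`f ↦ ∫ f(t₁, …, tₙ) Y_{k₁}(dt₁) ⋯ Y_{kₙ}(dtₙ)`: for mutually disjoint measurable pre-compact sets
`Δ₁, …, Δₙ`, the integral of `χ_{Δ₁}(t₁) ⋯ χ_{Δₙ}(tₙ)` is `Y_{k₁}(Δ₁) ⋯ Y_{kₙ}(Δₙ)`, understood as
the element of `L²(τ)` whose image under `I` is the vector `Y_{k₁}(Δ₁) ⋯ Y_{kₙ}(Δₙ) Ω`. -/
def IsMultipleIntegral {n : ℕ} (k : Fin n → ℕ) (S : L2 σ n →L[ℂ] L2Tau σ ν K) : Prop :=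
  ∀ (Δ : Fin n → Set T) (hΔ : ∀ j, MeasurableSet (Δ j)) (hc : ∀ j, IsCompact (closure (Δ j))),
    Pairwise (Function.onFun Disjoint Δ) →
    ∀ g : L2 σ n, g =ᵐ[Measure.pi fun _ : Fin n => σ]
        (fun t => ∏ j, (Δ j).indicator (fun _ => (1 : ℂ)) (t j)) →
      gns σ ν K (S g) = toFock σ ν K
        ((List.ofFn fun j => powerJumpY σ ν K (k j) (B0.indicator (Δ j) (hΔ j) (hc j))).prod (vac σ ν K))

/-- A bound for the support of `α`: `α i = 0` for `i ≥ blocks α`. -/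
def blocks (α : ℕ →₀ ℕ) : ℕ := α.support.sup Nat.succ

/-- The length `|α| = α₀ + α₁ + ⋯`. -/
abbrev deg (α : ℕ →₀ ℕ) : ℕ := ∑ i : Fin (blocks α), α i

/-- The multi-index `(0, …, 0, 1, …, 1, 2, …, 2, …)` in which `i` occurs `α i` times. -/
def idx (α : ℕ →₀ ℕ) (j : Fin (deg α)) : ℕ :=
  ((finSigmaFinEquiv (n := fun i : Fin (blocks α) => α i)).symm j).1

/-- The Hilbert space tensor product `H^{⊛ α₀} ⊗ H^{⊛ α₁} ⊗ ⋯` inside `L²(T^{|α|}, σ^{|α|})`: the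
closed linear span of the products `f₀(t₁, …, t_{α₀}) f₁(t_{α₀+1}, …, t_{α₀+α₁}) ⋯` with
`fᵢ ∈ H^{⊛ αᵢ}`. -/
def blockSym {T : Type u} [MeasurableSpace T] (σ : Measure T) [SigmaFinite σ] (K : HermKernel T)
    (α : ℕ →₀ ℕ) : Submodule ℂ (L2 σ (deg α)) :=
  (Submodule.span ℂ {g : L2 σ (deg α) | ∃ f : ∀ i : Fin (blocks α), qSym K σ (α i),
    g =ᵐ[Measure.pi fun _ : Fin (deg α) => σ] fun t =>
      ∏ i : Fin (blocks α), (f i : L2 σ (α i)) fun l =>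
        t (finSigmaFinEquiv (n := fun i : Fin (blocks α) => α i) ⟨i, l⟩)}).topologicalClosure

/-- The multi-indices `α` with `C_i > 0` whenever `α_i > 0`. These are all multi-indices if the
support of `ν` is infinite; otherwise the condition excludes those with `p⁽ⁱ⁾ = 0` for some `i` with
`α_i > 0`. -/
def Multi (ν : Measure ℝ) : Type := {α : ℕ →₀ ℕ // ∀ i, α i ≠ 0 → 0 < normC ν i}

/-- The weight `∏ i, α_i! C_i^{α_i}`. -/
def weight (ν : Measure ℝ) (α : Multi ν) : Set.Ioi (0 : ℝ) :=
  ⟨∏ i : Fin (blocks α.1), ((α.1 i).factorial : ℝ) * normC ν i ^ α.1 i, Set.mem_Ioi.2 <| by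
    refine Finset.prod_pos fun i _ => mul_pos (by exact_mod_cast (α.1 i).factorial_pos) ?_
    by_cases h : α.1 i = 0
    · simp [h]
    · exact pow_pos (α.2 i h) _⟩

/-- The Hilbert space `𝔽_α = H^{⊛ α₀} ⊗ H^{⊛ α₁} ⊗ ⋯ (∏ i, α_i! C_i^{α_i})`. -/
def FAlpha {T : Type u} [MeasurableSpace T] (σ : Measure T) [SigmaFinite σ] (ν : Measure ℝ)
    (K : HermKernel T) (α : Multi ν) : Type u :=
  Scaled (weight ν α) (blockSym σ K α.1)

instance {T : Type u} [MeasurableSpace T] (σ : Measure T) [SigmaFinite σ] (ν : Measure ℝ)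
    (K : HermKernel T) (α : Multi ν) :
    NormedAddCommGroup (FAlpha σ ν K α) :=
  inferInstanceAs (NormedAddCommGroup (Scaled _ (blockSym σ K α.1)))

instance {T : Type u} [MeasurableSpace T] (σ : Measure T) [SigmaFinite σ] (ν : Measure ℝ)
    (K : HermKernel T) (α : Multi ν) :
    InnerProductSpace ℂ (FAlpha σ ν K α) :=
  inferInstanceAs (InnerProductSpace ℂ (Scaled _ (blockSym σ K α.1)))

instance {T : Type u} [MeasurableSpace T] (σ : Measure T) [SigmaFinite σ] (ν : Measure ℝ)
    (K : HermKernel T) (α : Multi ν) :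
    CompleteSpace (FAlpha σ ν K α) :=
  haveI : CompleteSpace (blockSym σ K α.1) :=
    (Submodule.isClosed_topologicalClosure _).completeSpace_coe
  inferInstanceAs (CompleteSpace (Scaled _ (blockSym σ K α.1)))

/-- The Hilbert direct sum of the spaces `𝔽_α`. -/
abbrev ChaosSpace {T : Type u} [MeasurableSpace T] (σ : Measure T) [SigmaFinite σ] (ν : Measure ℝ)
    (K : HermKernel T) : Type u :=
  lp (fun α : Multi ν => FAlpha σ ν K α) 2

/-- The element of `𝔽_α` as a function in `L²(T^{|α|}, σ^{|α|})`. -/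
def FAlpha.fn {T : Type u} [MeasurableSpace T] {σ : Measure T} [SigmaFinite σ] {ν : Measure ℝ}
    {K : HermKernel T} {α : Multi ν} (f : FAlpha σ ν K α) : L2 σ (deg α.1) :=
  ((Scaled.of (weight ν α) (blockSym σ K α.1)).symm f : blockSym σ K α.1)

end Chaos


end QLevy

end

open QLevy

set_option linter.unusedSectionVars false
noncomputable section
namespace QLevy

-- Everything rests on one approximation. Let the vector `E` contain no particle over the set Δ. The
-- first application of ξ(Δ) = ⟨χ_Δ, ξ⟩ to `E` can only create a particle in Δ. Each further
-- application, to first order in σ(Δ), either multiplies by the jump size x of that particle or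
-- annihilates it and leaves a scalar. Hence ξ(Δ)^(k+1) E = a⁺(χ_Δ ⊗ x^k) E + c σ(Δ) E + remainder,
-- where c is the moment of ν of order k - 1 (and c = 0 for k = 0).
--
-- Since σ has no atoms, Δ splits into cells of measure at most δ. Apply the expansion to every
-- cell, subtract the scalars and sum: the creation terms add up to a⁺(χ_Δ ⊗ x^k) E. If `E` has n
-- particles, the remainder of a cell of measure v has norm O(v²) in the l-particle spaces with l ≤
-- n, and these norms sum to O(δ). For l > n the squared norm is O(v²), and remainders of different
-- cells are orthogonal, because their additional particles lie in different cells; so the squares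
-- sum to O(δ). Thus a⁺(χ_Δ ⊗ x^k) E is a limit of vectors `A E` with `A` in the algebra of Δ
-- (`exists_norm_sum_xiRem_le`, `aPlus_mem_closure`). The neutral operator is unbounded, so the
-- estimates use weighted norms that control every power of x.
--
-- Surjectivity of I: iterating over disjoint sets puts P_n of every χ_{Δ₁} ⊗ ⋯ ⊗ χ_{Δₙ} x₁^{i₁} ⋯
-- xₙ^{iₙ} into the range, which is closed (`prod_aPlus_mem_closure`). Disjoint boxes are total
-- because the diagonals are null (`total_disjointSets`), and polynomials are total because of the
-- exponential moment (`total_monomial`).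
--
-- Multiple integrals: on the vacuum and over disjoint sets only the creation parts of the Y_k act
-- (`prod_jumpOp_vac`). So the integral must be f ↦ I⁻¹ P_n[f ∏ p^(k_j)(x_j)], which is bounded in
-- f, and density gives uniqueness.
--
-- Chaos decomposition: the inner product of two such vectors is a sum over permutations π of ⟨f,
-- Ψ_π g⟩ times integrals of products of orthogonal polynomials. Only permutations carrying one
-- index sequence to the other survive (`inner_fockMap_polyMul`). Different multi-indices therefore
-- give orthogonal ranges. For one α the surviving permutations form ∏ S_{α_i}; they fix the
-- block-symmetric functions and produce the weight ∏ α_i! C_i^{α_i} (`inner_fockMap_idx`). Sorting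
-- the indices and symmetrizing the blocks does not change the vector, so the ranges span
-- (`fockMap_polyMul_mem`).

universe u


/-! ### Total families in L² and their products -/

section Total

/-- A family of functions is total in `L²` if only the zero function has vanishing integrals against
all of them. -/
def Total {Y ι : Type*} [MeasurableSpace Y] (m : Measure Y) (u : ι → Y → ℂ) : Prop :=
  ∀ h : Y → ℂ, MemLp h 2 m → (∀ i, ∫ y, u i y * h y ∂m = 0) → h =ᵐ[m] 0

variable {Y Z : Type*} [MeasurableSpace Y] [MeasurableSpace Z] {m : Measure Y} {m' : Measure Z}

theorem integrable_norm_sq_of_memLp {f : Y → ℂ} (hf : MemLp f 2 m) :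
    Integrable (fun y => ‖f y‖ ^ 2) m :=
  (memLp_two_iff_integrable_sq_norm hf.1).1 hf

theorem norm_integral_mul_sq_le {f g : Y → ℂ} (hf : MemLp f 2 m) (hg : MemLp g 2 m) :
    ‖∫ y, f y * g y ∂m‖ ^ 2 ≤ (∫ y, ‖f y‖ ^ 2 ∂m) * ∫ y, ‖g y‖ ^ 2 ∂m := by
  have h1 : ‖∫ y, f y * g y ∂m‖ ≤ ∫ y, ‖f y‖ * ‖g y‖ ∂m := by
    refine (norm_integral_le_integral_norm _).trans_eq ?_
    simp_rw [norm_mul]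
  have h2 := integral_mul_norm_le_Lp_mul_Lq (μ := m) (f := f) (g := g)
    (Real.HolderConjugate.two_two) (by simpa using hf) (by simpa using hg)
  have e1 : ∀ f : Y → ℂ, (∫ y, ‖f y‖ ^ (2 : ℝ) ∂m) = ∫ y, ‖f y‖ ^ 2 ∂m := fun f => by
    simp only [Real.rpow_two]
  rw [e1, e1, ← Real.sqrt_eq_rpow, ← Real.sqrt_eq_rpow] at h2
  have h3 := pow_le_pow_left₀ (norm_nonneg _) (h1.trans h2) 2
  rwa [mul_pow, Real.sq_sqrt (integral_nonneg fun _ => by positivity),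
    Real.sq_sqrt (integral_nonneg fun _ => by positivity)] at h3

theorem ae_memLp_slice [SFinite m'] [SFinite m] {F : Y × Z → ℂ} (hF : MemLp F 2 (m.prod m')) :
    ∀ᵐ y ∂m, MemLp (fun z => F (y, z)) 2 m' := by
  have h1 := hF.1.prodMk_left
  have h2 := (integrable_norm_sq_of_memLp hF).prod_right_ae
  filter_upwards [h1, h2] with y h1 h2
  exact (memLp_two_iff_integrable_sq_norm h1).2 h2

/-- Cauchy–Schwarz in the second variable bounds the square by ‖v‖² times the squared norm of the
slice, which is integrable by Fubini. -/
theorem memLp_partial_integral [SFinite m'] [SFinite m] {F : Y × Z → ℂ}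
    (hF : MemLp F 2 (m.prod m')) {v : Z → ℂ} (hv : MemLp v 2 m') :
    MemLp (fun y => ∫ z, v z * F (y, z) ∂m') 2 m := by
  have hm : AEStronglyMeasurable (fun y => ∫ z, v z * F (y, z) ∂m') m :=
    (hv.1.comp_snd.mul hF.1).integral_prod_right'
  rw [memLp_two_iff_integrable_sq_norm hm]
  refine ((integrable_norm_sq_of_memLp hF).integral_prod_left.const_mul
    (∫ z, ‖v z‖ ^ 2 ∂m')).mono' (hm.norm.pow 2) ?_
  filter_upwards [ae_memLp_slice hF] with y hy
  rw [norm_pow, norm_norm]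
  exact norm_integral_mul_sq_le hv hy

/-- The partial integrals against the `v j` lie in L² and are annihilated by all `u i`, so each
vanishes almost everywhere. Countability of `κ` merges the exceptional sets into one null set, off
which the slices are annihilated by all `v j`. The other index set may be uncountable. -/
theorem Total.prod {ι κ : Type*} [Countable κ] [SFinite m] [SFinite m'] {u : ι → Y → ℂ}
    {v : κ → Z → ℂ} (hu : Total m u) (hv : Total m' v) (hu2 : ∀ i, MemLp (u i) 2 m)
    (hv2 : ∀ j, MemLp (v j) 2 m') :
    Total (m.prod m') fun (ij : ι × κ) p => u ij.1 p.1 * v ij.2 p.2 := by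
  intro F hF h0
  have key : ∀ j, (fun y => ∫ z, v j z * F (y, z) ∂m') =ᵐ[m] 0 := fun j => by
    refine hu _ (memLp_partial_integral hF (hv2 j)) fun i => ?_
    rw [← h0 (i, j), integral_prod]
    · refine integral_congr_ae (Filter.Eventually.of_forall fun y => ?_)
      simp only [mul_assoc, integral_const_mul]
    · exact (memLp_mul_prod (hu2 i) (hv2 j)).integrable_mul hF
  have h2 : ∀ᵐ y ∂m, (fun z => F (y, z)) =ᵐ[m'] 0 := by
    filter_upwards [ae_memLp_slice hF, ae_all_iff.2 key] with y h1 h2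
    exact hv _ h1 h2
  have h3 : ∫ p, ‖F p‖ ^ 2 ∂(m.prod m') = 0 := by
    rw [integral_prod _ (integrable_norm_sq_of_memLp hF)]
    refine integral_eq_zero_of_ae ?_
    filter_upwards [h2] with y hy
    refine integral_eq_zero_of_ae ?_
    filter_upwards [hy] with z hz
    simpa using hz
  filter_upwards [(integral_eq_zero_iff_of_nonneg (fun _ => by positivity)
    (integrable_norm_sq_of_memLp hF)).1 h3] with p hp
  simpa using hp

theorem Total.comp_measurePreserving {ι : Type*} {u : ι → Z → ℂ} (hu : Total m' u) (e : Y ≃ᵐ Z)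
    (he : MeasurePreserving e m m') : Total m fun i y => u i (e y) := by
  intro h hh h0
  have hs := he.symm
  have h1 := hu (fun z => h (e.symm z)) (hh.comp_measurePreserving hs) fun i => by
    rw [← h0 i, ← he.integral_comp']
    simp
  have := he.quasiMeasurePreserving.ae h1
  filter_upwards [this] with y hy
  simpa using hy

/-- Totality says that the orthogonal complement is trivial; the conjugate appears because the inner
product is conjugate linear in its first argument. -/
theorem Total.dense_span {Y : Type u} [MeasurableSpace Y] {m : Measure Y} {ι : Type*}
    {u : ι → Lp ℂ 2 m} (hu : Total m fun i y => conj (u i y)) :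
    (Submodule.span ℂ (Set.range u)).topologicalClosure = ⊤ := by
  rw [Submodule.topologicalClosure_eq_top_iff, Submodule.eq_bot_iff]
  intro h hh
  refine Lp.ext ((hu h (Lp.memLp h) fun i => ?_).trans (Lp.coeFn_zero _ _ _).symm)
  have := (Submodule.mem_orthogonal _ _).1 hh (u i) (Submodule.subset_span ⟨i, rfl⟩)
  rw [L2.inner_def] at this
  rw [← this]
  refine integral_congr_ae (Filter.Eventually.of_forall fun y => ?_)
  simp [mul_comm]

end Total

/-! ### Density of polynomials under an exponential moment -/

section Moments
open ProbabilityTheory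

/-- The complex moment generating functions are analytic in the strip |Re z| < ε and have the same
derivatives at 0, so they agree on the strip. On the imaginary axis they are the characteristic
functions. -/
theorem eq_of_moments_eq {μ μ' : Measure ℝ} [IsFiniteMeasure μ] [IsFiniteMeasure μ'] {ε : ℝ}
    (hε : 0 < ε) (h1 : Set.Ioo (-ε) ε ⊆ integrableExpSet id μ)
    (h2 : Set.Ioo (-ε) ε ⊆ integrableExpSet id μ')
    (h : ∀ n : ℕ, ∫ x, x ^ n ∂μ = ∫ x, x ^ n ∂μ') : μ = μ' := by
  have i1 := interior_maximal h1 isOpen_Ioo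
  have i2 := interior_maximal h2 isOpen_Ioo
  set U : Set ℂ := Complex.re ⁻¹' Set.Ioo (-ε) ε with hU
  have a1 : AnalyticOnNhd ℂ (complexMGF id μ) U := fun z hz => analyticAt_complexMGF (i1 hz)
  have a2 : AnalyticOnNhd ℂ (complexMGF id μ') U := fun z hz => analyticAt_complexMGF (i2 hz)
  have h0 : (0 : ℂ) ∈ U := by simp [hU, hε]
  have hc : IsPreconnected U :=
    ((convex_Ioo (-ε) ε).linear_preimage Complex.reLm).isPreconnected
  have s1 := (a1 0 h0).hasFPowerSeriesAt
  have s2 := (a2 0 h0).hasFPowerSeriesAt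
  have e : ∀ n, iteratedDeriv n (complexMGF id μ) 0 = iteratedDeriv n (complexMGF id μ') 0 := by
    intro n
    rw [iteratedDeriv_complexMGF (i1 h0), iteratedDeriv_complexMGF (i2 h0)]
    have := congrArg (fun r : ℝ => (r : ℂ)) (h n)
    simpa [← integral_complex_ofReal] using this
  simp_rw [e] at s1
  have hev : complexMGF id μ =ᶠ[nhds 0] complexMGF id μ' := by
    have := (s1.sub s2)
    rw [sub_self] at this
    filter_upwards [this.eventually_eq_zero] with z hz
    exact sub_eq_zero.1 hz
  have := a1.eqOn_of_preconnected_of_eventuallyEq a2 hc h0 hev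
  refine Measure.ext_of_charFun (funext fun t => ?_)
  rw [← complexMGF_id_mul_I, ← complexMGF_id_mul_I]
  exact this (by simp [hU, hε])

variable (ν : Measure ℝ) [IsProbabilityMeasure ν] [HasExpMoment ν]

/-- The finite measures h⁺ν and h⁻ν have the same moments, and both have exponential moments. Hence
they coincide, so h⁺ = h⁻ almost everywhere, which forces h = 0. -/
theorem real_ae_zero_of_moments {h : ℝ → ℝ} (hh : MemLp h 2 ν)
    (h0 : ∀ n : ℕ, ∫ x, x ^ n * h x ∂ν = 0) : h =ᵐ[ν] 0 := by
  obtain ⟨ε, hε, hexp⟩ := HasExpMoment.exists_integrable (ν := ν)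
  -- Halving ε makes the exponential square integrable, so that by Cauchy–Schwarz it stays
  -- integrable against a density from L².
  have hL : ∀ t ∈ Set.Ioo (-(ε / 2)) (ε / 2), MemLp (fun x => Real.exp (t * x)) 2 ν := fun t ht => by
    rw [memLp_two_iff_integrable_sq (by fun_prop)]
    refine hexp.mono' (by fun_prop) (Filter.Eventually.of_forall fun x => ?_)
    rw [Real.norm_eq_abs, abs_of_nonneg (by positivity), ← Real.exp_nat_mul, Real.exp_le_exp]
    have h1 : t * x ≤ |t| * |x| := by rw [← abs_mul]; exact le_abs_self _
    have h2 : |t| ≤ ε / 2 := (abs_lt.2 ht).le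
    push_cast
    nlinarith [mul_le_mul_of_nonneg_right h2 (abs_nonneg x)]
  have hP : ∀ n : ℕ, MemLp (fun x : ℝ => x ^ n) 2 ν := fun n => by
    rw [memLp_two_iff_integrable_sq (by fun_prop)]
    simp_rw [← pow_mul]
    exact integrable_pow ν _
  have fin : ∀ k : ℝ → ℝ, MemLp k 2 ν →
      IsFiniteMeasure (ν.withDensity fun x => ENNReal.ofReal (k x)) := fun k hk =>
    isFiniteMeasure_withDensity_ofReal (hk.integrable one_le_two).2
  have wd : ∀ k : ℝ → ℝ, MemLp k 2 ν → ∀ g : ℝ → ℝ, MemLp g 2 ν →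
      Integrable g (ν.withDensity fun x => ENNReal.ofReal (k x)) := fun k hk g hg => by
    rw [integrable_withDensity_iff_integrable_smul₀' hk.1.aemeasurable.ennreal_ofReal
      (Filter.Eventually.of_forall fun x => ENNReal.ofReal_lt_top)]
    refine (hk.norm.integrable_mul hg.norm).mono' ?_ (Filter.Eventually.of_forall fun x => ?_)
    · exact (hk.1.aemeasurable.ennreal_ofReal).ennreal_toReal.aestronglyMeasurable.smul hg.1
    · rw [ENNReal.toReal_ofReal', norm_smul, Real.norm_eq_abs, abs_of_nonneg (le_max_right _ _)]
      exact mul_le_mul_of_nonneg_right (max_le (le_abs_self _) (abs_nonneg _)) (norm_nonneg _)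
  have hsub : ∀ k : ℝ → ℝ, MemLp k 2 ν → Set.Ioo (-(ε / 2)) (ε / 2) ⊆
      integrableExpSet id (ν.withDensity fun x => ENNReal.ofReal (k x)) :=
    fun k hk t ht => wd k hk _ (hL t ht)
  have hn : MemLp (fun x => - h x) 2 ν := hh.neg
  have := fin h hh
  have := fin (fun x => - h x) hn
  -- Since `ENNReal.ofReal` truncates at zero, the two densities are the positive and the negative
  -- part of `h`.
  have heq : (ν.withDensity fun x => ENNReal.ofReal (h x)) =
      ν.withDensity fun x => ENNReal.ofReal (- h x) := by
    refine eq_of_moments_eq (half_pos hε) (hsub h hh) (hsub _ hn) fun n => ?_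
    have ev : ∀ k : ℝ → ℝ, MemLp k 2 ν →
        ∫ x, x ^ n ∂(ν.withDensity fun x => ENNReal.ofReal (k x)) =
          ∫ x, max (k x) 0 * x ^ n ∂ν := fun k hk => by
      rw [integral_withDensity_eq_integral_toReal_smul₀ hk.1.aemeasurable.ennreal_ofReal
        (Filter.Eventually.of_forall fun x => ENNReal.ofReal_lt_top)]
      simp_rw [ENNReal.toReal_ofReal', smul_eq_mul]
    have hmax : ∀ k : ℝ → ℝ, MemLp k 2 ν → MemLp (fun x => max (k x) 0) 2 ν := fun k hk =>
      hk.of_le (hk.1.sup aestronglyMeasurable_const) (Filter.Eventually.of_forall fun x => by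
        rw [Real.norm_eq_abs, Real.norm_eq_abs, abs_of_nonneg (le_max_right _ _)]
        exact max_le (le_abs_self _) (abs_nonneg _))
    have hi : ∀ k : ℝ → ℝ, MemLp k 2 ν → Integrable (fun x => max (k x) 0 * x ^ n) ν :=
      fun k hk => (hmax k hk).integrable_mul (hP n)
    rw [ev h hh, ev _ hn, ← sub_eq_zero, ← integral_sub (hi h hh) (hi _ hn)]
    refine (integral_congr_ae (Filter.Eventually.of_forall fun x => ?_)).trans (h0 n)
    change max (h x) 0 * x ^ n - max (-h x) 0 * x ^ n = x ^ n * h x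
    rcases le_total 0 (h x) with hx | hx
    · rw [max_eq_left hx, max_eq_right (neg_nonpos.2 hx)]
      ring
    · rw [max_eq_right hx, max_eq_left (neg_nonneg.2 hx)]
      ring
  have := (withDensity_eq_iff hh.1.aemeasurable.ennreal_ofReal hn.1.aemeasurable.ennreal_ofReal
    (by
      have := (isFiniteMeasure_withDensity_ofReal (hh.integrable one_le_two).2).measure_univ_lt_top
      rw [withDensity_apply _ MeasurableSet.univ, Measure.restrict_univ] at this
      exact this.ne)).1 heq
  filter_upwards [this] with x hx
  rcases le_total 0 (h x) with hx' | hx'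
  · have h2 : ENNReal.ofReal (- h x) = 0 := ENNReal.ofReal_of_nonpos (by linarith)
    exact le_antisymm (ENNReal.ofReal_eq_zero.1 (hx.trans h2)) hx'
  · have h2 : ENNReal.ofReal (h x) = 0 := ENNReal.ofReal_of_nonpos hx'
    have := ENNReal.ofReal_eq_zero.1 (hx.symm.trans h2)
    simp only [Pi.zero_apply]
    linarith

theorem memLp_pow (n : ℕ) : MemLp (fun x : ℝ => (x : ℂ) ^ n) 2 ν := by
  have := memLp_eval ν (Polynomial.X ^ n)
  simpa using this

theorem total_pow : Total ν fun (n : ℕ) (x : ℝ) => (x : ℂ) ^ n := by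
  intro h hh h0
  have hre : MemLp (fun x => (h x).re) 2 ν := hh.re
  have him : MemLp (fun x => (h x).im) 2 ν := hh.im
  have hi : ∀ n, Integrable (fun x : ℝ => (x : ℂ) ^ n * h x) ν :=
    fun n => (memLp_pow ν n).integrable_mul hh
  have e1 := real_ae_zero_of_moments ν hre fun n => by
    have := congrArg Complex.re (h0 n)
    rw [← RCLike.re_eq_complex_re, ← integral_re (hi n)] at this
    simpa [← Complex.ofReal_pow] using this
  have e2 := real_ae_zero_of_moments ν him fun n => by
    have := congrArg Complex.im (h0 n)
    rw [← RCLike.im_eq_complex_im, ← integral_im (hi n)] at this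
    simpa [← Complex.ofReal_pow] using this
  filter_upwards [e1, e2] with x h1 h2
  exact Complex.ext h1 h2

theorem memLp_monomial {n : ℕ} (i : Fin n → ℕ) :
    MemLp (fun x : Fin n → ℝ => ∏ j, (x j : ℂ) ^ i j) 2 (Measure.pi fun _ => ν) := by
  have hm : Continuous fun x : Fin n → ℝ => ∏ j, (x j : ℂ) ^ i j := by fun_prop
  rw [memLp_two_iff_integrable_sq_norm hm.aestronglyMeasurable]
  refine (Integrable.fintype_prod (𝕜 := ℝ) (f := fun (j : Fin n) (x : ℝ) => x ^ (2 * i j))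
    fun j => integrable_pow ν _).congr (Filter.Eventually.of_forall fun x => ?_)
  simp only [norm_prod, norm_pow, Complex.norm_real, Real.norm_eq_abs, ← Finset.prod_pow]
  exact Finset.prod_congr rfl fun j _ => by
    rw [← pow_mul, mul_comm (i j) 2, pow_mul, pow_mul, sq_abs]

theorem total_monomial (n : ℕ) : Total (Measure.pi fun _ : Fin n => ν)
    fun (i : Fin n → ℕ) (x : Fin n → ℝ) => ∏ j, (x j : ℂ) ^ i j := by
  induction n with
  | zero =>
    intro h hh h0
    have := h0 Fin.elim0
    rw [Measure.pi_of_empty, integral_dirac] at this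
    rw [Measure.pi_of_empty]
    filter_upwards with x
    simpa [Subsingleton.elim x isEmptyElim] using this
  | succ n ih =>
    have h1 := ((total_pow ν).prod ih (memLp_pow ν) (memLp_monomial ν)).comp_measurePreserving
      (MeasurableEquiv.piFinSuccAbove (fun _ : Fin (n + 1) => ℝ) 0)
      (measurePreserving_piFinSuccAbove (fun _ : Fin (n + 1) => ν) 0)
    intro h hh h0
    refine h1 h hh fun ij => ?_
    rw [← h0 (Fin.cons ij.1 ij.2)]
    simp [Fin.prod_univ_succ, MeasurableEquiv.piFinSuccAbove, Fin.insertNthEquiv]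
    rfl

variable {T : Type u} [MeasurableSpace T] (σ : Measure T) [SigmaFinite σ]

/-- Testing `h` against its own conjugate gives ∫ ‖h‖² = 0. -/
theorem total_coe {Y : Type*} [MeasurableSpace Y] (m : Measure Y) :
    Total m fun (f : Lp ℂ 2 m) y => f y := by
  intro h hh h0
  have := h0 (hh.star.toLp)
  have e : ∫ y, ‖h y‖ ^ 2 ∂m = 0 := by
    have h2 : ∫ y, ((‖h y‖ ^ 2 : ℝ) : ℂ) ∂m = 0 := by
      rw [← this]
      refine integral_congr_ae ?_
      filter_upwards [hh.star.coeFn_toLp] with y hy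
      rw [hy, Pi.star_apply, RCLike.star_def, mul_comm, Complex.mul_conj, Complex.normSq_eq_norm_sq]
    rw [integral_complex_ofReal] at h2
    exact_mod_cast h2
  filter_upwards [(integral_eq_zero_iff_of_nonneg (fun _ => by positivity)
    (integrable_norm_sq_of_memLp hh)).1 e] with p hp
  simpa using hp

theorem dense_polyPart (n : ℕ) : (polyPart σ ν n).topologicalClosure = ⊤ := by
  have h1 := ((total_coe (Measure.pi fun _ : Fin n => σ)).prod (total_monomial ν n)
    (fun f => Lp.memLp f) (memLp_monomial ν)).comp_measurePreserving
      (MeasurableEquiv.arrowProdEquivProdArrow T ℝ (Fin n))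
      (measurePreserving_arrowProdEquivProdArrow T ℝ (Fin n) (fun _ => σ) (fun _ => ν))
  have h2 : Total (Measure.pi fun _ : Fin n => σ.prod ν)
      fun (p : L2 σ n × (Fin n → ℕ)) z => conj (polyElt ν p.2 p.1 z) := by
    intro h hh h0
    refine h1 h hh fun p => ?_
    -- The monomials are real, so the conjugation only replaces f by its conjugate, another element
    -- of L².
    rw [← h0 ((Lp.memLp p.1).star.toLp, p.2)]
    refine integral_congr_ae ?_
    filter_upwards [polyElt_ae σ ν p.2 ((Lp.memLp p.1).star.toLp),
      (quasiMeasurePreserving_fst_pi σ ν n).ae (Lp.memLp p.1).star.coeFn_toLp] with z h1 h2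
    rw [h1, h2]
    simp [MeasurableEquiv.arrowProdEquivProdArrow, Equiv.arrowProdEquivProdArrow]
  rw [← h2.dense_span]
  have : {F | ∃ (i : Fin n → ℕ) (f : L2 σ n), F = polyElt ν i f} =
      Set.range fun p : L2 σ n × (Fin n → ℕ) => polyElt ν p.2 p.1 := by
    ext F
    constructor
    · rintro ⟨i, f, rfl⟩
      exact ⟨(f, i), rfl⟩
    · rintro ⟨⟨f, i⟩, rfl⟩
      exact ⟨i, f, rfl⟩
  rw [polyPart, this]

end Moments

/-! ### Boxes with disjoint sides and fine partitions for a non-atomic measure -/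

section Rectangles

variable {T : Type u} [TopologicalSpace T] [PolishSpace T] [LocallyCompactSpace T]
    [MeasurableSpace T] [BorelSpace T] (σ : Measure T) [IsLocallyFiniteMeasure σ]

/-- A finite family of mutually disjoint measurable pre-compact sets. -/
structure DisjointSets (T : Type u) [TopologicalSpace T] [MeasurableSpace T] (n : ℕ) where
  /-- the sets -/
  set : Fin n → Set T
  meas : ∀ j, MeasurableSet (set j)
  compact : ∀ j, IsCompact (closure (set j))
  disj : Pairwise (Function.onFun Disjoint set)

/-- The indicator function of the product of the sets. -/
def DisjointSets.fn {T : Type u} [TopologicalSpace T] [MeasurableSpace T] {n : ℕ}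
    (D : DisjointSets T n) (t : Fin n → T) : ℂ := ∏ j, (D.set j).indicator (fun _ => (1 : ℂ)) (t j)

theorem DisjointSets.fn_eq {n : ℕ} (D : DisjointSets T n) :
    D.fn = (Set.univ.pi D.set).indicator fun _ => (1 : ℂ) := by
  ext t
  by_cases h : t ∈ Set.univ.pi D.set
  · rw [Set.indicator_of_mem h]
    exact Finset.prod_eq_one fun j _ => Set.indicator_of_mem (h j trivial) _
  · rw [Set.indicator_of_notMem h]
    simp only [Set.mem_pi, Set.mem_univ, true_imp_iff, not_forall] at h
    obtain ⟨j, hj⟩ := h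
    exact Finset.prod_eq_zero (Finset.mem_univ j) (Set.indicator_of_notMem hj _)

theorem DisjointSets.measure_lt_top {n : ℕ} (D : DisjointSets T n) :
    (Measure.pi fun _ : Fin n => σ) (Set.univ.pi D.set) < ∞ := by
  rw [Measure.pi_pi]
  exact ENNReal.prod_lt_top fun j _ =>
    (measure_mono subset_closure).trans_lt (D.compact j).measure_lt_top

theorem DisjointSets.memLp {n : ℕ} (D : DisjointSets T n) :
    MemLp D.fn 2 (Measure.pi fun _ : Fin n => σ) := by
  rw [D.fn_eq]
  exact memLp_indicator_const 2 (MeasurableSet.univ_pi D.meas) 1 (Or.inr (D.measure_lt_top σ).ne)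

/-- The indicator function of the product of the sets, as an element of `L²(Tⁿ, σⁿ)`. -/
def DisjointSets.elt {n : ℕ} (D : DisjointSets T n) : L2 σ n := (D.memLp σ).toLp

theorem DisjointSets.elt_ae {n : ℕ} (D : DisjointSets T n) :
    D.elt σ =ᵐ[Measure.pi fun _ : Fin n => σ] D.fn := (D.memLp σ).coeFn_toLp

theorem indicator_one_mul {Y : Type*} (S : Set Y) (h : Y → ℂ) (y : Y) :
    S.indicator (fun _ => (1 : ℂ)) y * h y = S.indicator h y := by
  by_cases hm : y ∈ S <;> simp [hm]

variable [NullSingletonClass σ]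

/-- Given the other coordinates, a new one has to avoid finitely many points, and points are null.
-/
theorem ae_pairwise_ne (n : ℕ) :
    ∀ᵐ t ∂(Measure.pi fun _ : Fin n => σ), ∀ i j, i ≠ j → t i ≠ t j := by
  induction n with
  | zero => exact Filter.Eventually.of_forall fun t i => i.elim0
  | succ n ih =>
    have h1 := (quasiMeasurePreserving_tail σ n).ae ih
    have hN : MeasurableSet {p : T × (Fin n → T) | ∀ j, p.1 ≠ p.2 j} := by
      rw [Set.ofPred_forall]
      refine MeasurableSet.iInter fun j => MeasurableSet.compl ?_
      exact measurableSet_eq_fun measurable_fst ((measurable_pi_apply j).comp measurable_snd)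
    have h2 : ∀ᵐ p ∂(σ.prod (Measure.pi fun _ : Fin n => σ)), ∀ j, p.1 ≠ p.2 j := by
      have h3 : ∀ᵐ q ∂((Measure.pi fun _ : Fin n => σ).prod σ), ∀ j, q.2 ≠ q.1 j := by
        refine (Measure.ae_prod_iff_ae_ae (measurable_swap hN)).2
          (Filter.Eventually.of_forall fun t => ?_)
        refine ae_all_iff.2 fun j => ?_
        rw [ae_iff]
        simp
      exact Measure.measurePreserving_swap.quasiMeasurePreserving.ae h3
    have h3 := (measurePreserving_head_tail σ n).quasiMeasurePreserving.ae h2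
    filter_upwards [h1, h3] with t h1 h3 i j hij
    refine Fin.cases (fun hij => ?_) (fun i hij => ?_) i hij
    · refine Fin.cases (fun h => (h rfl).elim) (fun j _ => h3 j) j hij
    · refine Fin.cases (fun _ => (h3 i).symm) (fun j h => h1 i j fun h' => h (by rw [h'])) j hij

/-- Inside a fixed box with disjoint pre-compact sides every measurable sub-box again has disjoint
sides, so `h` vanishes almost everywhere there. Countably many boxes with sides from a countable
basis cover everything off the diagonals, and the diagonals are null. -/
theorem total_disjointSets (n : ℕ) :
    Total (Measure.pi fun _ : Fin n => σ) fun D : DisjointSets T n => D.fn := by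
  intro h hh h0
  obtain ⟨b, hbc, -, hb⟩ := TopologicalSpace.exists_countable_basis T
  set W : Set (Fin n → Set T) := {U | (∀ j, U j ∈ b) ∧ (∀ j, IsCompact (closure (U j))) ∧
    Pairwise (Function.onFun Disjoint U)} with hW
  have hWc : W.Countable := (Set.countable_univ_pi (fun _ : Fin n => hbc)).mono
    (show W ⊆ Set.univ.pi fun _ => b from fun U hU j _ => hU.1 j)
  have key : ∀ U ∈ W, ∀ᵐ t ∂(Measure.pi fun _ : Fin n => σ),
      t ∈ Set.univ.pi U → h t = 0 := by
    rintro U ⟨hU1, hU2, hU3⟩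
    have hUm : ∀ j, MeasurableSet (U j) := fun j => (hb.isOpen (hU1 j)).measurableSet
    have hR : MeasurableSet (Set.univ.pi U) := MeasurableSet.univ_pi hUm
    have hfin : (Measure.pi fun _ : Fin n => σ) (Set.univ.pi U) ≠ ∞ := by
      rw [Measure.pi_pi]
      exact (ENNReal.prod_lt_top fun j _ =>
        (measure_mono subset_closure).trans_lt (hU2 j).measure_lt_top).ne
    have hi : IntegrableOn h (Set.univ.pi U) (Measure.pi fun _ : Fin n => σ) :=
      by
      have : IsFiniteMeasure ((Measure.pi fun _ : Fin n => σ).restrict (Set.univ.pi U)) :=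
        ⟨by rw [Measure.restrict_apply_univ]; exact hfin.lt_top⟩
      exact (hh.restrict _).integrable one_le_two
    rw [← ae_restrict_iff' hR]
    refine hi.ae_eq_zero_of_forall_setIntegral_eq_zero fun s hs _ => ?_
    rw [Measure.restrict_restrict hs]
    revert s
    -- Measurable boxes form a π-system generating the product σ-algebra, so it suffices to test `h`
    -- on them and to pass to complements and disjoint unions.
    have : ∀ s, MeasurableSet s → ∫ t in s ∩ Set.univ.pi U, h t ∂(Measure.pi fun _ => σ) = 0 := by
      refine MeasurableSpace.induction_on_inter generateFrom_pi.symm isPiSystem_pi ?_ ?_ ?_ ?_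
      · simp
      · rintro _ ⟨B, hB, rfl⟩
        have hB' : ∀ j, MeasurableSet (B j) := fun j => hB j trivial
        rw [← Set.pi_inter_distrib, ← integral_indicator
          (MeasurableSet.univ_pi fun j => (hB' j).inter (hUm j))]
        have := h0 ⟨fun j => B j ∩ U j, fun j => (hB' j).inter (hUm j),
          fun j => (hU2 j).of_isClosed_subset isClosed_closure (closure_mono Set.inter_subset_right),
          fun i j hij => (hU3 hij).mono Set.inter_subset_right Set.inter_subset_right⟩
        rw [← this]
        refine integral_congr_ae (Filter.Eventually.of_forall fun t => ?_)
        simp only [DisjointSets.fn_eq, indicator_one_mul]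
      · intro s hs ih
        have h1 := integral_inter_add_sdiff (μ := Measure.pi fun _ : Fin n => σ) (s := Set.univ.pi U)
          hs hi
        have h2 : ∫ t in Set.univ.pi U, h t ∂(Measure.pi fun _ => σ) = 0 := by
          have := h0 ⟨U, hUm, hU2, hU3⟩
          rw [← this, ← integral_indicator hR]
          refine integral_congr_ae (Filter.Eventually.of_forall fun t => ?_)
          simp only [DisjointSets.fn_eq, indicator_one_mul]
        rw [h2, Set.inter_comm, ih, zero_add] at h1
        rw [← h1, Set.sdiff_eq, Set.inter_comm]
      · intro f hd hm ih
        rw [Set.iUnion_inter, integral_iUnion (fun i => (hm i).inter hR)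
          (fun i j hij => (hd hij).mono Set.inter_subset_left Set.inter_subset_left)
          (hi.mono_set (Set.iUnion_subset fun i => Set.inter_subset_right))]
        simp [ih]
    exact fun s hs _ => this s hs
  have hall := (ae_ball_iff hWc).2 key
  filter_upwards [hall, ae_pairwise_ne σ n] with t ht hne
  -- The coordinates of `t` are distinct: Hausdorff separation and local compactness yield disjoint
  -- pre-compact basis sets around them.
  obtain ⟨V, hV, hVd⟩ := (Set.finite_range t).t2_separation
  have : ∀ j, ∃ U ∈ b, t j ∈ U ∧ IsCompact (closure U) ∧ U ⊆ V (t j) := fun j => by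
    obtain ⟨L, hL, hLV, hLc⟩ := exists_compact_subset (hV (t j)).2 (hV (t j)).1
    obtain ⟨U, hU, hjU, hUL⟩ := hb.exists_subset_of_mem_open hLV isOpen_interior
    exact ⟨U, hU, hjU, hL.of_isClosed_subset isClosed_closure
      (hL.isClosed.closure_subset_iff.2 (hUL.trans interior_subset)),
      hUL.trans (interior_subset.trans hLc)⟩
  choose U hU hjU hUc hUV using this
  exact ht U ⟨hU, hUc, fun i j hij => (hVd (Set.mem_range_self i) (Set.mem_range_self j)
    (hne i j hij)).mono (hUV i) (hUV j)⟩ fun j _ => hjU j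

theorem dense_disjointSets (n : ℕ) :
    (Submodule.span ℂ (Set.range fun D : DisjointSets T n => D.elt σ)).topologicalClosure = ⊤ := by
  refine Total.dense_span ?_
  intro h hh h0
  refine total_disjointSets σ n h hh fun D => ?_
  rw [← h0 D]
  refine integral_congr_ae ?_
  filter_upwards [D.elt_ae σ] with t ht
  rw [ht, D.fn_eq]
  by_cases hm : t ∈ Set.univ.pi D.set <;> simp [hm]

/-- Points are null, so by outer regularity each has an open neighbourhood of measure less than δ.
Finitely many of these cover the compact closure, and they are then made disjoint. -/
theorem exists_fine_partition {Δ : Set T} (hΔ : MeasurableSet Δ) (hc : IsCompact (closure Δ))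
    {δ : ℝ≥0∞} (hδ : δ ≠ 0) :
    ∃ (N : ℕ) (P : Fin N → Set T), (∀ i, MeasurableSet (P i)) ∧ (∀ i, σ (P i) < δ) ∧
      Pairwise (Function.onFun Disjoint P) ∧ ⋃ i, P i = Δ := by
  have h1 : ∀ x : T, ∃ U : Set T, x ∈ U ∧ IsOpen U ∧ σ U < δ := fun x => by
    obtain ⟨U, hU, hUo, hUd⟩ := Set.exists_isOpen_lt_of_lt {x} δ (μ := σ)
      (by rw [measure_singleton]; exact pos_iff_ne_zero.2 hδ)
    exact ⟨U, hU rfl, hUo, hUd⟩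
  choose U hxU hUo hUd using h1
  obtain ⟨s, -, hs⟩ := hc.elim_nhds_subcover U fun x _ => (hUo x).mem_nhds (hxU x)
  let e := s.equivFin.symm
  let V : Fin s.card → Set T := fun i => Δ ∩ U (e i)
  refine ⟨s.card, disjointed V, fun i => ?_, fun i => ?_, disjoint_disjointed V, ?_⟩
  · exact disjointedRec (f := V) (p := MeasurableSet)
      (fun _ i ht => ht.diff (hΔ.inter (hUo (e i)).measurableSet))
      (hΔ.inter (hUo (e i)).measurableSet)
  · exact (measure_mono ((disjointed_subset V i).trans Set.inter_subset_right)).trans_lt (hUd _)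
  · rw [iUnion_disjointed, ← Set.inter_iUnion, Set.inter_eq_left]
    intro x hx
    obtain ⟨y, hy, hxy⟩ := Set.mem_iUnion₂.1 (hs (subset_closure hx))
    exact Set.mem_iUnion.2 ⟨e.symm ⟨y, hy⟩, by simpa using hxy⟩

end Rectangles

/-! ### Q-symmetrization of tensors with disjoint supports -/

section Permutations

variable {X : Type u} [MeasurableSpace X] (K : HermKernel X) {μ : Measure X} [SigmaFinite μ]

theorem symP_ae {n : ℕ} (F : L2 μ n) : symP K μ n F =ᵐ[Measure.pi fun _ : Fin n => μ]
    fun t => ((n.factorial : ℂ)⁻¹) * ∑ π : Equiv.Perm (Fin n), qPerm K π⁻¹ t * F (fun j => t (π j)) := by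
  rw [symP_apply]
  filter_upwards [Lp.coeFn_smul ((n.factorial : ℂ)⁻¹) (∑ π : Equiv.Perm (Fin n), psi K μ π F),
    Lp.coeFn_fun_finsetSum Finset.univ fun π => psi K μ π F,
    ae_all_iff.2 fun π => psi_ae K μ π F] with t h1 h2 h3
  rw [h1, Pi.smul_apply, h2, smul_eq_mul]
  simp_rw [h3]

/-- The permutation of `n + 1` indices that fixes the first one and acts as `ρ` on the others. -/
def liftPerm {n : ℕ} (ρ : Equiv.Perm (Fin n)) : Equiv.Perm (Fin (n + 1)) :=
  Equiv.Perm.decomposeFin.symm (0, ρ)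

@[simp] theorem liftPerm_zero {n : ℕ} (ρ : Equiv.Perm (Fin n)) : liftPerm ρ 0 = 0 := by
  simp [liftPerm]

@[simp] theorem liftPerm_succ {n : ℕ} (ρ : Equiv.Perm (Fin n)) (j : Fin n) :
    liftPerm ρ j.succ = (ρ j).succ := by
  simp [liftPerm]

theorem liftPerm_inv {n : ℕ} (ρ : Equiv.Perm (Fin n)) : (liftPerm ρ)⁻¹ = liftPerm ρ⁻¹ := by
  rw [inv_eq_iff_mul_eq_one]
  ext j : 1
  refine Fin.cases ?_ (fun j => ?_) j <;> simp

/-- The first index stays first, so it takes part in no inversion. -/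
theorem qPerm_liftPerm {n : ℕ} (ρ : Equiv.Perm (Fin n)) (t : Fin (n + 1) → X) :
    qPerm K (liftPerm ρ) t = qPerm K ρ fun j => t j.succ := by
  simp only [qPerm, Fintype.prod_prod_type, Fin.prod_univ_succ]
  simp

theorem psi_liftPerm_tens (h : Lp ℂ 2 μ) {n : ℕ} (ρ : Equiv.Perm (Fin n)) (F : L2 μ n) :
    psi K μ (liftPerm ρ) (tens h n F) = tens h n (psi K μ ρ F) := by
  refine Lp.ext ?_
  filter_upwards [psi_ae K μ (liftPerm ρ) (tens h n F), tens_ae h (psi K μ ρ F),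
    (measurePreserving_comp_perm μ (liftPerm ρ)).quasiMeasurePreserving.ae (tens_ae h F),
    (quasiMeasurePreserving_tail μ n).ae (psi_ae K μ ρ F)] with t h1 h2 h3 h4
  rw [h1, h2, h3, h4, liftPerm_inv, qPerm_liftPerm]
  simp only [liftPerm_zero, liftPerm_succ]
  ring

theorem symP_psi {n : ℕ} (π : Equiv.Perm (Fin n)) (F : L2 μ n) :
    symP K μ n (psi K μ π F) = symP K μ n F := by
  rw [symP_apply, symP_apply]
  congr 1
  simp_rw [psi_mul]
  exact Equiv.sum_comp (Equiv.mulRight π) (fun ρ => psi K μ ρ F)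

/-- Permutations of the last `n` variables lift to permutations of all `n + 1`, and these are
absorbed by the larger projection. Iterated creation thus amounts to a single symmetrization. -/
theorem symP_tens_symP (h : Lp ℂ 2 μ) {n : ℕ} (F : L2 μ n) :
    symP K μ (n + 1) (tens h n (symP K μ n F)) = symP K μ (n + 1) (tens h n F) := by
  rw [symP_apply K μ n, map_smul, map_smul, map_sum, map_sum]
  simp_rw [← psi_liftPerm_tens, symP_psi]
  rw [Finset.sum_const, Finset.card_univ, Fintype.card_perm, Fintype.card_fin,
    ← Nat.cast_smul_eq_nsmul ℂ, smul_smul,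
    inv_mul_cancel₀ (by exact_mod_cast n.factorial_ne_zero), one_smul]

theorem inner_tens_tens (h g : Lp ℂ 2 μ) {n : ℕ} (G F : L2 μ n) :
    inner ℂ (tens h n G) (tens g n F) = inner ℂ h g * inner ℂ G F := by
  rw [L2.inner_def, L2.inner_def, L2.inner_def, ← integral_prod_mul]
  refine Eq.trans (integral_congr_ae ?_)
    ((measurePreserving_piFinSuccAbove (fun _ : Fin (n + 1) => μ) 0).integral_comp'
      (fun p : X × (Fin n → X) => inner ℂ (h p.1) (g p.1) * inner ℂ (G p.2) (F p.2)))
  filter_upwards [tens_ae h G, tens_ae g F] with t h1 h2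
  rw [h1, h2]
  simp only [RCLike.inner_apply, map_mul, MeasurableEquiv.piFinSuccAbove_apply,
    Fin.insertNthEquiv_symm_apply, Fin.removeNth_zero]
  change g (t 0) * F (Fin.tail t) * (conj (h (t 0)) * conj (G (Fin.tail t))) =
    g (t 0) * conj (h (t 0)) * (F (Fin.tail t) * conj (G (Fin.tail t)))
  ring

/-- A permutation that moves the first index makes the variable t₀ an argument of `F`. On the
support of `h` that variable lies in `A`, where `F` has no particle. -/
theorem inner_tens_psi_tens_eq_zero {A : Set X} {h g : Lp ℂ 2 μ} (hh : ∀ᵐ x ∂μ, h x ≠ 0 → x ∈ A)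
    {n : ℕ} (G : L2 μ n) {F : L2 μ n}
    (hF : ∀ᵐ t ∂(Measure.pi fun _ : Fin n => μ), F t ≠ 0 → ∀ j, t j ∉ A)
    {π : Equiv.Perm (Fin (n + 1))} (hπ : π 0 ≠ 0) :
    inner ℂ (tens h n G) (psi K μ π (tens g n F)) = 0 := by
  rw [L2.inner_def]
  refine integral_eq_zero_of_ae ?_
  filter_upwards [tens_ae h G, psi_ae K μ π (tens g n F),
    (measurePreserving_comp_perm μ π).quasiMeasurePreserving.ae (tens_ae g F),
    (quasiMeasurePreserving_head μ n).ae hh,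
    (measurePreserving_comp_perm μ π).quasiMeasurePreserving.ae
      ((quasiMeasurePreserving_tail μ n).ae hF)] with t h1 h2 h3 h4 h5
  rw [h1, h2, h3]
  by_cases h0 : h (t 0) = 0
  · simp [h0]
  obtain ⟨j, hj⟩ : ∃ j : Fin n, π j.succ = 0 := by
    have : π⁻¹ 0 ≠ 0 := fun h => hπ (by simpa using (congrArg π h).symm)
    obtain ⟨j, hj⟩ := Fin.exists_succ_eq.2 this
    exact ⟨j, by rw [hj]; simp⟩
  have : F (fun j => t (π j.succ)) = 0 := by
    by_contra hne
    exact h5 hne j (by rw [hj]; exact h4 h0)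
  simp [this]

/-- Of the (n+1)! permutations only the n! fixing the first index contribute, all by the same
amount; their ratio is the factor n + 1. The values of the kernel drop out because `F` is already
symmetric. -/
theorem inner_symP_tens {A : Set X} {h g : Lp ℂ 2 μ} (hh : ∀ᵐ x ∂μ, h x ≠ 0 → x ∈ A)
    {n : ℕ} (G : L2 μ n) {F : L2 μ n} (hFs : F ∈ qSym K μ n)
    (hF : ∀ᵐ t ∂(Measure.pi fun _ : Fin n => μ), F t ≠ 0 → ∀ j, t j ∉ A) :
    ((n : ℂ) + 1) * inner ℂ (symP K μ (n + 1) (tens h n G)) (symP K μ (n + 1) (tens g n F)) =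
      inner ℂ h g * inner ℂ G F := by
  -- A permutation is encoded by the image of 0 together with a permutation of the remaining
  -- indices; only the image 0 survives.
  rw [inner_symP_left, symP_of_mem K μ (symP_mem K μ _), symP_apply, inner_smul_right, inner_sum,
    ← (Equiv.Perm.decomposeFin (n := n)).symm.sum_comp, Fintype.sum_prod_type,
    Finset.sum_eq_single (0 : Fin (n + 1))]
  · have : ∀ ρ : Equiv.Perm (Fin n), inner ℂ (tens h n G)
        (psi K μ (Equiv.Perm.decomposeFin.symm (0, ρ)) (tens g n F)) =
          inner ℂ h g * inner ℂ G F := fun ρ => by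
      change inner ℂ (tens h n G) (psi K μ (liftPerm ρ) (tens g n F)) = _
      rw [psi_liftPerm_tens, (mem_qSym K μ).1 hFs, inner_tens_tens]
    simp_rw [this]
    rw [Finset.sum_const, Finset.card_univ, Fintype.card_perm, Fintype.card_fin, nsmul_eq_mul,
      Nat.factorial_succ]
    have h1 : ((n : ℂ) + 1) ≠ 0 := by exact_mod_cast n.succ_ne_zero
    have h2 : (n.factorial : ℂ) ≠ 0 := by exact_mod_cast n.factorial_ne_zero
    push_cast
    field_simp
  · intro p _ hp
    refine Finset.sum_eq_zero fun ρ _ => inner_tens_psi_tens_eq_zero K hh G hF ?_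
    simpa using hp
  · exact fun h => (h (Finset.mem_univ _)).elim

/-- The exchange terms, in which a⁻(h) would annihilate a particle of `F`, are absent since `F` has
none in `A`. Only the pairing of `h` with the newly created particle remains. -/
theorem anni_crea {A : Set X} {h : Lp ℂ 2 μ} (g : Lp ℂ 2 μ) (hh : ∀ᵐ x ∂μ, h x ≠ 0 → x ∈ A)
    {n : ℕ} (F : qSym K μ n)
    (hF : ∀ᵐ t ∂(Measure.pi fun _ : Fin n => μ), (F : L2 μ n) t ≠ 0 → ∀ j, t j ∉ A) :
    (anni K h n (crea K g n F) : L2 μ n) = (inner ℂ h g : ℂ) • (F : L2 μ n) := by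
  have : anni K h n (crea K g n F) =
      ⟨(inner ℂ h g : ℂ) • (F : L2 μ n), Submodule.smul_mem _ _ F.2⟩ := by
    refine ext_inner_left ℂ fun G => ?_
    rw [anni, smul_apply, inner_smul_right, ContinuousLinearMap.adjoint_inner_right,
      Submodule.coe_inner, Submodule.coe_inner, inner_smul_right]
    exact inner_symP_tens K hh (G : L2 μ n) F.2 hF
  rw [this]

end Permutations

/-! ### Numbers of particles in a set -/

section Occupation

/-- The number of particles in the set `B`. -/
def count {T : Type u} (B : Set T) {n : ℕ} (z : Fin n → T × ℝ) : ℕ :=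
  ∑ j, B.indicator (fun _ => 1) (z j).1

theorem count_comp_perm {T : Type u} (B : Set T) {n : ℕ} (z : Fin n → T × ℝ)
    (π : Equiv.Perm (Fin n)) : count B (fun j => z (π j)) = count B z :=
  Equiv.sum_comp π fun j => B.indicator (fun _ => 1) (z j).1

theorem count_succ {T : Type u} (B : Set T) {n : ℕ} (z : Fin (n + 1) → T × ℝ) :
    count B z = B.indicator (fun _ => 1) (z 0).1 + count B fun j => z j.succ :=
  Fin.sum_univ_succ _

theorem count_add_count_compl {T : Type u} (B : Set T) {n : ℕ} (z : Fin n → T × ℝ) :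
    count B z + count Bᶜ z = n := by
  rw [count, count, ← Finset.sum_add_distrib]
  have : ∀ j, B.indicator (fun _ => 1) (z j).1 + Bᶜ.indicator (fun _ => 1) (z j).1 = 1 := fun j => by
    by_cases h : (z j).1 ∈ B <;> simp [h]
  simp [this]

theorem count_le_of_subset {T : Type u} {B B' : Set T} (h : B ⊆ B') {n : ℕ} (z : Fin n → T × ℝ) :
    count B z ≤ count B' z :=
  Finset.sum_le_sum fun j _ => Set.indicator_le_indicator_of_subset h (fun _ => Nat.zero_le _) _

theorem count_union {T : Type u} {B B' : Set T} (h : Disjoint B B') {n : ℕ} (z : Fin n → T × ℝ) :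
    count (B ∪ B') z = count B z + count B' z := by
  rw [count, count, count, ← Finset.sum_add_distrib]
  refine Finset.sum_congr rfl fun j _ => ?_
  rw [Set.indicator_union_of_disjoint h]

theorem count_eq_zero_iff {T : Type u} {B : Set T} {n : ℕ} {z : Fin n → T × ℝ} :
    count B z = 0 ↔ ∀ j, (z j).1 ∉ B := by
  simp [count]

variable {T : Type u} [MeasurableSpace T] (σ : Measure T) [SigmaFinite σ]
  (ν : Measure ℝ) [IsProbabilityMeasure ν]

/-- The functions vanishing unless exactly `m` particles are in `B`. -/
def occ (B : Set T) (m : ℕ) (n : ℕ) : Submodule ℂ (L2 (σ.prod ν) n) where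
  carrier := {F | ∀ᵐ z ∂(Measure.pi fun _ : Fin n => σ.prod ν), F z ≠ 0 → count B z = m}
  add_mem' {F G} hF hG := by
    change ∀ᵐ z ∂(Measure.pi fun _ : Fin n => σ.prod ν), _
    filter_upwards [hF, hG, Lp.coeFn_add F G] with z h1 h2 h3 h
    rw [h3, Pi.add_apply] at h
    by_cases h0 : F z = 0
    · exact h2 fun h' => h (by rw [h0, h', add_zero])
    · exact h1 h0
  zero_mem' := by
    change ∀ᵐ z ∂(Measure.pi fun _ : Fin n => σ.prod ν), _
    filter_upwards [Lp.coeFn_zero ℂ 2 (Measure.pi fun _ : Fin n => σ.prod ν)] with z hz h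
    exact (h hz).elim
  smul_mem' c F hF := by
    change ∀ᵐ z ∂(Measure.pi fun _ : Fin n => σ.prod ν), _
    filter_upwards [hF, Lp.coeFn_smul c F] with z h1 h2 h
    refine h1 fun h' => h ?_
    rw [h2, Pi.smul_apply, h', smul_zero]

variable {σ ν} {B : Set T} {m n : ℕ}

theorem mem_occ {F : L2 (σ.prod ν) n} : F ∈ occ σ ν B m n ↔
    ∀ᵐ z ∂(Measure.pi fun _ : Fin n => σ.prod ν), F z ≠ 0 → count B z = m := Iff.rfl

theorem symP_mem_occ (K : HermKernel T) {F : L2 (σ.prod ν) n} (hF : F ∈ occ σ ν B m n) :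
    symP K.lift (σ.prod ν) n F ∈ occ σ ν B m n := by
  rw [symP_apply]
  refine Submodule.smul_mem _ _ (Submodule.sum_mem _ fun π _ => ?_)
  rw [mem_occ]
  filter_upwards [psi_ae K.lift (σ.prod ν) π F,
    (measurePreserving_comp_perm (σ.prod ν) π).quasiMeasurePreserving.ae (mem_occ.1 hF)] with z h1 h2 h
  rw [← count_comp_perm B z π]
  exact h2 fun h' => h (by rw [h1, h', mul_zero])

theorem tens_mem_occ {h : Lp ℂ 2 (σ.prod ν)} (hh : ∀ᵐ w ∂(σ.prod ν), h w ≠ 0 → w.1 ∉ B)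
    {F : L2 (σ.prod ν) n} (hF : F ∈ occ σ ν B m n) : tens h n F ∈ occ σ ν B m (n + 1) := by
  rw [mem_occ]
  filter_upwards [tens_ae h F, (quasiMeasurePreserving_tail _ n).ae (mem_occ.1 hF),
    (quasiMeasurePreserving_head _ n).ae hh] with z h1 h2 h3 h4
  rw [h1] at h4
  rw [count_succ, h2 (right_ne_zero_of_mul h4),
    Set.indicator_of_notMem (h3 (left_ne_zero_of_mul h4)), zero_add]

/-- The variable that is integrated out only matters on the support of `h`, that is off `B`, so it
does not enter the count. -/
theorem adjoint_tens_mem_occ {h : Lp ℂ 2 (σ.prod ν)} (hh : ∀ᵐ w ∂(σ.prod ν), h w ≠ 0 → w.1 ∉ B)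
    {F : L2 (σ.prod ν) (n + 1)} (hF : F ∈ occ σ ν B m (n + 1)) :
    ContinuousLinearMap.adjoint (tens h n) F ∈ occ σ ν B m n := by
  rw [mem_occ]
  have hs : ∀ᵐ z ∂(Measure.pi fun _ : Fin n => σ.prod ν), ∀ᵐ w ∂(σ.prod ν),
      F (Fin.cons w z) ≠ 0 → count B (Fin.cons w z : Fin (n + 1) → T × ℝ) = m :=
    Measure.ae_ae_of_ae_prod (((measurePreserving_cons (σ.prod ν) n).comp
      Measure.measurePreserving_swap).quasiMeasurePreserving.ae (mem_occ.1 hF))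
  filter_upwards [adjoint_tens_ae h F, hs] with z h1 h2
  contrapose!
  intro hc
  rw [h1]
  refine integral_eq_zero_of_ae ?_
  filter_upwards [h2, hh] with w h3 h4
  by_cases h5 : h w = 0
  · simp [h5]
  have : F (Fin.cons w z) = 0 := by
    by_contra h6
    refine hc ?_
    rw [← h3 h6, count_succ]
    simp [h4 h5]
  simp [this]

end Occupation

/-! ### Weighted norms controlling the jump variables -/

section Weights

theorem lintegral_comp_measurePreserving {Y Z : Type*} [MeasurableSpace Y] [MeasurableSpace Z]
    {m : Measure Y} {m' : Measure Z} {f : Y → Z} (mp : MeasurePreserving f m m') {g : Z → ℝ≥0∞}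
    (hg : AEMeasurable g m') : ∫⁻ y, g (f y) ∂m = ∫⁻ z, g z ∂m' := by
  rw [← mp.map_eq] at hg ⊢
  exact (lintegral_map' hg mp.measurable.aemeasurable).symm

/-- The weight `∏ⱼ (1 + xⱼ²)^r`. -/
def wt {T : Type u} (r : ℕ) {n : ℕ} (z : Fin n → T × ℝ) : ℝ := ∏ j, (1 + (z j).2 ^ 2) ^ r

theorem one_le_wt {T : Type u} (r : ℕ) {n : ℕ} (z : Fin n → T × ℝ) : 1 ≤ wt r z := by
  have : ∏ j : Fin n, (1 : ℝ) ≤ wt r z := Finset.prod_le_prod (fun _ _ => zero_le_one)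
    fun j _ => one_le_pow₀ (by nlinarith [sq_nonneg (z j).2])
  simpa using this

theorem wt_comp_perm {T : Type u} (r : ℕ) {n : ℕ} (z : Fin n → T × ℝ)
    (π : Equiv.Perm (Fin n)) : wt r (fun j => z (π j)) = wt r z :=
  Equiv.prod_comp π fun j => (1 + (z j).2 ^ 2) ^ r

theorem wt_succ {T : Type u} (r : ℕ) {n : ℕ} (z : Fin (n + 1) → T × ℝ) :
    wt r z = (1 + (z 0).2 ^ 2) ^ r * wt r fun j => z j.succ :=
  Fin.prod_univ_succ _

theorem measurable_wt {T : Type u} [MeasurableSpace T] (r : ℕ) {n : ℕ} :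
    Measurable (wt r : (Fin n → T × ℝ) → ℝ) := by
  unfold wt
  fun_prop

variable {T : Type u} [MeasurableSpace T] {σ : Measure T} [SigmaFinite σ]
  {ν : Measure ℝ} [IsProbabilityMeasure ν] {n : ℕ}

/-- The square of the weighted norm of `F`. -/
def wnorm (r : ℕ) (F : L2 (σ.prod ν) n) : ℝ≥0∞ :=
  ∫⁻ z, ‖F z‖ₑ ^ 2 * ENNReal.ofReal (wt r z) ∂(Measure.pi fun _ : Fin n => σ.prod ν)

theorem enorm_sum_sq_le {ι : Type*} (s : Finset ι) (f : ι → ℂ) :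
    ‖∑ i ∈ s, f i‖ₑ ^ 2 ≤ s.card * ∑ i ∈ s, ‖f i‖ₑ ^ 2 := by
  have h : ‖∑ i ∈ s, f i‖ ^ 2 ≤ s.card * ∑ i ∈ s, ‖f i‖ ^ 2 :=
    (pow_le_pow_left₀ (norm_nonneg _) (norm_sum_le _ _) 2).trans sq_sum_le_card_mul_sum_sq
  have := ENNReal.ofReal_le_ofReal h
  rw [ENNReal.ofReal_mul (by positivity), ENNReal.ofReal_sum_of_nonneg (fun _ _ => by positivity),
    ENNReal.ofReal_natCast] at this
  simpa [ENNReal.ofReal_pow] using this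

theorem wnorm_sum_le {ι : Type*} (r : ℕ) (s : Finset ι) (F : ι → L2 (σ.prod ν) n) :
    wnorm r (∑ i ∈ s, F i) ≤ s.card * ∑ i ∈ s, wnorm r (F i) := by
  have h1 : wnorm r (∑ i ∈ s, F i) ≤ ∫⁻ z, s.card *
      ∑ i ∈ s, ‖F i z‖ₑ ^ 2 * ENNReal.ofReal (wt r z) ∂(Measure.pi fun _ : Fin n => σ.prod ν) := by
    refine lintegral_mono_ae ?_
    filter_upwards [Lp.coeFn_fun_finsetSum s F] with z hz
    rw [hz, ← Finset.sum_mul, ← mul_assoc]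
    gcongr
    exact enorm_sum_sq_le s _
  refine h1.trans_eq ?_
  rw [lintegral_const_mul' _ _ (by simp), lintegral_finsetSum']
  · rfl
  · intro i _
    exact ((Lp.aestronglyMeasurable (F i)).enorm.pow_const 2).mul
      (measurable_wt r).ennreal_ofReal.aemeasurable

theorem wnorm_smul (r : ℕ) (c : ℂ) (F : L2 (σ.prod ν) n) :
    wnorm r (c • F) = ‖c‖ₑ ^ 2 * wnorm r F := by
  rw [wnorm, wnorm, ← lintegral_const_mul' _ _ (by simp)]
  refine lintegral_congr_ae ?_
  filter_upwards [Lp.coeFn_smul c F] with z hz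
  rw [hz, Pi.smul_apply, smul_eq_mul, enorm_mul, mul_pow, mul_assoc]

theorem wnorm_psi (K : HermKernel T) (r : ℕ) (π : Equiv.Perm (Fin n)) (F : L2 (σ.prod ν) n) :
    wnorm r (psi K.lift (σ.prod ν) π F) = wnorm r F := by
  have hm : AEMeasurable (fun z => ‖F z‖ₑ ^ 2 * ENNReal.ofReal (wt r z))
      (Measure.pi fun _ : Fin n => σ.prod ν) :=
    ((Lp.aestronglyMeasurable F).enorm.pow_const 2).mul
      (measurable_wt r).ennreal_ofReal.aemeasurable
  have mp := measurePreserving_comp_perm (σ.prod ν) π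
  rw [wnorm, wnorm, ← lintegral_comp_measurePreserving mp hm]
  refine lintegral_congr_ae ?_
  filter_upwards [psi_ae K.lift (σ.prod ν) π F] with z hz
  have h1 : ‖qPerm K.lift π⁻¹ z‖ₑ = 1 := by
    rw [← ofReal_norm, norm_qPerm, ENNReal.ofReal_one]
  rw [hz, wt_comp_perm, enorm_mul, h1, one_mul]

/-- The weight is symmetric and the phases have modulus one, so every Ψ_π preserves the weighted
norm, and `symP` is an average of these. -/
theorem wnorm_symP_le (K : HermKernel T) (r : ℕ) (F : L2 (σ.prod ν) n) :
    wnorm r (symP K.lift (σ.prod ν) n F) ≤ wnorm r F := by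
  rw [symP_apply, wnorm_smul]
  refine (mul_le_mul_right (wnorm_sum_le r _ _) _).trans ?_
  simp_rw [wnorm_psi]
  rw [Finset.sum_const, Finset.card_univ, Fintype.card_perm, Fintype.card_fin, nsmul_eq_mul,
    ← mul_assoc, ← mul_assoc, enorm_inv (by exact_mod_cast n.factorial_ne_zero)]
  have : ‖(n.factorial : ℂ)‖ₑ = (n.factorial : ℝ≥0∞) := by
    rw [← ofReal_norm, Complex.norm_natCast, ENNReal.ofReal_natCast]
  rw [this, ← ENNReal.inv_pow, mul_assoc (_⁻¹), ← sq, ENNReal.inv_mul_cancel, one_mul]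
  · exact pow_ne_zero _ (by exact_mod_cast n.factorial_ne_zero)
  · exact ENNReal.pow_ne_top (ENNReal.natCast_ne_top _)

theorem wnorm_tens (r : ℕ) (h : Lp ℂ 2 (σ.prod ν)) (F : L2 (σ.prod ν) n) :
    wnorm r (tens h n F) =
      (∫⁻ w, ‖h w‖ₑ ^ 2 * ENNReal.ofReal ((1 + w.2 ^ 2) ^ r) ∂(σ.prod ν)) * wnorm r F := by
  have hm1 : AEMeasurable (fun w => ‖h w‖ₑ ^ 2 * ENNReal.ofReal ((1 + w.2 ^ 2) ^ r)) (σ.prod ν) :=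
    ((Lp.aestronglyMeasurable h).enorm.pow_const 2).mul
      (by fun_prop : Measurable fun w : T × ℝ => ENNReal.ofReal ((1 + w.2 ^ 2) ^ r)).aemeasurable
  have hm : AEMeasurable (fun z => ‖F z‖ₑ ^ 2 * ENNReal.ofReal (wt r z))
      (Measure.pi fun _ : Fin n => σ.prod ν) :=
    ((Lp.aestronglyMeasurable F).enorm.pow_const 2).mul
      (measurable_wt r).ennreal_ofReal.aemeasurable
  have mp := measurePreserving_head_tail (σ.prod ν) n
  rw [wnorm, wnorm, ← lintegral_prod_mul hm1 hm]
  refine (lintegral_congr_ae ?_).trans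
    (lintegral_comp_measurePreserving mp (hm1.comp_fst.mul hm.comp_snd))
  filter_upwards [tens_ae h F] with z hz
  rw [hz, wt_succ, enorm_mul, ENNReal.ofReal_mul (by positivity)]
  ring

/-- Cauchy–Schwarz in the variable integrated out, together with the fact that the weight of `n` of
the particles is at most the weight of all `n + 1`. -/
theorem wnorm_adjoint_tens_le (r : ℕ) (h : Lp ℂ 2 (σ.prod ν)) (F : L2 (σ.prod ν) (n + 1)) :
    wnorm r (ContinuousLinearMap.adjoint (tens h n) F) ≤
      (∫⁻ w, ‖h w‖ₑ ^ 2 ∂(σ.prod ν)) * wnorm r F := by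
  have hm : AEMeasurable (fun z => ‖F z‖ₑ ^ 2 * ENNReal.ofReal (wt r z))
      (Measure.pi fun _ : Fin (n + 1) => σ.prod ν) :=
    ((Lp.aestronglyMeasurable F).enorm.pow_const 2).mul
      (measurable_wt r).ennreal_ofReal.aemeasurable
  have mp := (measurePreserving_cons (σ.prod ν) n).comp
    (Measure.measurePreserving_swap (μ := Measure.pi fun _ : Fin n => σ.prod ν) (ν := σ.prod ν))
  have hm2 : AEMeasurable (fun p : (Fin n → T × ℝ) × (T × ℝ) => ‖F (Fin.cons p.2 p.1)‖ₑ ^ 2 *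
      ENNReal.ofReal (wt r (Fin.cons p.2 p.1 : Fin (n + 1) → T × ℝ)))
      ((Measure.pi fun _ : Fin n => σ.prod ν).prod (σ.prod ν)) :=
    hm.comp_quasiMeasurePreserving mp.quasiMeasurePreserving
  have e : wnorm r F = ∫⁻ z, ∫⁻ w, ‖F (Fin.cons w z)‖ₑ ^ 2 *
      ENNReal.ofReal (wt r (Fin.cons w z : Fin (n + 1) → T × ℝ)) ∂(σ.prod ν)
        ∂(Measure.pi fun _ : Fin n => σ.prod ν) := by
    rw [wnorm, ← lintegral_comp_measurePreserving mp hm]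
    exact lintegral_prod _ hm2
  have hsl : ∀ᵐ z ∂(Measure.pi fun _ : Fin n => σ.prod ν),
      AEStronglyMeasurable (fun w => F (Fin.cons w z)) (σ.prod ν) :=
    ((Lp.aestronglyMeasurable F).comp_measurePreserving mp).prodMk_left
  rw [e, ← lintegral_const_mul'' _ hm2.lintegral_prod_right', wnorm]
  refine lintegral_mono_ae ?_
  filter_upwards [adjoint_tens_ae h F, hsl] with z hz hzm
  rw [hz]
  have h1 : ‖∫ w, conj (h w) * F (Fin.cons w z) ∂(σ.prod ν)‖ₑ ^ 2 ≤
      (∫⁻ w, ‖h w‖ₑ ^ 2 ∂(σ.prod ν)) * ∫⁻ w, ‖F (Fin.cons w z)‖ₑ ^ 2 ∂(σ.prod ν) := by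
    have h2 := (enorm_integral_le_lintegral_enorm fun w => conj (h w) * F (Fin.cons w z)).trans
      ((lintegral_congr fun w => by rw [enorm_mul, RCLike.enorm_conj]; rfl).trans_le
      (ENNReal.lintegral_mul_le_Lp_mul_Lq (σ.prod ν) Real.HolderConjugate.two_two
        (Lp.aestronglyMeasurable h).enorm hzm.enorm))
    refine (pow_le_pow_left' h2 2).trans_eq ?_
    have e3 : ∀ a : ℝ≥0∞, (a ^ (1 / (2 : ℝ))) ^ 2 = a := fun a => by
      rw [← ENNReal.rpow_natCast, ← ENNReal.rpow_mul]
      norm_num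
    simp only [mul_pow, e3, ENNReal.rpow_two]
  refine (mul_le_mul_left h1 _).trans ?_
  rw [mul_assoc, ← lintegral_mul_const'' _ (hzm.enorm.pow_const 2)]
  gcongr with w
  rw [wt_succ]
  simp only [Fin.cons_succ]
  exact le_mul_of_one_le_left (zero_le_one.trans (one_le_wt r z))
    (one_le_pow₀ (by nlinarith [sq_nonneg ((Fin.cons w z : Fin (n + 1) → T × ℝ) 0).2]))

theorem norm_sq_eq_wnorm (F : L2 (σ.prod ν) n) : ENNReal.ofReal (‖F‖ ^ 2) = wnorm 0 F := by
  rw [norm_sq_L2, ofReal_integral_eq_lintegral_ofReal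
    (integrable_norm_sq_of_memLp (Lp.memLp F)) (Filter.Eventually.of_forall fun _ => by positivity)]
  refine lintegral_congr fun z => ?_
  simp [wt, ENNReal.ofReal_pow]

/-- All moments of ν are finite. Since every weight is available on the domain, each use of the
neutral operator may cost one unit of `r`. -/
theorem wnorm_lt_top [HasExpMoment ν] (r : ℕ) {F : L2 (σ.prod ν) n} (hF : F ∈ polyPart σ ν n) :
    wnorm r F < ∞ := by
  induction hF using Submodule.span_induction with
  | mem F h =>
    obtain ⟨i, f, rfl⟩ := h
    have hp : Integrable (fun x : Fin n → ℝ => ∏ j, (x j ^ (2 * i j) * (1 + x j ^ 2) ^ r))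
        (Measure.pi fun _ => ν) := by
      refine Integrable.fintype_prod (𝕜 := ℝ)
        (f := fun (j : Fin n) (x : ℝ) => x ^ (2 * i j) * (1 + x ^ 2) ^ r) fun j => ?_
      refine (integrable_eval ν (Polynomial.X ^ (2 * i j) * (1 + Polynomial.X ^ 2) ^ r)).congr
        (Filter.Eventually.of_forall fun x => ?_)
      simp
    have hi := ((integrable_norm_sq_of_memLp (Lp.memLp f)).mul_prod hp)
    have hi2 := ((measurePreserving_arrowProdEquivProdArrow T ℝ (Fin n)
      (fun _ => σ) (fun _ => ν)).integrable_comp hi.1).2 hi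
    refine lt_of_le_of_lt (le_of_eq ?_) hi2.2
    refine lintegral_congr_ae ?_
    filter_upwards [polyElt_ae σ ν i f] with z hz
    have e1 : ∏ j, ((z j).2 ^ (2 * i j) * (1 + (z j).2 ^ 2) ^ r) =
        ‖∏ j, ((z j).2 : ℂ) ^ i j‖ ^ 2 * wt r z := by
      rw [Finset.prod_mul_distrib, norm_prod, ← Finset.prod_pow]
      congr 1
      refine Finset.prod_congr rfl fun j _ => ?_
      rw [norm_pow, Complex.norm_real, Real.norm_eq_abs, ← pow_mul, mul_comm (i j) 2, pow_mul, pow_mul,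
        sq_abs]
    change _ = ‖‖f (fun j => (z j).1)‖ ^ 2 *
      ∏ j, ((z j).2 ^ (2 * i j) * (1 + (z j).2 ^ 2) ^ r)‖ₑ
    rw [e1, hz, enorm_mul, ← mul_assoc, ← mul_pow, ← norm_mul, Real.enorm_of_nonneg
      (mul_nonneg (by positivity) (zero_le_one.trans (one_le_wt r z))),
      ENNReal.ofReal_mul (by positivity), ENNReal.ofReal_pow (norm_nonneg _), ofReal_norm,
      enorm_mul]
  | zero =>
    have := wnorm_smul r (0 : ℂ) (0 : L2 (σ.prod ν) n)
    rw [zero_smul] at this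
    rw [this]
    simp
  | add F G _ _ hF hG =>
    have := wnorm_sum_le r Finset.univ ![F, G]
    simp only [Fin.sum_univ_two, Matrix.cons_val_zero, Matrix.cons_val_one] at this
    exact this.trans_lt (ENNReal.mul_lt_top (by simp) (ENNReal.add_lt_top.2 ⟨hF, hG⟩))
  | smul c F _ hF =>
    rw [wnorm_smul]
    exact ENNReal.mul_lt_top (by simp) hF

end Weights

/-! ### Creation, neutral and annihilation operators level by level -/

section DomainLevels

variable {T : Type u} [TopologicalSpace T] [MeasurableSpace T]
  {σ : Measure T} [SigmaFinite σ] [IsFiniteMeasureOnCompacts σ]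
  {ν : Measure ℝ} [IsProbabilityMeasure ν] [HasExpMoment ν] {K : HermKernel T}

variable (σ ν K) in
/-- The `l`-particle component of an element of the domain. -/
def Dom.proj (l : ℕ) : Dom σ ν K →ₗ[ℂ] dom σ ν K l := DFinsupp.lapply l

variable (σ ν K) in
/-- The element of the domain whose only component is a given `n`-particle one. -/
def Dom.single (n : ℕ) : dom σ ν K n →ₗ[ℂ] Dom σ ν K :=
  DFinsupp.lsingle (R := ℂ) (M := fun n => dom σ ν K n) n

theorem Dom.ext {E E' : Dom σ ν K} (h : ∀ l, Dom.proj σ ν K l E = Dom.proj σ ν K l E') : E = E' :=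
  DFinsupp.ext h

@[simp] theorem Dom.proj_single_same (n : ℕ) (F : dom σ ν K n) :
    Dom.proj σ ν K n (Dom.single σ ν K n F) = F := DFinsupp.single_eq_same

theorem Dom.proj_single_ne {l n : ℕ} (h : l ≠ n) (F : dom σ ν K n) :
    Dom.proj σ ν K l (Dom.single σ ν K n F) = 0 := DFinsupp.single_eq_of_ne h

theorem Dom.exists_bound (E : Dom σ ν K) : ∃ N, ∀ l, N < l → Dom.proj σ ν K l E = 0 := by
  classical
  refine ⟨(DFinsupp.support E).sup id, fun l hl => ?_⟩
  by_contra h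
  exact hl.not_ge (Finset.le_sup (f := id) (DFinsupp.mem_support_iff.2 h))

theorem Dom.induction {p : Dom σ ν K → Prop} (h0 : p 0)
    (hadd : ∀ E E', p E → p E' → p (E + E')) (hs : ∀ n F, p (Dom.single σ ν K n F)) (E) : p E :=
  DFinsupp.induction E h0 fun n F E' _ _ h => hadd _ _ (hs n F) h

theorem aPlus_single (f : B0 T) (p : ℝ[X]) (n : ℕ) (F : dom σ ν K n) :
    aPlus σ ν K f p (Dom.single σ ν K n F) = Dom.single σ ν K (n + 1) (creaDom σ ν K f p n F) :=
  DFinsupp.lsum_single _ _ _ _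

theorem aZero_single (f : B0 T) (p : ℝ[X]) (n : ℕ) (F : dom σ ν K n) :
    aZero σ ν K f p (Dom.single σ ν K n F) = Dom.single σ ν K n (neutDom σ ν K f p n F) :=
  DFinsupp.mapRange_single (hf := fun n => map_zero (neutDom σ ν K f p n))

theorem aMinus_single_zero (f : B0 T) (p : ℝ[X]) (F : dom σ ν K 0) :
    aMinus σ ν K f p (Dom.single σ ν K 0 F) = 0 :=
  DFinsupp.lsum_single _ _ _ _

theorem aMinus_single_succ (f : B0 T) (p : ℝ[X]) (n : ℕ) (F : dom σ ν K (n + 1)) :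
    aMinus σ ν K f p (Dom.single σ ν K (n + 1) F) = Dom.single σ ν K n (anniDom σ ν K f p n F) :=
  DFinsupp.lsum_single _ _ _ _

theorem proj_aPlus_zero (f : B0 T) (p : ℝ[X]) (E : Dom σ ν K) :
    Dom.proj σ ν K 0 (aPlus σ ν K f p E) = 0 := by
  induction E using Dom.induction with
  | h0 => simp
  | hadd E E' h h' => rw [map_add, map_add, h, h', add_zero]
  | hs n F => rw [aPlus_single, Dom.proj_single_ne (Nat.succ_ne_zero n).symm]

theorem proj_aPlus_succ (f : B0 T) (p : ℝ[X]) (l : ℕ) (E : Dom σ ν K) :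
    Dom.proj σ ν K (l + 1) (aPlus σ ν K f p E) = creaDom σ ν K f p l (Dom.proj σ ν K l E) := by
  induction E using Dom.induction with
  | h0 => simp
  | hadd E E' h h' => rw [map_add, map_add, h, h', map_add, map_add]
  | hs n F =>
    rw [aPlus_single]
    by_cases h : l = n
    · subst h
      simp
    · rw [Dom.proj_single_ne h, Dom.proj_single_ne (by omega), map_zero]

theorem proj_aZero (f : B0 T) (p : ℝ[X]) (l : ℕ) (E : Dom σ ν K) :
    Dom.proj σ ν K l (aZero σ ν K f p E) = neutDom σ ν K f p l (Dom.proj σ ν K l E) := rfl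

theorem proj_aMinus (f : B0 T) (p : ℝ[X]) (l : ℕ) (E : Dom σ ν K) :
    Dom.proj σ ν K l (aMinus σ ν K f p E) = anniDom σ ν K f p l (Dom.proj σ ν K (l + 1) E) := by
  induction E using Dom.induction with
  | h0 => simp
  | hadd E E' h h' => rw [map_add, map_add, h, h', map_add, map_add]
  | hs n F =>
    cases n with
    | zero => rw [aMinus_single_zero, Dom.proj_single_ne (Nat.succ_ne_zero l), map_zero, map_zero]
    | succ n =>
      rw [aMinus_single_succ]
      by_cases h : l = n
      · subst h
        simp
      · rw [Dom.proj_single_ne h, Dom.proj_single_ne (by omega), map_zero]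

theorem coe_creaDom (f : B0 T) (p : ℝ[X]) (n : ℕ) (F : dom σ ν K n) :
    (creaDom σ ν K f p n F : L2 (σ.prod ν) (n + 1)) =
      symP K.lift (σ.prod ν) (n + 1) (tens (tensorPoly σ ν f p) n F) := rfl

theorem coe_anniDom (f : B0 T) (p : ℝ[X]) (n : ℕ) (F : dom σ ν K (n + 1)) :
    (anniDom σ ν K f p n F : L2 (σ.prod ν) n) = ((n : ℂ) + 1) •
      symP K.lift (σ.prod ν) n (ContinuousLinearMap.adjoint (tens (tensorPoly σ ν f p) n) F) :=
  coe_anni K.lift (tensorPoly σ ν f p) n ⟨F, dom_le σ ν K _ F.2⟩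

theorem neutDom_ae (f : B0 T) (q : ℝ[X]) (n : ℕ) (F : dom σ ν K n) :
    (neutDom σ ν K f q n F : L2 (σ.prod ν) n) =ᵐ[Measure.pi fun _ : Fin n => σ.prod ν]
      fun z => multiplier f q z * (F : L2 (σ.prod ν) n) z :=
  (memLp_multiplier σ ν K f q F).coeFn_toLp

theorem tensorPoly_notMem {f : B0 T} (p : ℝ[X]) {B : Set T} (hf : ∀ t ∈ B, f.toFun t = 0) :
    ∀ᵐ w ∂(σ.prod ν), tensorPoly σ ν f p w ≠ 0 → w.1 ∉ B := by
  filter_upwards [tensorPoly_ae σ ν f p] with w hw h hB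
  exact h (by rw [hw, hf _ hB]; simp)

variable {B : Set T} {m : ℕ}

theorem creaDom_mem_occ {f : B0 T} (p : ℝ[X]) (hf : ∀ t ∈ B, f.toFun t = 0) {n : ℕ}
    {F : dom σ ν K n} (hF : (F : L2 (σ.prod ν) n) ∈ occ σ ν B m n) :
    (creaDom σ ν K f p n F : L2 (σ.prod ν) (n + 1)) ∈ occ σ ν B m (n + 1) :=
  symP_mem_occ K (tens_mem_occ (tensorPoly_notMem p hf) hF)

theorem anniDom_mem_occ {f : B0 T} (p : ℝ[X]) (hf : ∀ t ∈ B, f.toFun t = 0) {n : ℕ}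
    {F : dom σ ν K (n + 1)} (hF : (F : L2 (σ.prod ν) (n + 1)) ∈ occ σ ν B m (n + 1)) :
    (anniDom σ ν K f p n F : L2 (σ.prod ν) n) ∈ occ σ ν B m n := by
  rw [coe_anniDom]
  exact Submodule.smul_mem _ _ (symP_mem_occ K (adjoint_tens_mem_occ (tensorPoly_notMem p hf) hF))

theorem neutDom_mem_occ (f : B0 T) (q : ℝ[X]) {n : ℕ}
    {F : dom σ ν K n} (hF : (F : L2 (σ.prod ν) n) ∈ occ σ ν B m n) :
    (neutDom σ ν K f q n F : L2 (σ.prod ν) n) ∈ occ σ ν B m n := by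
  rw [mem_occ]
  filter_upwards [mem_occ.1 hF, neutDom_ae f q n F] with z h1 h2 h
  exact h1 fun h' => h (by rw [h2, h', mul_zero])

variable (σ ν K B m) in
/-- The elements of the domain with exactly `m` particles in `B`. -/
def domOcc : Submodule ℂ (Dom σ ν K) :=
  ⨅ l, (occ σ ν B m l).comap ((dom σ ν K l).subtype ∘ₗ Dom.proj σ ν K l)

theorem mem_domOcc {E : Dom σ ν K} : E ∈ domOcc σ ν K B m ↔
    ∀ l, (Dom.proj σ ν K l E : L2 (σ.prod ν) l) ∈ occ σ ν B m l := by
  simp [domOcc]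

theorem single_mem_domOcc {n : ℕ} {F : dom σ ν K n}
    (hF : (F : L2 (σ.prod ν) n) ∈ occ σ ν B m n) : Dom.single σ ν K n F ∈ domOcc σ ν K B m := by
  rw [mem_domOcc]
  intro l
  by_cases h : l = n
  · subst h
    rwa [Dom.proj_single_same]
  · rw [Dom.proj_single_ne h]
    exact Submodule.zero_mem _

theorem aPlus_mem_domOcc {f : B0 T} (p : ℝ[X]) (hf : ∀ t ∈ B, f.toFun t = 0) {E : Dom σ ν K}
    (hE : E ∈ domOcc σ ν K B m) : aPlus σ ν K f p E ∈ domOcc σ ν K B m := by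
  rw [mem_domOcc] at hE ⊢
  rintro (_ | l)
  · rw [proj_aPlus_zero]
    exact Submodule.zero_mem _
  · rw [proj_aPlus_succ]
    exact creaDom_mem_occ p hf (hE l)

theorem aMinus_mem_domOcc {f : B0 T} (p : ℝ[X]) (hf : ∀ t ∈ B, f.toFun t = 0) {E : Dom σ ν K}
    (hE : E ∈ domOcc σ ν K B m) : aMinus σ ν K f p E ∈ domOcc σ ν K B m := by
  rw [mem_domOcc] at hE ⊢
  intro l
  rw [proj_aMinus]
  exact anniDom_mem_occ p hf (hE (l + 1))

theorem aZero_mem_domOcc (f : B0 T) (p : ℝ[X]) {E : Dom σ ν K}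
    (hE : E ∈ domOcc σ ν K B m) : aZero σ ν K f p E ∈ domOcc σ ν K B m := by
  rw [mem_domOcc] at hE ⊢
  intro l
  exact neutDom_mem_occ f p (hE l)

theorem xi_mem_domOcc {f : B0 T} (hf : ∀ t ∈ B, f.toFun t = 0) {E : Dom σ ν K}
    (hE : E ∈ domOcc σ ν K B m) : xi σ ν K f E ∈ domOcc σ ν K B m :=
  Submodule.add_mem _ (Submodule.add_mem _ (aPlus_mem_domOcc _ hf hE) (aZero_mem_domOcc _ _ hE))
    (aMinus_mem_domOcc _ hf hE)

theorem proj_eq_zero_of_mem_domOcc {E : Dom σ ν K} (hE : E ∈ domOcc σ ν K B m) {l : ℕ}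
    (hl : l < m) : Dom.proj σ ν K l E = 0 := by
  refine Subtype.ext (Lp.ext ?_)
  filter_upwards [mem_occ.1 (mem_domOcc.1 hE l),
    Lp.coeFn_zero ℂ 2 (Measure.pi fun _ : Fin l => σ.prod ν)] with z h1 h2
  refine Eq.trans ?_ h2.symm
  by_contra h
  have h3 := h1 h
  have h4 := count_add_count_compl B z
  omega

theorem mem_occ_compl {n : ℕ} {F : L2 (σ.prod ν) n} :
    F ∈ occ σ ν Bᶜ n n ↔ F ∈ occ σ ν B 0 n := by
  rw [mem_occ, mem_occ]
  refine Filter.eventually_congr (Filter.Eventually.of_forall fun z => ?_)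
  have := count_add_count_compl B z
  refine imp_congr Iff.rfl ⟨fun h => by omega, fun h => by omega⟩

/-- All n + 1 particles of `F` lie outside `B`, and a function living on `B` leaves that number
unchanged; but only n particles are left. -/
theorem anniDom_eq_zero {f : B0 T} (p : ℝ[X]) (hf : ∀ t ∈ Bᶜ, f.toFun t = 0) {n : ℕ}
    {F : dom σ ν K (n + 1)} (hF : (F : L2 (σ.prod ν) (n + 1)) ∈ occ σ ν B 0 (n + 1)) :
    anniDom σ ν K f p n F = 0 := by
  have h1 := anniDom_mem_occ p hf (mem_occ_compl.2 hF)
  have := proj_eq_zero_of_mem_domOcc (single_mem_domOcc h1) (Nat.lt_succ_self n)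
  rwa [Dom.proj_single_same] at this

theorem neutDom_eq_zero {f : B0 T} (p : ℝ[X]) (hf : ∀ t ∈ Bᶜ, f.toFun t = 0) {n : ℕ}
    {F : dom σ ν K n} (hF : (F : L2 (σ.prod ν) n) ∈ occ σ ν B 0 n) :
    neutDom σ ν K f p n F = 0 := by
  refine Subtype.ext (Lp.ext ?_)
  filter_upwards [neutDom_ae f p n F, mem_occ.1 hF,
    Lp.coeFn_zero ℂ 2 (Measure.pi fun _ : Fin n => σ.prod ν)] with z h1 h2 h3
  refine h1.trans (Eq.trans ?_ h3.symm)
  by_cases h : (F : L2 (σ.prod ν) n) z = 0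
  · simp [h]
  · have h4 := count_eq_zero_iff.1 (h2 h)
    have : multiplier f p z = 0 := Finset.sum_eq_zero fun j _ => by rw [hf _ (h4 j)]; simp
    simp [this]

theorem aMinus_eq_zero {f : B0 T} (p : ℝ[X]) (hf : ∀ t ∈ Bᶜ, f.toFun t = 0) {E : Dom σ ν K}
    (hE : E ∈ domOcc σ ν K B 0) : aMinus σ ν K f p E = 0 := by
  refine Dom.ext fun l => ?_
  rw [proj_aMinus, anniDom_eq_zero p hf (mem_domOcc.1 hE _), map_zero]

theorem aZero_eq_zero {f : B0 T} (p : ℝ[X]) (hf : ∀ t ∈ Bᶜ, f.toFun t = 0) {E : Dom σ ν K}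
    (hE : E ∈ domOcc σ ν K B 0) : aZero σ ν K f p E = 0 := by
  refine Dom.ext fun l => ?_
  rw [proj_aZero, neutDom_eq_zero p hf (mem_domOcc.1 hE _), map_zero]

/-- The only particle over `B` is the one just created, so the sum defining the multiplier reduces
to `q` at its jump variable. This is the mechanism that turns powers of ξ into powers of x. -/
theorem neutDom_creaDom {f g : B0 T} (p q : ℝ[X]) (hf : ∀ t ∈ Bᶜ, f.toFun t = 0)
    (hg : ∀ t ∈ B, g.toFun t = 1) (hg' : ∀ t ∈ Bᶜ, g.toFun t = 0) {n : ℕ}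
    {F : dom σ ν K n} (hF : (F : L2 (σ.prod ν) n) ∈ occ σ ν B 0 n) :
    neutDom σ ν K g q (n + 1) (creaDom σ ν K f p n F) = creaDom σ ν K f (q * p) n F := by
  refine Subtype.ext (Lp.ext ?_)
  -- It suffices to compare the tensors before symmetrization, since the multiplier is a symmetric
  -- function and passes through the average.
  have key : ∀ᵐ z ∂(Measure.pi fun _ : Fin (n + 1) => σ.prod ν),
      multiplier g q z * tens (tensorPoly σ ν f p) n (F : L2 (σ.prod ν) n) z =
        tens (tensorPoly σ ν f (q * p)) n (F : L2 (σ.prod ν) n) z := by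
    filter_upwards [tens_ae (tensorPoly σ ν f p) (F : L2 (σ.prod ν) n),
      tens_ae (tensorPoly σ ν f (q * p)) (F : L2 (σ.prod ν) n),
      (quasiMeasurePreserving_head (σ.prod ν) n).ae (tensorPoly_ae σ ν f p),
      (quasiMeasurePreserving_head (σ.prod ν) n).ae (tensorPoly_ae σ ν f (q * p)),
      (quasiMeasurePreserving_tail (σ.prod ν) n).ae (mem_occ.1 hF)] with z h1 h2 h3 h4 h5
    rw [h1, h2, h3, h4]
    by_cases h : (F : L2 (σ.prod ν) n) (fun j => z j.succ) = 0
    · simp [h]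
    · have h6 := count_eq_zero_iff.1 (h5 h)
      have h7 : multiplier g q z = (g.toFun (z 0).1 : ℂ) * ((q.eval (z 0).2 : ℝ) : ℂ) := by
        rw [multiplier, Fin.sum_univ_succ, add_eq_left]
        exact Finset.sum_eq_zero fun j _ => by rw [hg' _ (h6 j)]; simp
      rw [h7, eval_mul]
      by_cases h8 : (z 0).1 ∈ B
      · rw [hg _ h8]
        push_cast
        ring
      · rw [hf _ h8]
        simp
  filter_upwards [neutDom_ae g q (n + 1) (creaDom σ ν K f p n F),
    symP_ae K.lift (tens (tensorPoly σ ν f p) n (F : L2 (σ.prod ν) n)),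
    symP_ae K.lift (tens (tensorPoly σ ν f (q * p)) n (F : L2 (σ.prod ν) n)),
    ae_all_iff.2 fun π : Equiv.Perm (Fin (n + 1)) =>
      (measurePreserving_comp_perm (σ.prod ν) π).quasiMeasurePreserving.ae key] with z h1 h2 h3 h4
  rw [h1, coe_creaDom, coe_creaDom, h2, h3, mul_left_comm, Finset.mul_sum]
  congr 1
  refine Finset.sum_congr rfl fun π _ => ?_
  rw [← h4 π]
  have : multiplier g q (fun j => z (π j)) = multiplier g q z :=
    Equiv.sum_comp π fun j => (g.toFun (z j).1 : ℂ) * ((q.eval (z j).2 : ℝ) : ℂ)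
  rw [this, mul_left_comm]

theorem anniDom_creaDom {f g : B0 T} (p q : ℝ[X]) (hg : ∀ t ∈ Bᶜ, g.toFun t = 0) {n : ℕ}
    {F : dom σ ν K n} (hF : (F : L2 (σ.prod ν) n) ∈ occ σ ν B 0 n) :
    anniDom σ ν K g q n (creaDom σ ν K f p n F) =
      (inner ℂ (tensorPoly σ ν g q) (tensorPoly σ ν f p) : ℂ) • F := by
  have h1 : ∀ᵐ w ∂(σ.prod ν), tensorPoly σ ν g q w ≠ 0 → w ∈ Prod.fst ⁻¹' B := by
    filter_upwards [tensorPoly_notMem q hg] with w h1 h2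
    exact not_not.1 (h1 h2)
  have h2 : ∀ᵐ z ∂(Measure.pi fun _ : Fin n => σ.prod ν), (F : L2 (σ.prod ν) n) z ≠ 0 →
      ∀ j, z j ∉ Prod.fst ⁻¹' B := by
    filter_upwards [mem_occ.1 hF] with z h1 h2
    exact count_eq_zero_iff.1 (h1 h2)
  have h3 := anni_crea K.lift (tensorPoly σ ν f p) h1
    (⟨F, dom_le σ ν K _ F.2⟩ : qSym K.lift (σ.prod ν) n) h2
  refine Subtype.ext ?_
  rw [Submodule.coe_smul, ← h3]
  rfl

theorem inner_tensorPoly (f g : B0 T) (p q : ℝ[X]) :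
    (inner ℂ (tensorPoly σ ν g q) (tensorPoly σ ν f p) : ℂ) =
      ((∫ t, g.toFun t * f.toFun t ∂σ : ℝ) : ℂ) * ((∫ x, q.eval x * p.eval x ∂ν : ℝ) : ℂ) := by
  rw [L2.inner_def, ← integral_complex_ofReal, ← integral_complex_ofReal, ← integral_prod_mul]
  refine integral_congr_ae ?_
  filter_upwards [tensorPoly_ae σ ν f p, tensorPoly_ae σ ν g q] with w h1 h2
  rw [h1, h2]
  simp only [RCLike.inner_apply, map_mul, Complex.conj_ofReal]
  push_cast
  ring

theorem toFock_single (n : ℕ) (F : dom σ ν K n) : toFock σ ν K (Dom.single σ ν K n F) =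
    lp.single (E := fun n => FockLevel K.lift (σ.prod ν) n) 2 n (toLevel σ ν K n F) :=
  DFinsupp.lsum_single _ _ _ _

theorem toFock_apply (E : Dom σ ν K) (l : ℕ) :
    toFock σ ν K E l = toLevel σ ν K l (Dom.proj σ ν K l E) := by
  induction E using Dom.induction with
  | h0 => simp
  | hadd E E' h h' => rw [map_add, lp.coeFn_add, Pi.add_apply, h, h', map_add, map_add]
  | hs n F =>
    rw [toFock_single]
    by_cases h : l = n
    · subst h
      rw [lp.single_apply_self, Dom.proj_single_same]
    · rw [lp.single_apply_ne _ _ _ h, Dom.proj_single_ne h, map_zero]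

theorem norm_fockLevel_of (l : ℕ) (F : qSym K.lift (σ.prod ν) l) :
    ‖FockLevel.of K.lift (σ.prod ν) l F‖ = √(l.factorial : ℝ) * ‖(F : L2 (σ.prod ν) l)‖ :=
  Scaled.norm_of ⟨(l.factorial : ℝ), Set.mem_Ioi.2 (by exact_mod_cast l.factorial_pos)⟩
    (qSym K.lift (σ.prod ν) l) F

theorem norm_toLevel (l : ℕ) (F : dom σ ν K l) :
    ‖toLevel σ ν K l F‖ = √(l.factorial : ℝ) * ‖(F : L2 (σ.prod ν) l)‖ :=
  norm_fockLevel_of l _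

theorem norm_sq_toFock (E : Dom σ ν K) : HasSum
    (fun l => (l.factorial : ℝ) * ‖(Dom.proj σ ν K l E : L2 (σ.prod ν) l)‖ ^ 2)
    (‖toFock σ ν K E‖ ^ 2) := by
  have h1 := lp.hasSum_norm (p := 2) (by norm_num) (toFock σ ν K E)
  simp only [ENNReal.toReal_ofNat, Real.rpow_two] at h1
  convert h1 using 2 with l
  rw [toFock_apply, norm_toLevel, mul_pow, Real.sq_sqrt (by positivity)]

end DomainLevels

/-! ### Expansion of the powers of ⟨χ_Δ, ξ⟩ in σ(Δ) -/

section Estimates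

variable {T : Type u} [TopologicalSpace T] [MeasurableSpace T]
  {σ : Measure T} [SigmaFinite σ] [IsFiniteMeasureOnCompacts σ]
  {ν : Measure ℝ} [IsProbabilityMeasure ν] [HasExpMoment ν] {K : HermKernel T}

variable (ν) in
/-- The weighted moment `∫ p(x)² (1 + x²)^r ν(dx)`. -/
def wmom (p : ℝ[X]) (r : ℕ) : ℝ≥0∞ :=
  ∫⁻ x, ‖((p.eval x : ℝ) : ℂ)‖ₑ ^ 2 * ENNReal.ofReal ((1 + x ^ 2) ^ r) ∂ν

theorem wmom_ne_top (p : ℝ[X]) (r : ℕ) : wmom ν p r ≠ ∞ := by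
  have := (integrable_eval ν (p ^ 2 * (1 + Polynomial.X ^ 2) ^ r)).2
  refine (lt_of_le_of_lt (le_of_eq ?_) this).ne
  refine lintegral_congr fun x => ?_
  have h : 0 ≤ (1 + x ^ 2) ^ r := by positivity
  simp only [eval_mul, eval_pow, eval_add, eval_one, eval_X]
  rw [enorm_mul, enorm_pow, Real.enorm_of_nonneg h, ← ofReal_norm, ← ofReal_norm,
    Complex.norm_real]

theorem lintegral_tensorPoly (f : B0 T) (p : ℝ[X]) (r : ℕ) :
    ∫⁻ w, ‖tensorPoly σ ν f p w‖ₑ ^ 2 * ENNReal.ofReal ((1 + w.2 ^ 2) ^ r) ∂(σ.prod ν) =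
      (∫⁻ t, ‖(f.toFun t : ℂ)‖ₑ ^ 2 ∂σ) * wmom ν p r := by
  have h1 : Measurable fun t => ‖(f.toFun t : ℂ)‖ₑ ^ 2 :=
    ((Complex.measurable_ofReal.comp f.measurable_toFun).enorm.pow_const 2)
  have h2 : Measurable fun x => ‖((p.eval x : ℝ) : ℂ)‖ₑ ^ 2 * ENNReal.ofReal ((1 + x ^ 2) ^ r) :=
    ((Complex.continuous_ofReal.comp p.continuous).measurable.enorm.pow_const 2).mul
      (by fun_prop)
  rw [wmom, ← lintegral_prod_mul h1.aemeasurable h2.aemeasurable]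
  refine lintegral_congr_ae ?_
  filter_upwards [tensorPoly_ae σ ν f p] with w hw
  rw [hw, enorm_mul]
  ring

theorem lintegral_indicator_sq {Δ : Set T} (hΔ : MeasurableSet Δ) (hc : IsCompact (closure Δ)) :
    ∫⁻ t, ‖((B0.indicator Δ hΔ hc).toFun t : ℂ)‖ₑ ^ 2 ∂σ = σ Δ := by
  rw [← lintegral_indicator_one hΔ]
  refine lintegral_congr fun t => ?_
  by_cases h : t ∈ Δ <;> simp [B0.indicator, h]

variable {n : ℕ}

theorem wnorm_creaDom_le {Δ : Set T} (hΔ : MeasurableSet Δ) (hc : IsCompact (closure Δ))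
    (p : ℝ[X]) (r : ℕ) (F : dom σ ν K n) :
    wnorm r (creaDom σ ν K (B0.indicator Δ hΔ hc) p n F : L2 (σ.prod ν) (n + 1)) ≤
      σ Δ * (wmom ν p r * wnorm r (F : L2 (σ.prod ν) n)) := by
  rw [coe_creaDom]
  refine (wnorm_symP_le K r _).trans ?_
  rw [wnorm_tens, lintegral_tensorPoly, lintegral_indicator_sq, mul_assoc]

theorem wnorm_anniDom_le {Δ : Set T} (hΔ : MeasurableSet Δ) (hc : IsCompact (closure Δ))
    (p : ℝ[X]) (r : ℕ) (F : dom σ ν K (n + 1)) :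
    wnorm r (anniDom σ ν K (B0.indicator Δ hΔ hc) p n F : L2 (σ.prod ν) n) ≤
      σ Δ * (((n : ℝ≥0∞) + 1) ^ 2 * wmom ν p 0 * wnorm r (F : L2 (σ.prod ν) (n + 1))) := by
  rw [coe_anniDom, wnorm_smul]
  have h1 : ‖(n : ℂ) + 1‖ₑ = (n : ℝ≥0∞) + 1 := by
    rw [← Nat.cast_succ, ← ofReal_norm, Complex.norm_natCast, ENNReal.ofReal_natCast]
    push_cast
    rfl
  have h2 := (wnorm_symP_le K r _).trans (wnorm_adjoint_tens_le r
    (tensorPoly σ ν (B0.indicator Δ hΔ hc) p) (F : L2 (σ.prod ν) (n + 1)))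
  have h3 := lintegral_tensorPoly (σ := σ) (ν := ν) (B0.indicator Δ hΔ hc) p 0
  simp only [pow_zero, ENNReal.ofReal_one, mul_one] at h3
  rw [h3, lintegral_indicator_sq] at h2
  rw [h1]
  refine (mul_le_mul_right h2 _).trans_eq ?_
  ring

/-- Each xⱼ² is bounded by the weight with r = 1; the square of a sum of `n` terms gives the factor
n². -/
theorem wnorm_neutDom_le {f : B0 T} (hf : ∀ t, |f.toFun t| ≤ 1) (r : ℕ) (F : dom σ ν K n) :
    wnorm r (neutDom σ ν K f Polynomial.X n F : L2 (σ.prod ν) n) ≤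
      (n : ℝ≥0∞) ^ 2 * wnorm (r + 1) (F : L2 (σ.prod ν) n) := by
  rw [wnorm, wnorm, ← lintegral_const_mul' _ _ (by simp)]
  refine lintegral_mono_ae ?_
  filter_upwards [neutDom_ae f Polynomial.X n F] with z hz
  have h1 : ‖multiplier f Polynomial.X z‖ ^ 2 ≤ (n : ℝ) ^ 2 * wt 1 z := by
    have h2 : ∀ j, ‖(f.toFun (z j).1 : ℂ) * ((Polynomial.X.eval (z j).2 : ℝ) : ℂ)‖ ^ 2 ≤
        wt 1 z := fun j => by
      rw [norm_mul, mul_pow, Complex.norm_real, Complex.norm_real, eval_X, Real.norm_eq_abs,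
        Real.norm_eq_abs, sq_abs (z j).2]
      have h3 : |f.toFun (z j).1| ^ 2 ≤ 1 := pow_le_one₀ (abs_nonneg _) (hf _)
      have h4 : 1 + (z j).2 ^ 2 ≤ wt 1 z := by
        rw [wt, ← Finset.mul_prod_erase _ _ (Finset.mem_univ j), pow_one]
        refine le_mul_of_one_le_right (by positivity) ?_
        refine (Finset.prod_const_one (s := Finset.univ.erase j)).symm.le.trans
          (Finset.prod_le_prod (fun _ _ => zero_le_one) fun i _ => ?_)
        nlinarith [sq_nonneg (z i).2]
      nlinarith [sq_nonneg (z j).2]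
    calc ‖multiplier f Polynomial.X z‖ ^ 2
        ≤ (∑ j, ‖(f.toFun (z j).1 : ℂ) * ((Polynomial.X.eval (z j).2 : ℝ) : ℂ)‖) ^ 2 :=
          pow_le_pow_left₀ (norm_nonneg _) (norm_sum_le _ _) 2
      _ ≤ (Finset.univ : Finset (Fin n)).card *
          ∑ j, ‖(f.toFun (z j).1 : ℂ) * ((Polynomial.X.eval (z j).2 : ℝ) : ℂ)‖ ^ 2 :=
          sq_sum_le_card_mul_sum_sq
      _ ≤ (Finset.univ : Finset (Fin n)).card * ∑ _j : Fin n, wt 1 z := by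
          gcongr with j
          exact h2 j
      _ = (n : ℝ) ^ 2 * wt 1 z := by simp; ring
  have h3 : wt (r + 1) z = wt 1 z * wt r z := by
    rw [wt, wt, wt, ← Finset.prod_mul_distrib]
    exact Finset.prod_congr rfl fun j _ => by ring
  have h4 : ‖multiplier f Polynomial.X z‖ₑ ^ 2 ≤ (n : ℝ≥0∞) ^ 2 * ENNReal.ofReal (wt 1 z) := by
    have := ENNReal.ofReal_le_ofReal h1
    rw [ENNReal.ofReal_mul (by positivity), ENNReal.ofReal_pow (norm_nonneg _), ofReal_norm,
      ENNReal.ofReal_pow (by positivity), ENNReal.ofReal_natCast] at this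
    exact this
  rw [hz, enorm_mul, mul_pow, h3, ENNReal.ofReal_mul (zero_le_one.trans (one_le_wt 1 z))]
  calc _ = ‖multiplier f Polynomial.X z‖ₑ ^ 2 *
        (‖(F : L2 (σ.prod ν) n) z‖ₑ ^ 2 * ENNReal.ofReal (wt r z)) := by ring
    _ ≤ ((n : ℝ≥0∞) ^ 2 * ENNReal.ofReal (wt 1 z)) *
        (‖(F : L2 (σ.prod ν) n) z‖ₑ ^ 2 * ENNReal.ofReal (wt r z)) := by gcongr
    _ = _ := by ring

theorem wnorm_add_le (r : ℕ) (F G : L2 (σ.prod ν) n) :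
    wnorm r (F + G) ≤ 2 * (wnorm r F + wnorm r G) := by
  have := wnorm_sum_le r Finset.univ ![F, G]
  simpa using this

theorem wnorm_zero (r : ℕ) : wnorm r (0 : L2 (σ.prod ν) n) = 0 := by
  have := wnorm_smul r (0 : ℂ) (0 : L2 (σ.prod ν) n)
  rw [zero_smul] at this
  rw [this]
  simp

/-- The order in `σ(Δ)` of the remainder of `⟨χ_Δ, ξ⟩^k F` in the `l`-particle space. -/
def remOrder (n l : ℕ) : ℕ := if l ≤ n then 4 else if l = n + 1 then 3 else 2

/-- Creation and annihilation gain a factor σ(Δ) in the squared norm, while `remOrder` changes by at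
most one between neighbouring levels. The neutral part stays at its level and only raises `r`. This
is why the orders descend as 4, 3, 2: a remainder at level n + 2 has to reach level n by two
annihilations with order 4. -/
theorem wnorm_proj_xi_le {Δ : Set T} (hΔ : MeasurableSet Δ) (hc : IsCompact (closure Δ))
    (h1 : σ Δ ≤ 1) {E : Dom σ ν K} {C : ℕ → ℕ → ℝ≥0∞}
    (hE : ∀ r l, wnorm r (Dom.proj σ ν K l E : L2 (σ.prod ν) l) ≤ C r l * σ Δ ^ remOrder n l)
    (r l : ℕ) :
    wnorm r (Dom.proj σ ν K l (xi σ ν K (B0.indicator Δ hΔ hc) E) : L2 (σ.prod ν) l) ≤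
      (4 * (wmom ν 1 r * C r (l - 1) + (l : ℝ≥0∞) ^ 2 * C (r + 1) l +
        ((l : ℝ≥0∞) + 1) ^ 2 * wmom ν 1 0 * C r (l + 1))) * σ Δ ^ remOrder n l := by
  have e1 : ∀ l, remOrder n (l + 1) ≤ remOrder n l + 1 := fun l => by
    unfold remOrder; split_ifs <;> omega
  have e2 : ∀ l, remOrder n l ≤ remOrder n (l + 1) + 1 := fun l => by
    unfold remOrder; split_ifs <;> omega
  have hp : ∀ a b : ℕ, a ≤ b + 1 → σ Δ * σ Δ ^ b ≤ σ Δ ^ a := fun a b hab => by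
    rw [← pow_succ']
    exact pow_le_pow_right_of_le_one' h1 hab
  have hA : wnorm r (Dom.proj σ ν K l (aPlus σ ν K (B0.indicator Δ hΔ hc) 1 E) :
      L2 (σ.prod ν) l) ≤ wmom ν 1 r * C r (l - 1) * σ Δ ^ remOrder n l := by
    -- At level 0 the creation part vanishes, so the truncated `l - 1` in the constant is harmless
    -- there.
    cases l with
    | zero => rw [proj_aPlus_zero, Submodule.coe_zero, wnorm_zero]; exact zero_le
    | succ l =>
      rw [proj_aPlus_succ]
      refine (wnorm_creaDom_le hΔ hc 1 r _).trans ?_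
      calc _ ≤ σ Δ * (wmom ν 1 r * (C r l * σ Δ ^ remOrder n l)) := by gcongr; exact hE r l
        _ = wmom ν 1 r * C r l * (σ Δ * σ Δ ^ remOrder n l) := by ring
        _ ≤ _ := by rw [Nat.add_sub_cancel]; gcongr; exact hp _ _ (e1 l)
  have hB : wnorm r (Dom.proj σ ν K l (aZero σ ν K (B0.indicator Δ hΔ hc) Polynomial.X E) :
      L2 (σ.prod ν) l) ≤ (l : ℝ≥0∞) ^ 2 * C (r + 1) l * σ Δ ^ remOrder n l := by
    rw [proj_aZero, mul_assoc]
    refine (wnorm_neutDom_le (fun t => ?_) r _).trans (by gcongr; exact hE (r + 1) l)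
    by_cases h : t ∈ Δ <;> simp [B0.indicator, h]
  have hC : wnorm r (Dom.proj σ ν K l (aMinus σ ν K (B0.indicator Δ hΔ hc) 1 E) :
      L2 (σ.prod ν) l) ≤
        ((l : ℝ≥0∞) + 1) ^ 2 * wmom ν 1 0 * C r (l + 1) * σ Δ ^ remOrder n l := by
    rw [proj_aMinus]
    refine (wnorm_anniDom_le hΔ hc 1 r _).trans ?_
    calc _ ≤ σ Δ * (((l : ℝ≥0∞) + 1) ^ 2 * wmom ν 1 0 *
          (C r (l + 1) * σ Δ ^ remOrder n (l + 1))) := by gcongr; exact hE r (l + 1)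
      _ = ((l : ℝ≥0∞) + 1) ^ 2 * wmom ν 1 0 * C r (l + 1) *
          (σ Δ * σ Δ ^ remOrder n (l + 1)) := by ring
      _ ≤ _ := by gcongr; exact hp _ _ (e2 l)
  rw [xi, LinearMap.add_apply, LinearMap.add_apply, map_add, map_add, Submodule.coe_add,
    Submodule.coe_add]
  -- The constant 4 comes from using ‖a + b‖² ≤ 2 (‖a‖² + ‖b‖²) twice for the three parts of ξ.
  refine (wnorm_add_le r _ _).trans ?_
  calc _ ≤ 2 * (2 * (wmom ν 1 r * C r (l - 1) * σ Δ ^ remOrder n l +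
          (l : ℝ≥0∞) ^ 2 * C (r + 1) l * σ Δ ^ remOrder n l) +
          2 * (((l : ℝ≥0∞) + 1) ^ 2 * wmom ν 1 0 * C r (l + 1) * σ Δ ^ remOrder n l)) := by
        gcongr
        · exact (wnorm_add_le r _ _).trans (by gcongr)
        · exact hC.trans (le_mul_of_one_le_left (zero_le) one_le_two)
    _ = _ := by ring

variable (ν) in
/-- The coefficients of the first order vacuum contribution to the powers of `⟨χ_Δ, ξ⟩`. -/
def vacCoeff : ℕ → ℂ
  | 0 => 0
  | k + 1 => ((∫ x, x ^ k ∂ν : ℝ) : ℂ)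

variable (σ ν K) in
/-- The scalar multiple of `σ(Δ)` to be subtracted from `⟨χ_Δ, ξ⟩^{k + 1}`. -/
def vacShift (k : ℕ) (Δ : Set T) : ℂ := vacCoeff ν k * ((σ Δ).toReal : ℂ)

/-- The remainder of `⟨χ_Δ, ξ⟩^{k + 1} F` after the terms of first order in `σ(Δ)`. -/
def xiRem (k : ℕ) {Δ : Set T} (hΔ : MeasurableSet Δ) (hc : IsCompact (closure Δ)) (E : Dom σ ν K) :
    Dom σ ν K :=
  (xi σ ν K (B0.indicator Δ hΔ hc) ^ (k + 1)) E - vacShift σ ν k Δ • E -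
    aPlus σ ν K (B0.indicator Δ hΔ hc) (Polynomial.X ^ k) E

theorem indicator_eq_zero {Δ : Set T} (hΔ : MeasurableSet Δ) (hc : IsCompact (closure Δ)) :
    ∀ t ∈ Δᶜ, (B0.indicator Δ hΔ hc).toFun t = 0 := fun _ ht => Set.indicator_of_notMem ht fun _ => (1 : ℝ)

theorem indicator_eq_one {Δ : Set T} (hΔ : MeasurableSet Δ) (hc : IsCompact (closure Δ)) :
    ∀ t ∈ Δ, (B0.indicator Δ hΔ hc).toFun t = 1 := fun _ ht => Set.indicator_of_mem ht fun _ => (1 : ℝ)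

theorem integral_indicator_sq {Δ : Set T} (hΔ : MeasurableSet Δ) (hc : IsCompact (closure Δ)) :
    ∫ t, (B0.indicator Δ hΔ hc).toFun t * (B0.indicator Δ hΔ hc).toFun t ∂σ = (σ Δ).toReal := by
  have : ∀ t, (B0.indicator Δ hΔ hc).toFun t * (B0.indicator Δ hΔ hc).toFun t =
      Δ.indicator 1 t := fun t => by
    by_cases h : t ∈ Δ <;> simp [B0.indicator, h]
  simp_rw [this]
  rw [integral_indicator_one hΔ]
  rfl

theorem xi_eq_aPlus {Δ : Set T} {f : B0 T} (hf : ∀ t ∈ Δᶜ, f.toFun t = 0) {E : Dom σ ν K}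
    (hE : E ∈ domOcc σ ν K Δ 0) : xi σ ν K f E = aPlus σ ν K f 1 E := by
  rw [xi, LinearMap.add_apply, LinearMap.add_apply, aMinus_eq_zero 1 hf hE,
    aZero_eq_zero _ hf hE, add_zero, add_zero]

/-- Apply ξ once more to the explicit terms of the expansion. On `F` itself only creation acts, with
the old scalar in front. On a⁺(χ_Δ ⊗ x^k) F the neutral part gives the new leading term with
x^(k+1), annihilation gives the new scalar, and creation gives the two-particle term. -/
theorem xiRem_succ (k : ℕ) {Δ : Set T} (hΔ : MeasurableSet Δ) (hc : IsCompact (closure Δ))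
    {F : dom σ ν K n} (hF : (F : L2 (σ.prod ν) n) ∈ occ σ ν Δ 0 n) :
    xiRem (k + 1) hΔ hc (Dom.single σ ν K n F) =
      xi σ ν K (B0.indicator Δ hΔ hc) (xiRem k hΔ hc (Dom.single σ ν K n F)) +
      (vacShift σ ν k Δ • Dom.single σ ν K (n + 1) (creaDom σ ν K (B0.indicator Δ hΔ hc) 1 n F) +
      Dom.single σ ν K (n + 2) (creaDom σ ν K (B0.indicator Δ hΔ hc) 1 (n + 1)
        (creaDom σ ν K (B0.indicator Δ hΔ hc) (Polynomial.X ^ k) n F))) := by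
  have h0 := indicator_eq_zero hΔ hc
  have h1 := indicator_eq_one hΔ hc
  have e1 := xi_eq_aPlus h0 (single_mem_domOcc (K := K) hF)
  have e2 : xi σ ν K (B0.indicator Δ hΔ hc) (Dom.single σ ν K (n + 1)
      (creaDom σ ν K (B0.indicator Δ hΔ hc) (Polynomial.X ^ k) n F)) =
      Dom.single σ ν K (n + 2) (creaDom σ ν K (B0.indicator Δ hΔ hc) 1 (n + 1)
        (creaDom σ ν K (B0.indicator Δ hΔ hc) (Polynomial.X ^ k) n F)) +
      Dom.single σ ν K (n + 1) (creaDom σ ν K (B0.indicator Δ hΔ hc) (Polynomial.X ^ (k + 1)) n F) +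
      vacShift σ ν (k + 1) Δ • Dom.single σ ν K n F := by
    rw [xi, LinearMap.add_apply, LinearMap.add_apply, aPlus_single, aZero_single,
      aMinus_single_succ, neutDom_creaDom _ _ h0 h1 h0 hF, anniDom_creaDom _ _ h0 hF,
      inner_tensorPoly, integral_indicator_sq, map_smul, pow_succ' Polynomial.X]
    simp only [eval_one, eval_pow, eval_X, one_mul, vacShift, vacCoeff]
    rw [mul_comm ((σ Δ).toReal : ℂ)]
  rw [aPlus_single] at e1
  unfold xiRem
  rw [pow_succ' _ (k + 1), Module.End.mul_apply, map_sub, map_sub, map_smul, e1, aPlus_single,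
    aPlus_single, e2]
  abel

theorem wnorm_proj_single_le (r l a : ℕ) (G : dom σ ν K a) {D : ℝ≥0∞} {v : ℝ≥0∞} {q : ℕ → ℕ}
    (h : wnorm r (G : L2 (σ.prod ν) a) ≤ D * v ^ q a) :
    wnorm r (Dom.proj σ ν K l (Dom.single σ ν K a G) : L2 (σ.prod ν) l) ≤ D * v ^ q l := by
  by_cases hl : l = a
  · subst hl
    rwa [Dom.proj_single_same]
  · rw [Dom.proj_single_ne hl, Submodule.coe_zero, wnorm_zero]
    exact zero_le

/-- Induction along `xiRem_succ`. The two new terms have order 3 at level n + 1 (a squared scalar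
times one creation) and order 2 at level n + 2 (two creations), as `remOrder` prescribes. All `r`
are treated together because ξ raises `r`, and the constants must not depend on Δ, as many cells
will be summed. -/
theorem exists_wnorm_xiRem_le (n k : ℕ) (F : dom σ ν K n) :
    ∃ (C : ℕ → ℕ → ℝ≥0∞) (N : ℕ), (∀ r l, C r l ≠ ∞) ∧
      ∀ (Δ : Set T) (hΔ : MeasurableSet Δ) (hc : IsCompact (closure Δ)), σ Δ ≤ 1 →
        (F : L2 (σ.prod ν) n) ∈ occ σ ν Δ 0 n →
        (∀ l, N < l → Dom.proj σ ν K l (xiRem k hΔ hc (Dom.single σ ν K n F)) = 0) ∧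
        ∀ r l, wnorm r (Dom.proj σ ν K l (xiRem k hΔ hc (Dom.single σ ν K n F)) :
          L2 (σ.prod ν) l) ≤ C r l * σ Δ ^ remOrder n l := by
  have hF : ∀ r, wnorm r (F : L2 (σ.prod ν) n) ≠ ∞ := fun r =>
    (wnorm_lt_top r ((mem_dom σ ν K).1 F.2).1).ne
  induction k with
  | zero =>
    refine ⟨fun _ _ => 0, 0, fun _ _ => by simp, fun Δ hΔ hc _ hFΔ => ?_⟩
    -- For k = 0 the expansion is exact: ξ acts on `F` as pure creation and the scalar is zero.
    have : xiRem 0 hΔ hc (Dom.single σ ν K n F) = 0 := by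
      unfold xiRem
      rw [zero_add, pow_one, pow_zero, xi_eq_aPlus (indicator_eq_zero hΔ hc)
        (single_mem_domOcc hFΔ), vacShift, vacCoeff]
      simp
    rw [this]
    exact ⟨fun l _ => map_zero _, fun r l => by
      rw [map_zero, Submodule.coe_zero, wnorm_zero]; exact zero_le⟩
  | succ k ih =>
    obtain ⟨C, N, hC, h⟩ := ih
    -- The summand with factor 4 is the constant of `wnorm_proj_xi_le`; the other two bound the new
    -- terms, with a factor 2 for each sum of vectors.
    refine ⟨fun r l => 2 * (4 * (wmom ν 1 r * C r (l - 1) + (l : ℝ≥0∞) ^ 2 * C (r + 1) l +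
        ((l : ℝ≥0∞) + 1) ^ 2 * wmom ν 1 0 * C r (l + 1)) + 
        2 * (‖vacCoeff ν k‖ₑ ^ 2 * (wmom ν 1 r * wnorm r (F : L2 (σ.prod ν) n)) +
          wmom ν 1 r * (wmom ν (Polynomial.X ^ k) r * wnorm r (F : L2 (σ.prod ν) n)))),
        N + n + 2, fun r l => ?_, fun Δ hΔ hc h1 hFΔ => ?_⟩
    · have h1 := wmom_ne_top (ν := ν) 1 r
      have h2 := wmom_ne_top (ν := ν) 1 0
      have h3 := wmom_ne_top (ν := ν) (Polynomial.X ^ k) r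
      finiteness [hC r (l - 1), hC (r + 1) l, hC r (l + 1), hF r]
    obtain ⟨hz, hb⟩ := h Δ hΔ hc h1 hFΔ
    rw [xiRem_succ k hΔ hc hFΔ]
    have hfin : σ Δ ≠ ∞ := (h1.trans_lt ENNReal.one_lt_top).ne
    constructor
    · intro l hl
      obtain ⟨l, rfl⟩ : ∃ j, l = j + 1 := ⟨l - 1, by omega⟩
      rw [map_add, map_add, map_smul, Dom.proj_single_ne (by omega), Dom.proj_single_ne (by omega),
        xi, LinearMap.add_apply, LinearMap.add_apply, map_add, map_add, proj_aPlus_succ, proj_aZero,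
        proj_aMinus, hz _ (by omega), hz _ (by omega), hz _ (by omega)]
      simp
    · intro r l
      have b1 := wnorm_proj_xi_le hΔ hc h1 hb r l
      have b2 : wnorm r (Dom.proj σ ν K l (vacShift σ ν k Δ • Dom.single σ ν K (n + 1)
          (creaDom σ ν K (B0.indicator Δ hΔ hc) 1 n F)) : L2 (σ.prod ν) l) ≤
          ‖vacCoeff ν k‖ₑ ^ 2 * (wmom ν 1 r * wnorm r (F : L2 (σ.prod ν) n)) *
            σ Δ ^ remOrder n l := by
        rw [← map_smul]
        refine wnorm_proj_single_le r l (n + 1) _ ?_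
        have ho : remOrder n (n + 1) = 3 := by simp [remOrder]
        have hv : ‖((σ Δ).toReal : ℂ)‖ₑ = σ Δ := by
          rw [← ofReal_norm, Complex.norm_real, Real.norm_of_nonneg ENNReal.toReal_nonneg,
            ENNReal.ofReal_toReal hfin]
        rw [ho, Submodule.coe_smul, wnorm_smul, vacShift, enorm_mul, hv]
        refine (mul_le_mul_right (wnorm_creaDom_le hΔ hc 1 r F) _).trans_eq ?_
        ring
      have b3 : wnorm r (Dom.proj σ ν K l (Dom.single σ ν K (n + 2)
          (creaDom σ ν K (B0.indicator Δ hΔ hc) 1 (n + 1)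
            (creaDom σ ν K (B0.indicator Δ hΔ hc) (Polynomial.X ^ k) n F))) : L2 (σ.prod ν) l) ≤
          wmom ν 1 r * (wmom ν (Polynomial.X ^ k) r * wnorm r (F : L2 (σ.prod ν) n)) *
            σ Δ ^ remOrder n l := by
        refine wnorm_proj_single_le r l (n + 2) _ ?_
        have ho : remOrder n (n + 2) = 2 := by simp [remOrder]
        rw [ho]
        refine (wnorm_creaDom_le hΔ hc 1 r _).trans ?_
        calc _ ≤ σ Δ * (wmom ν 1 r * (σ Δ * (wmom ν (Polynomial.X ^ k) r *
              wnorm r (F : L2 (σ.prod ν) n)))) := by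
              gcongr
              exact wnorm_creaDom_le hΔ hc _ r F
          _ = _ := by ring
      rw [map_add, map_add, Submodule.coe_add, Submodule.coe_add]
      refine (wnorm_add_le r _ _).trans ?_
      rw [mul_assoc 2, add_mul, mul_assoc 2, add_mul]
      gcongr
      exact (wnorm_add_le r _ _).trans (by gcongr)

end Estimates

/-! ### Creation operators as limits of elements of the algebra -/

section Limits

variable {T : Type u} [TopologicalSpace T] [MeasurableSpace T]
  {σ : Measure T} [SigmaFinite σ] [IsFiniteMeasureOnCompacts σ]
  {ν : Measure ℝ} [IsProbabilityMeasure ν] [HasExpMoment ν] {K : HermKernel T}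

theorem norm_sq_sum_of_pairwise_orthogonal {E ι : Type*} [NormedAddCommGroup E]
    [InnerProductSpace ℂ E] (s : Finset ι) (G : ι → E)
    (h : ∀ i ∈ s, ∀ j ∈ s, i ≠ j → inner ℂ (G i) (G j) = 0) :
    ‖∑ i ∈ s, G i‖ ^ 2 = ∑ i ∈ s, ‖G i‖ ^ 2 := by
  rw [@norm_sq_eq_re_inner ℂ, sum_inner, map_sum]
  refine Finset.sum_congr rfl fun i hi => ?_
  rw [inner_sum, Finset.sum_eq_single i (fun j hj hij => h i hi j hj hij.symm)
    (fun h => (h hi).elim), ← norm_sq_eq_re_inner]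

theorem inner_eq_zero_of_ae {Y : Type u} [MeasurableSpace Y] {m : Measure Y} {F G : Lp ℂ 2 m}
    (h : ∀ᵐ y ∂m, F y = 0 ∨ G y = 0) : (inner ℂ F G : ℂ) = 0 := by
  rw [L2.inner_def]
  refine integral_eq_zero_of_ae ?_
  filter_upwards [h] with y hy
  rcases hy with h | h <;> simp [h]

theorem xiPow_mem_domOcc {B : Set T} {m : ℕ} {f : B0 T} (hf : ∀ t ∈ B, f.toFun t = 0) (k : ℕ)
    {E : Dom σ ν K} (hE : E ∈ domOcc σ ν K B m) : (xi σ ν K f ^ k) E ∈ domOcc σ ν K B m := by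
  induction k with
  | zero => simpa using hE
  | succ k ih =>
    rw [pow_succ', Module.End.mul_apply]
    exact xi_mem_domOcc hf ih

theorem xiRem_mem_domOcc {B Δ : Set T} {m : ℕ} (k : ℕ) (hΔ : MeasurableSet Δ)
    (hc : IsCompact (closure Δ)) (h : Disjoint B Δ) {E : Dom σ ν K}
    (hE : E ∈ domOcc σ ν K B m) : xiRem k hΔ hc E ∈ domOcc σ ν K B m := by
  have hf : ∀ t ∈ B, (B0.indicator Δ hΔ hc).toFun t = 0 := fun t ht =>
    indicator_eq_zero hΔ hc t (Set.disjoint_left.1 h ht)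
  exact Submodule.sub_mem _ (Submodule.sub_mem _ (xiPow_mem_domOcc hf _ hE)
    (Submodule.smul_mem _ _ hE)) (aPlus_mem_domOcc _ hf hE)

variable {n : ℕ}

theorem occ_mono {B B' : Set T} (h : B ⊆ B') {F : L2 (σ.prod ν) n} (hF : F ∈ occ σ ν B' 0 n) :
    F ∈ occ σ ν B 0 n := by
  rw [mem_occ] at hF ⊢
  filter_upwards [hF] with z hz h0
  exact Nat.le_zero.1 ((count_le_of_subset h z).trans (hz h0).le)

/-- Where neither function vanishes, l - n particles lie in Δ altogether, yet l - n of them lie in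
`A` and l - n in `B`. As `A` and `B` are disjoint subsets of Δ, this is impossible for l > n. -/
theorem inner_eq_zero_of_occ {Δ A B : Set T} (hA : A ⊆ Δ) (hB : B ⊆ Δ) (hAB : Disjoint A B)
    {l : ℕ} (hl : n < l) {F G : L2 (σ.prod ν) l} (hF : F ∈ occ σ ν Aᶜ n l)
    (hF' : F ∈ occ σ ν Δᶜ n l) (hG : G ∈ occ σ ν Bᶜ n l) : (inner ℂ F G : ℂ) = 0 := by
  refine inner_eq_zero_of_ae ?_
  filter_upwards [mem_occ.1 hF, mem_occ.1 hF', mem_occ.1 hG] with z h1 h2 h3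
  by_contra! h
  have e1 := h1 h.1
  have e2 := h2 h.1
  have e3 := h3 h.2
  have c1 := count_add_count_compl A z
  have c2 := count_add_count_compl B z
  have c3 := count_add_count_compl Δ z
  have c4 := count_le_of_subset (Set.union_subset hA hB) z
  rw [count_union hAB] at c4
  omega

theorem norm_sq_le_of_wnorm_le {F : L2 (σ.prod ν) n} {C v : ℝ≥0∞} (hC : C ≠ ∞) (hv : v ≠ ∞)
    {q : ℕ} (h : wnorm 0 F ≤ C * v ^ q) : ‖F‖ ^ 2 ≤ C.toReal * v.toReal ^ q := by
  rw [← norm_sq_eq_wnorm] at h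
  have := ENNReal.toReal_mono (by finiteness) h
  rwa [ENNReal.toReal_ofReal (by positivity), ENNReal.toReal_mul, ENNReal.toReal_pow] at this

/-- There are two regimes: up to level `n` the triangle inequality suffices, above it orthogonality
of the cells is used. In both cases one factor of a cell's measure is traded for δ and the others
sum to a bound in terms of σ(Δ). -/
theorem exists_norm_sum_xiRem_single_le (k : ℕ) {Δ : Set T} (hc : IsCompact (closure Δ))
    {F : dom σ ν K n} (hF : (F : L2 (σ.prod ν) n) ∈ occ σ ν Δ 0 n) :
    ∃ M : ℝ, 0 ≤ M ∧ ∀ δ : ℝ, 0 < δ → δ ≤ 1 → ∀ (N : ℕ) (P : DisjointSets T N),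
      ⋃ i, P.set i = Δ → (∀ i, σ (P.set i) ≤ ENNReal.ofReal δ) →
      ‖toFock σ ν K (∑ i, xiRem k (P.meas i) (P.compact i) (Dom.single σ ν K n F))‖ ^ 2 ≤ M * δ := by
  obtain ⟨C, L, hC, hCb⟩ := exists_wnorm_xiRem_le n k F
  have hfin : σ Δ ≠ ∞ := ((measure_mono subset_closure).trans_lt hc.measure_lt_top).ne
  set V := (σ Δ).toReal with hV
  have hV0 : 0 ≤ V := ENNReal.toReal_nonneg
  refine ⟨∑ l ∈ Finset.range (L + 1), (l.factorial : ℝ) * ((C 0 l).toReal * (V ^ 2 + V)),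
    Finset.sum_nonneg fun l _ => by positivity, fun δ hδ hδ1 N P hP hσ => ?_⟩
  have hsub : ∀ i, P.set i ⊆ Δ := fun i => hP ▸ Set.subset_iUnion P.set i
  have hlt : ∀ i, σ (P.set i) ≠ ∞ := fun i => ne_top_of_le_ne_top hfin (measure_mono (hsub i))
  have hle1 : ∀ i, σ (P.set i) ≤ 1 := fun i => (hσ i).trans (by simpa using hδ1)
  set v : Fin N → ℝ := fun i => (σ (P.set i)).toReal with hv
  have hv0 : ∀ i, 0 ≤ v i := fun i => ENNReal.toReal_nonneg
  have hvδ : ∀ i, v i ≤ δ := fun i => ENNReal.toReal_le_of_le_ofReal hδ.le (hσ i)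
  have hvsum : ∑ i, v i = V := by
    rw [hV, ← hP, measure_iUnion P.disj P.meas, tsum_fintype,
      ENNReal.toReal_sum fun i _ => hlt i]
  set R := fun i => xiRem k (P.meas i) (P.compact i) (Dom.single σ ν K n F) with hR
  have hb := fun i => hCb (P.set i) (P.meas i) (P.compact i) (hle1 i) (occ_mono (hsub i) hF)
  have hnorm : ∀ i l, ‖(Dom.proj σ ν K l (R i) : L2 (σ.prod ν) l)‖ ^ 2 ≤
      (C 0 l).toReal * v i ^ remOrder n l := fun i l =>
    norm_sq_le_of_wnorm_le (hC 0 l) (hlt i) ((hb i).2 0 l)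
  have hocc : ∀ i l, (Dom.proj σ ν K l (R i) : L2 (σ.prod ν) l) ∈ occ σ ν (P.set i)ᶜ n l :=
    fun i => mem_domOcc.1 (xiRem_mem_domOcc k _ _ disjoint_compl_left
      (single_mem_domOcc (mem_occ_compl.2 (occ_mono (hsub i) hF))))
  have hocc' : ∀ i l, (Dom.proj σ ν K l (R i) : L2 (σ.prod ν) l) ∈ occ σ ν Δᶜ n l :=
    fun i => mem_domOcc.1 (xiRem_mem_domOcc k _ _
      (disjoint_compl_left.mono_right (hsub i)) (single_mem_domOcc (mem_occ_compl.2 hF)))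
  have hcoe : ∀ l, (Dom.proj σ ν K l (∑ i, R i) : L2 (σ.prod ν) l) =
      ∑ i, (Dom.proj σ ν K l (R i) : L2 (σ.prod ν) l) := fun l => by
    rw [map_sum, Submodule.coe_sum]
  have hlev : ∀ l, ‖(Dom.proj σ ν K l (∑ i, R i) : L2 (σ.prod ν) l)‖ ^ 2 ≤
      (C 0 l).toReal * (V ^ 2 + V) * δ := fun l => by
    rw [hcoe]
    rcases le_or_gt l n with hl | hl
    -- No orthogonality is available here, but the norms are of order vᵢ² ≤ δ vᵢ.
    · have h4 : remOrder n l = 4 := by simp [remOrder, hl]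
      have h5 : ∀ i, ‖(Dom.proj σ ν K l (R i) : L2 (σ.prod ν) l)‖ ≤
          √(C 0 l).toReal * (δ * v i) := fun i => by
        refine (Real.le_sqrt (norm_nonneg _) (by positivity)).2 (hnorm i l) |>.trans ?_
        rw [h4, Real.sqrt_mul ENNReal.toReal_nonneg]
        have : √(v i ^ 4) = v i * v i := by
          rw [show v i ^ 4 = (v i * v i) ^ 2 by ring, Real.sqrt_sq (mul_nonneg (hv0 i) (hv0 i))]
        rw [this]
        gcongr
        exact hvδ i
      have h6 : ‖∑ i, (Dom.proj σ ν K l (R i) : L2 (σ.prod ν) l)‖ ≤ √(C 0 l).toReal * (δ * V) := by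
        refine (norm_sum_le_of_le _ fun i _ => h5 i).trans_eq ?_
        rw [← Finset.mul_sum, ← Finset.mul_sum, hvsum]
      calc _ ≤ (√(C 0 l).toReal * (δ * V)) ^ 2 := pow_le_pow_left₀ (norm_nonneg _) h6 2
        _ = (C 0 l).toReal * (V ^ 2 * δ ^ 2) := by
          rw [mul_pow, Real.sq_sqrt ENNReal.toReal_nonneg]; ring
        _ ≤ (C 0 l).toReal * ((V ^ 2 + V) * δ) := by
          gcongr
          · linarith
          · nlinarith
        _ = _ := by ring
    -- Here squared norms add, and order vᵢ² ≤ δ vᵢ is needed only for them.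
    · have h2 : 2 ≤ remOrder n l := by unfold remOrder; split_ifs <;> omega
      rw [norm_sq_sum_of_pairwise_orthogonal _ _ fun i _ j _ hij =>
        inner_eq_zero_of_occ (hsub i) (hsub j) (P.disj hij) hl (hocc i l) (hocc' i l) (hocc j l)]
      have h5 : ∀ i, ‖(Dom.proj σ ν K l (R i) : L2 (σ.prod ν) l)‖ ^ 2 ≤
          (C 0 l).toReal * (δ * v i) := fun i => by
        refine (hnorm i l).trans ?_
        gcongr
        calc v i ^ remOrder n l ≤ v i ^ 2 :=
              pow_le_pow_of_le_one (hv0 i) ((hvδ i).trans hδ1) h2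
          _ = v i * v i := sq _
          _ ≤ _ := mul_le_mul_of_nonneg_right (hvδ i) (hv0 i)
      refine (Finset.sum_le_sum fun i _ => h5 i).trans ?_
      rw [← Finset.mul_sum, ← Finset.mul_sum, hvsum, mul_assoc, mul_comm δ]
      gcongr
      nlinarith [sq_nonneg V]
  have hs := norm_sq_toFock (∑ i, R i)
  rw [← hs.tsum_eq, tsum_eq_sum (s := Finset.range (L + 1)), Finset.sum_mul]
  · refine Finset.sum_le_sum fun l _ => ?_
    rw [mul_assoc]
    gcongr
    exact hlev l
  · intro l hl
    have : Dom.proj σ ν K l (∑ i, R i) = 0 := by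
      rw [map_sum]
      exact Finset.sum_eq_zero fun i _ => (hb i).1 l (by simpa using hl)
    simp [this]

theorem Dom.eq_sum_single (E : Dom σ ν K) : ∃ N, E =
    ∑ l ∈ Finset.range N, Dom.single σ ν K l (Dom.proj σ ν K l E) := by
  obtain ⟨N, hN⟩ := Dom.exists_bound E
  refine ⟨N + 1, Dom.ext fun m => ?_⟩
  rw [map_sum]
  by_cases hm : m ∈ Finset.range (N + 1)
  · rw [Finset.sum_eq_single_of_mem m hm fun l _ hl => Dom.proj_single_ne hl.symm _,
      Dom.proj_single_same]
  · rw [hN m (by simpa using hm)]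
    refine (Finset.sum_eq_zero fun l hl => Dom.proj_single_ne ?_ _).symm
    rintro rfl
    exact hm hl

theorem xiRem_sum {ι : Type*} (s : Finset ι) (k : ℕ) {Δ : Set T} (hΔ : MeasurableSet Δ)
    (hc : IsCompact (closure Δ)) (E : ι → Dom σ ν K) :
    xiRem k hΔ hc (∑ a ∈ s, E a) = ∑ a ∈ s, xiRem k hΔ hc (E a) := by
  simp only [xiRem, map_sum, Finset.smul_sum, Finset.sum_sub_distrib]

theorem exists_norm_sum_xiRem_le (k : ℕ) {Δ : Set T} (hc : IsCompact (closure Δ))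
    {E : Dom σ ν K} (hE : E ∈ domOcc σ ν K Δ 0) :
    ∃ M : ℝ, 0 ≤ M ∧ ∀ δ : ℝ, 0 < δ → δ ≤ 1 → ∀ (N : ℕ) (P : DisjointSets T N),
      ⋃ i, P.set i = Δ → (∀ i, σ (P.set i) ≤ ENNReal.ofReal δ) →
      ‖toFock σ ν K (∑ i, xiRem k (P.meas i) (P.compact i) E)‖ ^ 2 ≤ M * δ := by
  obtain ⟨L, hL⟩ := Dom.eq_sum_single E
  choose M hM0 hM using fun l => exists_norm_sum_xiRem_single_le k hc (mem_domOcc.1 hE l)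
  -- The factor `L` comes from Cauchy–Schwarz for the sum over the `L` components of `E`.
  refine ⟨L * ∑ l ∈ Finset.range L, M l,
    mul_nonneg (Nat.cast_nonneg _) (Finset.sum_nonneg fun l _ => hM0 l),
    fun δ hδ hδ1 N P hP hσ => ?_⟩
  have : ∑ i, xiRem k (P.meas i) (P.compact i) E = ∑ l ∈ Finset.range L,
      ∑ i, xiRem k (P.meas i) (P.compact i) (Dom.single σ ν K l (Dom.proj σ ν K l E)) := by
    rw [Finset.sum_comm]
    refine Finset.sum_congr rfl fun i _ => ?_
    conv_lhs => rw [hL]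
    rw [xiRem_sum]
  rw [this, map_sum]
  refine (pow_le_pow_left₀ (norm_nonneg _) (norm_sum_le _ _) 2).trans
    (sq_sum_le_card_mul_sum_sq.trans ?_)
  rw [Finset.card_range, mul_assoc, Finset.sum_mul]
  gcongr with l
  exact hM l δ hδ hδ1 N P hP hσ

theorem tens_sum {X ι : Type*} [MeasurableSpace X] {μ : Measure X} [SigmaFinite μ] (s : Finset ι)
    (h : ι → Lp ℂ 2 μ) (F : L2 μ n) :
    tens (∑ i ∈ s, h i) n F = ∑ i ∈ s, tens (h i) n F := by
  refine Lp.ext ?_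
  filter_upwards [tens_ae (∑ i ∈ s, h i) F, Lp.coeFn_fun_finsetSum s fun i => tens (h i) n F,
    (quasiMeasurePreserving_head μ n).ae (Lp.coeFn_fun_finsetSum s h),
    (Finset.eventually_all s).2 fun i _ => tens_ae (h i) F] with t h1 h2 h3 h4
  rw [h1, h2, h3, Finset.sum_mul]
  exact Finset.sum_congr rfl fun i hi => (h4 i hi).symm

theorem tensorPoly_sum {ι : Type*} (s : Finset ι) {f : B0 T} {g : ι → B0 T}
    (h : ∀ t, f.toFun t = ∑ i ∈ s, (g i).toFun t) (p : ℝ[X]) :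
    tensorPoly σ ν f p = ∑ i ∈ s, tensorPoly σ ν (g i) p := by
  refine Lp.ext ?_
  filter_upwards [tensorPoly_ae σ ν f p, Lp.coeFn_fun_finsetSum s fun i => tensorPoly σ ν (g i) p,
    (Finset.eventually_all s).2 fun i _ => tensorPoly_ae σ ν (g i) p] with w h1 h2 h3
  rw [h1, h2, h w.1, Finset.sum_congr rfl fun i hi => h3 i hi, ← Finset.sum_mul]
  push_cast
  rfl

theorem aPlus_sum {ι : Type*} (s : Finset ι) {f : B0 T} {g : ι → B0 T}
    (h : ∀ t, f.toFun t = ∑ i ∈ s, (g i).toFun t) (p : ℝ[X]) (E : Dom σ ν K) :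
    aPlus σ ν K f p E = ∑ i ∈ s, aPlus σ ν K (g i) p E := by
  refine Dom.ext fun l => ?_
  rw [map_sum]
  cases l with
  | zero => simp_rw [proj_aPlus_zero]; simp
  | succ l =>
    refine Subtype.ext ?_
    simp_rw [proj_aPlus_succ]
    rw [Submodule.coe_sum]
    simp_rw [coe_creaDom]
    rw [tensorPoly_sum s h, tens_sum, map_sum]

theorem norm_sq_creaDom {Δ : Set T} {f : B0 T} (p : ℝ[X]) (hf : ∀ t ∈ Δᶜ, f.toFun t = 0)
    {F : dom σ ν K n} (hF : (F : L2 (σ.prod ν) n) ∈ occ σ ν Δ 0 n) :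
    ((n : ℝ) + 1) * ‖(creaDom σ ν K f p n F : L2 (σ.prod ν) (n + 1))‖ ^ 2 =
      ‖tensorPoly σ ν f p‖ ^ 2 * ‖(F : L2 (σ.prod ν) n)‖ ^ 2 := by
  have h1 : ∀ᵐ w ∂(σ.prod ν), tensorPoly σ ν f p w ≠ 0 → w ∈ Prod.fst ⁻¹' Δ := by
    filter_upwards [tensorPoly_notMem p hf] with w h1 h2
    exact not_not.1 (h1 h2)
  have h2 : ∀ᵐ z ∂(Measure.pi fun _ : Fin n => σ.prod ν), (F : L2 (σ.prod ν) n) z ≠ 0 →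
      ∀ j, z j ∉ Prod.fst ⁻¹' Δ := by
    filter_upwards [mem_occ.1 hF] with z h1 h2
    exact count_eq_zero_iff.1 (h1 h2)
  have h3 := inner_symP_tens K.lift (g := tensorPoly σ ν f p) h1 (F : L2 (σ.prod ν) n)
    (dom_le σ ν K _ F.2) h2
  rw [← coe_creaDom, inner_self_eq_norm_sq_to_K, inner_self_eq_norm_sq_to_K,
    inner_self_eq_norm_sq_to_K] at h3
  refine Complex.ofReal_injective ?_
  push_cast
  exact h3

/-- The new particle is the only one over Δ, so symmetrization costs exactly a factor 1/(n+1) in the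
squared norm, which the weights n! compensate. On such vectors creation is therefore bounded
uniformly in the number of particles. -/
theorem norm_toFock_aPlus {Δ : Set T} {f : B0 T} (p : ℝ[X]) (hf : ∀ t ∈ Δᶜ, f.toFun t = 0)
    {E : Dom σ ν K} (hE : E ∈ domOcc σ ν K Δ 0) :
    ‖toFock σ ν K (aPlus σ ν K f p E)‖ = ‖tensorPoly σ ν f p‖ * ‖toFock σ ν K E‖ := by
  rw [← sq_eq_sq₀ (norm_nonneg _) (by positivity), mul_pow]
  have h1 := norm_sq_toFock (aPlus σ ν K f p E)
  have h2 := (norm_sq_toFock E).mul_left (‖tensorPoly σ ν f p‖ ^ 2)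
  rw [← h1.tsum_eq, ← h2.tsum_eq, h1.summable.tsum_eq_zero_add, proj_aPlus_zero]
  simp only [Submodule.coe_zero, norm_zero, ne_eq, OfNat.ofNat_ne_zero, not_false_eq_true, zero_pow,
    mul_zero, zero_add]
  refine tsum_congr fun l => ?_
  rw [proj_aPlus_succ, mul_left_comm, ← norm_sq_creaDom p hf (mem_domOcc.1 hE l), Nat.factorial_succ]
  push_cast
  ring

/-- The operators in the algebra generated by the `⟨f, ξ⟩` with `f` vanishing outside `S`. -/
def localAlg (σ : Measure T) [SigmaFinite σ] [IsFiniteMeasureOnCompacts σ]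
    (ν : Measure ℝ) [IsProbabilityMeasure ν] [HasExpMoment ν] (K : HermKernel T) (S : Set T) :
    Subalgebra ℂ (Module.End ℂ (Dom σ ν K)) :=
  Algebra.adjoin ℂ (xi σ ν K '' {f | ∀ t ∈ Sᶜ, f.toFun t = 0})

theorem localAlg_mono {S S' : Set T} (h : S ⊆ S') : localAlg σ ν K S ≤ localAlg σ ν K S' := by
  refine Algebra.adjoin_mono (Set.image_mono ?_)
  exact fun f hf t ht => hf t fun hS => ht (h hS)

theorem localAlg_mem_domOcc {S B : Set T} {m : ℕ} (h : Disjoint B S) {A : Module.End ℂ (Dom σ ν K)}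
    (hA : A ∈ localAlg σ ν K S) {E : Dom σ ν K} (hE : E ∈ domOcc σ ν K B m) :
    A E ∈ domOcc σ ν K B m := by
  induction hA using Algebra.adjoin_induction generalizing E with
  | mem x hx =>
    obtain ⟨f, hf, rfl⟩ := hx
    exact xi_mem_domOcc (fun t ht => hf t (Set.disjoint_left.1 h ht)) hE
  | algebraMap c => exact Submodule.smul_mem _ c hE
  | add x y _ _ hx hy => exact Submodule.add_mem _ (hx hE) (hy hE)
  | mul x y _ _ hx hy => exact hx (hy hE)

/-- For a fine partition of Δ the approximant is the sum over the cells of ξ(cell)^(k+1) minus the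
vacuum scalar. The creation terms of the cells add up to that of Δ, and the error is exactly the sum
of the remainders. -/
theorem aPlus_mem_closure [PolishSpace T] [LocallyCompactSpace T] [BorelSpace T]
    [NullSingletonClass σ] {Δ : Set T} (hΔ : MeasurableSet Δ) (hc : IsCompact (closure Δ)) (k : ℕ)
    {E : Dom σ ν K} (hE : E ∈ domOcc σ ν K Δ 0) :
    toFock σ ν K (aPlus σ ν K (B0.indicator Δ hΔ hc) (Polynomial.X ^ k) E) ∈
      closure ((fun A : Module.End ℂ (Dom σ ν K) => toFock σ ν K (A E)) '' localAlg σ ν K Δ) := by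
  obtain ⟨M, hM0, hM⟩ := exists_norm_sum_xiRem_le k hc hE
  rw [Metric.mem_closure_iff]
  intro ε hε
  obtain ⟨δ, hδ, hδ1, hMδ⟩ : ∃ δ : ℝ, 0 < δ ∧ δ ≤ 1 ∧ M * δ < ε ^ 2 := by
    refine ⟨min 1 (ε ^ 2 / (M + 1)), by positivity, min_le_left _ _, ?_⟩
    calc M * min 1 (ε ^ 2 / (M + 1)) ≤ M * (ε ^ 2 / (M + 1)) := by gcongr; exact min_le_right _ _
      _ < (M + 1) * (ε ^ 2 / (M + 1)) := by gcongr; linarith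
      _ = ε ^ 2 := by field_simp
  obtain ⟨N, P, hPm, hPσ, hPd, hPU⟩ := exists_fine_partition σ hΔ hc
    (δ := ENNReal.ofReal δ) (by simpa using hδ)
  have hsub : ∀ i, P i ⊆ Δ := fun i => hPU ▸ Set.subset_iUnion P i
  have hPc : ∀ i, IsCompact (closure (P i)) := fun i =>
    hc.of_isClosed_subset isClosed_closure (closure_mono (hsub i))
  set D : DisjointSets T N := ⟨P, hPm, hPc, hPd⟩
  have hb := hM δ hδ hδ1 N D hPU fun i => (hPσ i).le
  set A : Module.End ℂ (Dom σ ν K) := ∑ i, (xi σ ν K (B0.indicator (P i) (hPm i) (hPc i)) ^ (k + 1) -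
    vacShift σ ν k (P i) • 1) with hA
  have hAm : A ∈ localAlg σ ν K Δ := by
    refine Subalgebra.sum_mem _ fun i _ => Subalgebra.sub_mem _ (Subalgebra.pow_mem _ ?_ _)
      (Subalgebra.smul_mem _ (Subalgebra.one_mem _) _)
    refine Algebra.subset_adjoin ⟨_, fun t ht => ?_, rfl⟩
    exact indicator_eq_zero _ _ t fun h => ht (hsub i h)
  have hsum : ∀ t, (B0.indicator Δ hΔ hc).toFun t =
      ∑ i, (B0.indicator (P i) (hPm i) (hPc i)).toFun t := fun t => by
    by_cases ht : t ∈ Δ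
    · obtain ⟨i, hi⟩ := Set.mem_iUnion.1 (hPU ▸ ht)
      rw [indicator_eq_one _ _ t ht, Finset.sum_eq_single i]
      · exact (indicator_eq_one _ _ t hi).symm
      · exact fun j _ hj => indicator_eq_zero _ _ t (Set.disjoint_right.1 (hPd hj) hi)
      · exact fun h => (h (Finset.mem_univ i)).elim
    · rw [indicator_eq_zero _ _ t ht]
      exact (Finset.sum_eq_zero fun i _ => indicator_eq_zero _ _ t fun h => ht (hsub i h)).symm
  refine ⟨_, ⟨A, hAm, rfl⟩, ?_⟩
  have e : A E - aPlus σ ν K (B0.indicator Δ hΔ hc) (Polynomial.X ^ k) E =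
      ∑ i, xiRem k (hPm i) (hPc i) E := by
    rw [aPlus_sum Finset.univ hsum, hA, LinearMap.sum_apply, ← Finset.sum_sub_distrib]
    rfl
  rw [dist_comm, dist_eq_norm, ← map_sub, e]
  exact lt_of_pow_lt_pow_left₀ 2 hε.le (hb.trans_lt hMδ)

end Limits

/-! ### Multiplication by products of polynomials in the jump variables -/

section PolyMul

variable {T : Type u} [MeasurableSpace T] {σ : Measure T} [SigmaFinite σ]
  (ν : Measure ℝ) [IsProbabilityMeasure ν] [HasExpMoment ν] {n : ℕ}

theorem memLp_prod_eval (p : Fin n → ℝ[X]) :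
    MemLp (fun x : Fin n → ℝ => ∏ j, (((p j).eval (x j) : ℝ) : ℂ)) 2 (Measure.pi fun _ => ν) := by
  have hm : Continuous fun x : Fin n → ℝ => ∏ j, (((p j).eval (x j) : ℝ) : ℂ) := by
    refine continuous_finsetProd _ fun j _ => ?_
    exact Complex.continuous_ofReal.comp ((p j).continuous.comp (continuous_apply j))
  rw [memLp_two_iff_integrable_sq_norm hm.aestronglyMeasurable]
  refine (Integrable.fintype_prod (𝕜 := ℝ) (f := fun (j : Fin n) (x : ℝ) => (p j ^ 2).eval x)
    fun j => integrable_eval ν _).congr (Filter.Eventually.of_forall fun x => ?_)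
  simp only [norm_prod, Complex.norm_real, Real.norm_eq_abs, ← Finset.prod_pow, sq_abs, eval_pow]

theorem memLp_mul_prod_eval (p : Fin n → ℝ[X]) (f : L2 σ n) :
    MemLp (fun z : Fin n → T × ℝ => f (fun j => (z j).1) * ∏ j, (((p j).eval (z j).2 : ℝ) : ℂ)) 2
      (Measure.pi fun _ : Fin n => σ.prod ν) :=
  (memLp_mul_prod (Lp.memLp f) (memLp_prod_eval ν p)).comp_measurePreserving
    (measurePreserving_arrowProdEquivProdArrow T ℝ (Fin n) (fun _ => σ) (fun _ => ν))

/-- Multiplication by `p₁(x₁) ⋯ pₙ(xₙ)`, as a linear map. -/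
def polyMulLin (p : Fin n → ℝ[X]) : L2 σ n →ₗ[ℂ] L2 (σ.prod ν) n where
  toFun f := (memLp_mul_prod_eval ν p f).toLp
  map_add' F G := by
    rw [← MemLp.toLp_add, MemLp.toLp_eq_toLp_iff]
    filter_upwards [(quasiMeasurePreserving_fst_pi σ ν n).ae (Lp.coeFn_add F G)] with z hz
    rw [Pi.add_apply, hz, Pi.add_apply, add_mul]
  map_smul' c F := by
    rw [RingHom.id_apply, ← MemLp.toLp_const_smul, MemLp.toLp_eq_toLp_iff]
    filter_upwards [(quasiMeasurePreserving_fst_pi σ ν n).ae (Lp.coeFn_smul c F)] with z hz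
    rw [Pi.smul_apply, hz, Pi.smul_apply, smul_eq_mul, smul_eq_mul, mul_assoc]

theorem polyMulLin_ae (p : Fin n → ℝ[X]) (f : L2 σ n) :
    polyMulLin ν p f =ᵐ[Measure.pi fun _ : Fin n => σ.prod ν]
      fun z => f (fun j => (z j).1) * ∏ j, (((p j).eval (z j).2 : ℝ) : ℂ) :=
  (memLp_mul_prod_eval ν p f).coeFn_toLp

theorem inner_polyMulLin (p q : Fin n → ℝ[X]) (f g : L2 σ n) :
    (inner ℂ (polyMulLin ν p f) (polyMulLin ν q g) : ℂ) =
      inner ℂ f g * ∏ j, ((∫ x, (p j).eval x * (q j).eval x ∂ν : ℝ) : ℂ) := by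
  have h1 : ∀ j, ((∫ x, (p j).eval x * (q j).eval x ∂ν : ℝ) : ℂ) =
      ∫ x, (((p j).eval x * (q j).eval x : ℝ) : ℂ) ∂ν := fun j => integral_complex_ofReal.symm
  simp_rw [h1]
  rw [L2.inner_def, L2.inner_def, ← integral_fintype_prod_eq_prod (𝕜 := ℂ)
      (f := fun (j : Fin n) x => (((p j).eval x * (q j).eval x : ℝ) : ℂ)) (μ := fun _ => ν),
    ← integral_prod_mul]
  refine Eq.trans (integral_congr_ae ?_)
    ((measurePreserving_arrowProdEquivProdArrow T ℝ (Fin n) (fun _ => σ)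
      (fun _ => ν)).integral_comp' (fun y : (Fin n → T) × (Fin n → ℝ) =>
        inner ℂ (f y.1) (g y.1) * ∏ j, (((p j).eval (y.2 j) * (q j).eval (y.2 j) : ℝ) : ℂ)))
  filter_upwards [polyMulLin_ae ν p f, polyMulLin_ae ν q g] with z h1 h2
  rw [h1, h2]
  simp only [RCLike.inner_apply, map_mul, map_prod, Complex.conj_ofReal]
  have : ∏ j, (((p j).eval (z j).2 * (q j).eval (z j).2 : ℝ) : ℂ) =
      (∏ j, (((p j).eval (z j).2 : ℝ) : ℂ)) * ∏ j, (((q j).eval (z j).2 : ℝ) : ℂ) := by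
    rw [← Finset.prod_mul_distrib]
    exact Finset.prod_congr rfl fun j _ => by push_cast; rfl
  change _ = g (fun j => (z j).1) * conj (f fun j => (z j).1) *
    ∏ j, (((p j).eval (z j).2 * (q j).eval (z j).2 : ℝ) : ℂ)
  rw [this]
  ring

theorem norm_polyMulLin (p : Fin n → ℝ[X]) (f : L2 σ n) :
    ‖polyMulLin ν p f‖ = √(∏ j, ∫ x, (p j).eval x * (p j).eval x ∂ν) * ‖f‖ := by
  have h : 0 ≤ ∏ j, ∫ x, (p j).eval x * (p j).eval x ∂ν :=
    Finset.prod_nonneg fun j _ => integral_nonneg fun x => mul_self_nonneg _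
  rw [← sq_eq_sq₀ (norm_nonneg _) (by positivity), mul_pow, Real.sq_sqrt h]
  have := inner_polyMulLin ν p p f f
  rw [inner_self_eq_norm_sq_to_K, inner_self_eq_norm_sq_to_K] at this
  refine Complex.ofReal_injective ?_
  push_cast
  rw [mul_comm]
  exact this

/-- The operator `f ↦ f(t₁, …, tₙ) p₁(x₁) ⋯ pₙ(xₙ)`. -/
def polyMul (p : Fin n → ℝ[X]) : L2 σ n →L[ℂ] L2 (σ.prod ν) n :=
  (polyMulLin ν p).mkContinuous _ fun f => (norm_polyMulLin ν p f).le

theorem polyMul_ae (p : Fin n → ℝ[X]) (f : L2 σ n) :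
    polyMul ν p f =ᵐ[Measure.pi fun _ : Fin n => σ.prod ν]
      fun z => f (fun j => (z j).1) * ∏ j, (((p j).eval (z j).2 : ℝ) : ℂ) :=
  polyMulLin_ae ν p f

theorem inner_polyMul (p q : Fin n → ℝ[X]) (f g : L2 σ n) :
    (inner ℂ (polyMul ν p f) (polyMul ν q g) : ℂ) =
      inner ℂ f g * ∏ j, ((∫ x, (p j).eval x * (q j).eval x ∂ν : ℝ) : ℂ) :=
  inner_polyMulLin ν p q f g

theorem polyElt_eq_polyMul (i : Fin n → ℕ) (f : L2 σ n) :
    polyElt ν i f = polyMul ν (fun j => Polynomial.X ^ i j) f := by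
  refine Lp.ext ?_
  filter_upwards [polyElt_ae σ ν i f, polyMul_ae ν (fun j => Polynomial.X ^ i j) f] with z h1 h2
  rw [h1, h2]
  simp

end PolyMul

/-! ### Surjectivity of the isometry I -/

section Surjectivity

variable {T : Type u} [TopologicalSpace T] [MeasurableSpace T]
  {σ : Measure T} [SigmaFinite σ] [IsFiniteMeasureOnCompacts σ]
  {ν : Measure ℝ} [IsProbabilityMeasure ν] [HasExpMoment ν] {K : HermKernel T} {n : ℕ}

/-- The projection `Pₙ` followed by the inclusion of the `n`-particle space in the Fock space. -/
def fockMap {X : Type u} [MeasurableSpace X] (K : HermKernel X) (μ : Measure X) [SigmaFinite μ]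
    (n : ℕ) : L2 μ n →ₗ[ℂ] QFock K μ :=
  lp.lsingle (𝕜 := ℂ) (E := fun n => FockLevel K μ n) 2 n ∘ₗ
    (FockLevel.of K μ n).toLinearMap ∘ₗ (symP K μ n).toLinearMap.rangeRestrict

theorem fockMap_apply {X : Type u} [MeasurableSpace X] (K : HermKernel X) (μ : Measure X)
    [SigmaFinite μ] (n : ℕ) (F : L2 μ n) : fockMap K μ n F =
      lp.single (E := fun n => FockLevel K μ n) 2 n (FockLevel.of K μ n ⟨symP K μ n F, symP_mem K μ F⟩) :=
  rfl

theorem inner_fockMap {X : Type u} [MeasurableSpace X] (K : HermKernel X) (μ : Measure X)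
    [SigmaFinite μ] (n : ℕ) (F G : L2 μ n) :
    (inner ℂ (fockMap K μ n F) (fockMap K μ n G) : ℂ) =
      (n.factorial : ℂ) * inner ℂ F (symP K μ n G) := by
  rw [fockMap_apply, fockMap_apply, lp.inner_single_left, lp.single_apply_self]
  refine (Scaled.inner_of ⟨(n.factorial : ℝ), Set.mem_Ioi.2 (by exact_mod_cast n.factorial_pos)⟩
    (qSym K μ n) _ _).trans ?_
  rw [Submodule.coe_inner]
  change ((n.factorial : ℝ) : ℂ) * inner ℂ (symP K μ n F) (symP K μ n G) = _
  rw [inner_symP_left, symP_of_mem K μ (symP_mem K μ G)]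
  simp

theorem inner_fockMap_of_ne {X : Type u} [MeasurableSpace X] (K : HermKernel X) (μ : Measure X)
    [SigmaFinite μ] {n m : ℕ} (h : n ≠ m) (F : L2 μ n) (G : L2 μ m) :
    (inner ℂ (fockMap K μ n F) (fockMap K μ m G) : ℂ) = 0 := by
  rw [fockMap_apply, fockMap_apply, lp.inner_single_left, lp.single_apply_ne _ _ _ h,
    inner_zero_right]

theorem norm_fockMap_le {X : Type u} [MeasurableSpace X] (K : HermKernel X) (μ : Measure X)
    [SigmaFinite μ] (n : ℕ) (F : L2 μ n) :
    ‖fockMap K μ n F‖ ≤ √(n.factorial : ℝ) * ‖symP K μ n‖ * ‖F‖ := by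
  rw [fockMap_apply, lp.norm_single (by norm_num)]
  refine (Scaled.norm_of ⟨(n.factorial : ℝ), Set.mem_Ioi.2 (by exact_mod_cast n.factorial_pos)⟩
    (qSym K μ n) _).trans_le ?_
  rw [mul_assoc]
  gcongr
  exact (symP K μ n).le_opNorm F

/-- The bounded operator `f ↦ Pₙ f` into the Fock space. -/
def fockMapL {X : Type u} [MeasurableSpace X] (K : HermKernel X) (μ : Measure X) [SigmaFinite μ]
    (n : ℕ) : L2 μ n →L[ℂ] QFock K μ :=
  (fockMap K μ n).mkContinuous _ (norm_fockMap_le K μ n)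

theorem fockMapL_apply {X : Type u} [MeasurableSpace X] (K : HermKernel X) (μ : Measure X)
    [SigmaFinite μ] (n : ℕ) (F : L2 μ n) : fockMapL K μ n F = fockMap K μ n F := rfl

theorem toFock_single_eq (F : dom σ ν K n) : toFock σ ν K (Dom.single σ ν K n F) =
    fockMapL K.lift (σ.prod ν) n F := by
  rw [toFock_single, fockMapL_apply, fockMap_apply]
  exact congrArg (fun G => lp.single (E := fun n => FockLevel K.lift (σ.prod ν) n) 2 n
    (FockLevel.of K.lift (σ.prod ν) n G)) (Subtype.ext (symP_of_mem _ _ (dom_le σ ν K n F.2)).symm)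

variable [PolishSpace T] [LocallyCompactSpace T] [BorelSpace T]

/-- The product of creation operators applied to the vacuum. -/
theorem prod_aPlus_vac (D : DisjointSets T n) (p : Fin n → ℝ[X]) :
    ∃ F : dom σ ν K n, (List.ofFn fun j =>
      aPlus σ ν K (B0.indicator (D.set j) (D.meas j) (D.compact j)) (p j)).prod (vac σ ν K) =
        Dom.single σ ν K n F ∧ (F : L2 (σ.prod ν) n) =
          symP K.lift (σ.prod ν) n (polyMul ν p (D.elt σ)) := by
  induction n with
  | zero =>
    refine ⟨_, rfl, ?_⟩
    rw [symP_of_psi _ _ fun π => by rw [Subsingleton.elim π 1, psi_one]]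
    refine Lp.ext ?_
    filter_upwards [one0_ae (σ.prod ν), polyMul_ae ν p (D.elt σ),
      (quasiMeasurePreserving_fst_pi σ ν 0).ae (D.elt_ae σ)] with z h1 h2 h3
    rw [h2, h3]
    refine h1.trans ?_
    simp [DisjointSets.fn]
  | succ n ih =>
    set D' : DisjointSets T n := ⟨fun j => D.set j.succ, fun j => D.meas _, fun j => D.compact _,
      fun i j hij => D.disj fun h => hij (Fin.succ_injective n h)⟩
    obtain ⟨F, hF, hF'⟩ := ih D' fun j => p j.succ
    refine ⟨creaDom σ ν K (B0.indicator (D.set 0) (D.meas 0) (D.compact 0)) (p 0) n F, ?_, ?_⟩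
    · rw [List.ofFn_succ, List.prod_cons, Module.End.mul_apply, ← aPlus_single, ← hF]
    · rw [coe_creaDom, hF', symP_tens_symP]
      congr 1
      refine Lp.ext ?_
      filter_upwards [tens_ae (tensorPoly σ ν (B0.indicator (D.set 0) (D.meas 0) (D.compact 0)) (p 0))
          (polyMul ν (fun j => p j.succ) (D'.elt σ)), polyMul_ae ν p (D.elt σ),
        (quasiMeasurePreserving_head (σ.prod ν) n).ae (tensorPoly_ae σ ν
          (B0.indicator (D.set 0) (D.meas 0) (D.compact 0)) (p 0)),
        (quasiMeasurePreserving_tail (σ.prod ν) n).ae (polyMul_ae ν (fun j => p j.succ) (D'.elt σ)),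
        (quasiMeasurePreserving_tail (σ.prod ν) n).ae
          ((quasiMeasurePreserving_fst_pi σ ν n).ae (D'.elt_ae σ)),
        (quasiMeasurePreserving_fst_pi σ ν (n + 1)).ae (D.elt_ae σ)] with z h1 h2 h3 h4 h5 h6
      rw [h1, h2, h3, h4, h5, h6, DisjointSets.fn, DisjointSets.fn, Fin.prod_univ_succ,
        Fin.prod_univ_succ]
      have : (((B0.indicator (D.set 0) (D.meas 0) (D.compact 0)).toFun (z 0).1 : ℝ) : ℂ) =
          (D.set 0).indicator (fun _ => 1) (z 0).1 := by
        by_cases h : (z 0).1 ∈ D.set 0 <;> simp [B0.indicator, h]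
      rw [this]
      ring

theorem vac_mem_domOcc (B : Set T) : vac σ ν K ∈ domOcc σ ν K B 0 := by
  refine single_mem_domOcc (mem_occ.2 (Filter.Eventually.of_forall fun z _ => ?_))
  exact count_eq_zero_iff.2 fun j => j.elim0

theorem prod_mem_domOcc {B : Set T} {m : ℕ} (l : List (Module.End ℂ (Dom σ ν K)))
    (h : ∀ A ∈ l, ∀ E ∈ domOcc σ ν K B m, A E ∈ domOcc σ ν K B m) {E : Dom σ ν K}
    (hE : E ∈ domOcc σ ν K B m) : l.prod E ∈ domOcc σ ν K B m := by
  induction l with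
  | nil => simpa using hE
  | cons A l ih =>
    rw [List.prod_cons, Module.End.mul_apply]
    exact h A (by simp) _ (ih fun A hA => h A (by simp [hA]))

theorem prod_aPlus_mem_domOcc {B : Set T} (D : DisjointSets T n) (p : Fin n → ℝ[X])
    (hB : ∀ j, Disjoint B (D.set j)) : (List.ofFn fun j =>
      aPlus σ ν K (B0.indicator (D.set j) (D.meas j) (D.compact j)) (p j)).prod (vac σ ν K) ∈
        domOcc σ ν K B 0 := by
  refine prod_mem_domOcc _ (fun A hA E hE => ?_) (vac_mem_domOcc B)
  obtain ⟨j, rfl⟩ := List.mem_ofFn.1 hA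
  exact aPlus_mem_domOcc _ (fun t ht => indicator_eq_zero _ _ t (Set.disjoint_left.1 (hB j) ht)) hE

variable [NullSingletonClass σ]

/-- Induction on the number of factors. Operators local to the other sets create nothing over the
first one, so `aPlus_mem_closure` applies to each approximant of the remaining product. -/
theorem prod_aPlus_mem_closure (D : DisjointSets T n) (i : Fin n → ℕ) :
    toFock σ ν K ((List.ofFn fun j => aPlus σ ν K (B0.indicator (D.set j) (D.meas j) (D.compact j))
      (Polynomial.X ^ i j)).prod (vac σ ν K)) ∈
        closure ((fun A : Module.End ℂ (Dom σ ν K) => toFock σ ν K (A (vac σ ν K))) ''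
          localAlg σ ν K (⋃ j, D.set j)) := by
  induction n with
  | zero => exact subset_closure ⟨1, Subalgebra.one_mem _, rfl⟩
  | succ n ih =>
    set D' : DisjointSets T n := ⟨fun j => D.set j.succ, fun j => D.meas _, fun j => D.compact _,
      fun i j hij => D.disj fun h => hij (Fin.succ_injective n h)⟩
    have h1 := ih D' fun j => i j.succ
    have hd : ∀ j, Disjoint (D.set 0) (D'.set j) := fun j => D.disj (Fin.succ_ne_zero j).symm
    have hW := prod_aPlus_mem_domOcc (σ := σ) (ν := ν) (K := K) D'
      (fun j => Polynomial.X ^ i j.succ) hd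
    rw [List.ofFn_succ, List.prod_cons, Module.End.mul_apply]
    set W := (List.ofFn fun j => aPlus σ ν K (B0.indicator (D'.set j) (D'.meas j) (D'.compact j))
      (Polynomial.X ^ i j.succ)).prod (vac σ ν K)
    set a := aPlus σ ν K (B0.indicator (D.set 0) (D.meas 0) (D.compact 0)) (Polynomial.X ^ i 0)
    change toFock σ ν K (a W) ∈ _
    -- There are two nested limits: a(AΩ) is a limit of vectors A'AΩ, and a W is a limit of vectors
    -- a(AΩ), where W is the remaining product and a the first factor. The second limit is
    -- legitimate because a is a multiple of an isometry on vectors without particles over the first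
    -- set.
    refine (closure_minimal (t := closure _) (s := (fun A : Module.End ℂ (Dom σ ν K) =>
      toFock σ ν K (a (A (vac σ ν K)))) '' localAlg σ ν K (⋃ j, D'.set j)) ?_ isClosed_closure) ?_
    · rintro _ ⟨A, hA, rfl⟩
      have hE : A (vac σ ν K) ∈ domOcc σ ν K (D.set 0) 0 :=
        localAlg_mem_domOcc (Set.disjoint_iUnion_right.2 hd) hA (vac_mem_domOcc _)
      refine closure_mono ?_ (aPlus_mem_closure (D.meas 0) (D.compact 0) (i 0) hE)
      rintro _ ⟨A', hA', rfl⟩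
      have hs : ⋃ j, D'.set j ⊆ ⋃ j, D.set j :=
        Set.iUnion_subset fun j => Set.subset_iUnion D.set j.succ
      have m1 := localAlg_mono hs hA
      have m2 := localAlg_mono (Set.subset_iUnion D.set 0) hA'
      exact ⟨A' * A, Subalgebra.mul_mem _ m2 m1, rfl⟩
    · rw [Metric.mem_closure_iff] at h1 ⊢
      intro ε hε
      set c := ‖tensorPoly σ ν (B0.indicator (D.set 0) (D.meas 0) (D.compact 0))
        (Polynomial.X ^ i 0)‖
      obtain ⟨_, ⟨A, hA, rfl⟩, hd'⟩ := h1 (ε / (c + 1)) (by positivity)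
      refine ⟨_, ⟨A, hA, rfl⟩, ?_⟩
      have hE : A (vac σ ν K) ∈ domOcc σ ν K (D.set 0) 0 :=
        localAlg_mem_domOcc (Set.disjoint_iUnion_right.2 hd) hA (vac_mem_domOcc _)
      rw [dist_eq_norm, ← map_sub] at hd' ⊢
      rw [← map_sub, norm_toFock_aPlus _ (indicator_eq_zero _ _) (Submodule.sub_mem _ hW hE)]
      calc c * _ ≤ c * (ε / (c + 1)) := by gcongr
        _ < (c + 1) * (ε / (c + 1)) := by gcongr; linarith
        _ = ε := mul_div_cancel₀ _ (by positivity)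

theorem toFock_mem_range_gns {A : Module.End ℂ (Dom σ ν K)} {S : Set T}
    (hA : A ∈ localAlg σ ν K S) :
    toFock σ ν K (A (vac σ ν K)) ∈ LinearMap.range (gns σ ν K).toLinearMap := by
  have : A ∈ Algebra.adjoin ℂ (Set.range (xi σ ν K)) :=
    Algebra.adjoin_mono (Set.image_subset_range _ _) hA
  let a : PAlg σ ν K := ⟨A, this⟩
  exact ⟨(a : L2Tau σ ν K), gns_coe σ ν K a⟩

theorem isClosed_range_gns : IsClosed (LinearMap.range (gns σ ν K).toLinearMap : Set (QFock K.lift (σ.prod ν))) := by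
  have := (gns σ ν K).isometry.isClosedEmbedding.isClosed_range
  exact this

theorem mem_of_dense {E F : Type*} [NormedAddCommGroup E] [NormedSpace ℂ E] [NormedAddCommGroup F]
    [NormedSpace ℂ F] (S : E →L[ℂ] F) {s : Set E} (hs : (Submodule.span ℂ s).topologicalClosure = ⊤)
    {R : Submodule ℂ F} (hR : IsClosed (R : Set F)) (h : ∀ v ∈ s, S v ∈ R) (v : E) : S v ∈ R := by
  have : (Submodule.span ℂ s).topologicalClosure ≤ R.comap S.toLinearMap :=
    (Submodule.span ℂ s).topologicalClosure_minimal (Submodule.span_le.2 h)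
      (hR.preimage S.continuous)
  exact this (hs ▸ Submodule.mem_top)

/-- The polynomial functions are dense at each level, the n-particle space is the range of Pₙ, and
finite sequences are dense in the Hilbert sum. -/
theorem eq_top_of_polyElt_mem {R : Submodule ℂ (QFock K.lift (σ.prod ν))}
    (hR : IsClosed (R : Set (QFock K.lift (σ.prod ν))))
    (h : ∀ (n : ℕ) (i : Fin n → ℕ) (f : L2 σ n),
      fockMapL K.lift (σ.prod ν) n (polyElt ν i f) ∈ R) : R = ⊤ := by
  have h1 : ∀ (n : ℕ) (F : L2 (σ.prod ν) n), fockMapL K.lift (σ.prod ν) n F ∈ R := fun n =>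
    mem_of_dense _ (dense_polyPart ν σ n) hR (by rintro _ ⟨i, f, rfl⟩; exact h n i f)
  refine eq_top_iff.2 fun F _ => hR.mem_of_tendsto (lp.hasSum_single (p := 2) (by norm_num) F)
    (Filter.Eventually.of_forall fun s => Submodule.sum_mem _ fun l _ => ?_)
  obtain ⟨⟨G, hG⟩, hG'⟩ := (FockLevel.of K.lift (σ.prod ν) l).surjective (F l)
  have h2 := h1 l G
  rw [fockMapL_apply, fockMap_apply] at h2
  rw [← hG']
  simpa only [symP_of_mem _ _ hG] using h2

/-- The range of an isometry from a complete space is closed, so only disjoint boxes times monomials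
have to be reached. -/
theorem surjective_gns : Function.Surjective (gns σ ν K) := by
  refine LinearMap.range_eq_top.1 (eq_top_of_polyElt_mem isClosed_range_gns fun n i f => ?_)
  rw [polyElt_eq_polyMul]
  refine mem_of_dense ((fockMapL K.lift (σ.prod ν) n).comp
    (polyMul ν fun j => Polynomial.X ^ i j)) (dense_disjointSets σ n) isClosed_range_gns ?_ f
  rintro _ ⟨D, rfl⟩
  obtain ⟨F, hF, hF'⟩ := prod_aPlus_vac (σ := σ) (ν := ν) (K := K) D fun j => Polynomial.X ^ i j
  have h1 := prod_aPlus_mem_closure (σ := σ) (ν := ν) (K := K) D i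
  rw [hF, toFock_single_eq, hF', fockMapL_apply, fockMap_apply] at h1
  change fockMap K.lift (σ.prod ν) n _ ∈ _
  rw [fockMap_apply]
  simp only [symP_of_mem _ _ (symP_mem K.lift (σ.prod ν) _)] at h1
  refine isClosed_range_gns.closure_subset_iff.2 ?_ h1
  rintro _ ⟨A, hA, rfl⟩
  exact toFock_mem_range_gns hA

end Surjectivity

/-! ### Multiple stochastic integrals -/

section MultipleIntegrals

variable {T : Type u} [TopologicalSpace T] [MeasurableSpace T] [PolishSpace T]
  [LocallyCompactSpace T] [BorelSpace T]
  {σ : Measure T} [SigmaFinite σ] [IsFiniteMeasureOnCompacts σ]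
  {ν : Measure ℝ} [IsProbabilityMeasure ν] [HasExpMoment ν] {K : HermKernel T} {n : ℕ}

/-- When a factor acts, no particle is yet present over its set, so its neutral and annihilation
parts vanish. -/
theorem prod_jumpOp_vac (D : DisjointSets T n) (p : Fin n → ℝ[X]) :
    (List.ofFn fun j => jumpOp σ ν K (p j)
      (B0.indicator (D.set j) (D.meas j) (D.compact j))).prod (vac σ ν K) =
    (List.ofFn fun j =>
      aPlus σ ν K (B0.indicator (D.set j) (D.meas j) (D.compact j)) (p j)).prod (vac σ ν K) := by
  induction n with
  | zero => rfl
  | succ n ih =>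
    set D' : DisjointSets T n := ⟨fun j => D.set j.succ, fun j => D.meas _, fun j => D.compact _,
      fun i j hij => D.disj fun h => hij (Fin.succ_injective n h)⟩
    have h1 := ih D' fun j => p j.succ
    have hW := prod_aPlus_mem_domOcc (σ := σ) (ν := ν) (K := K) D' (fun j => p j.succ)
      fun j => D.disj (Fin.succ_ne_zero j).symm
    rw [List.ofFn_succ, List.prod_cons, Module.End.mul_apply, List.ofFn_succ, List.prod_cons,
      Module.End.mul_apply]
    refine (congrArg _ h1).trans ?_
    rw [jumpOp, LinearMap.add_apply, LinearMap.add_apply,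
      aMinus_eq_zero _ (indicator_eq_zero _ _) hW, aZero_eq_zero _ (indicator_eq_zero _ _) hW,
      add_zero, add_zero]

variable [NullSingletonClass σ]

variable (σ ν K) in
/-- The isometry `p ↦ p Ω` as a unitary operator of `L²(τ)` onto the Fock space. -/
def gnsEquiv : L2Tau σ ν K ≃ₗᵢ[ℂ] QFock K.lift (σ.prod ν) :=
  LinearIsometryEquiv.ofSurjective (gns σ ν K) surjective_gns

variable (σ ν K) in
/-- The multiple stochastic integral with respect to `Y_{k₁}, …, Y_{kₙ}`. -/
def multInt (k : Fin n → ℕ) : L2 σ n →L[ℂ] L2Tau σ ν K :=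
  (gnsEquiv σ ν K).symm.toContinuousLinearEquiv.toContinuousLinearMap.comp
    ((fockMapL K.lift (σ.prod ν) n).comp (polyMul ν fun j => orthPoly ν (k j)))

theorem gns_multInt (k : Fin n → ℕ) (f : L2 σ n) : gns σ ν K (multInt σ ν K k f) =
    fockMap K.lift (σ.prod ν) n (polyMul ν (fun j => orthPoly ν (k j)) f) :=
  (gnsEquiv σ ν K).apply_symm_apply _

theorem isMultipleIntegral_multInt (k : Fin n → ℕ) :
    IsMultipleIntegral σ ν K k (multInt σ ν K k) := by
  intro Δ hΔ hc hd g hg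
  let D : DisjointSets T n := ⟨Δ, hΔ, hc, hd⟩
  obtain rfl : g = D.elt σ := Lp.ext (hg.trans (D.elt_ae σ).symm)
  obtain ⟨F, hF, hF'⟩ := prod_aPlus_vac (σ := σ) (ν := ν) (K := K) D fun j => orthPoly ν (k j)
  have h1 := prod_jumpOp_vac (σ := σ) (ν := ν) (K := K) D fun j => orthPoly ν (k j)
  rw [gns_multInt]
  refine Eq.trans ?_ (congrArg (toFock σ ν K) (h1.trans hF)).symm
  rw [toFock_single_eq, hF', fockMapL_apply, fockMap_apply, fockMap_apply]
  simp only [symP_of_mem _ _ (symP_mem K.lift (σ.prod ν) _)]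

/-- The defining property fixes the operator on disjoint boxes, whose span is dense, and I is
injective. -/
theorem IsMultipleIntegral.eq_multInt {k : Fin n → ℕ} {S : L2 σ n →L[ℂ] L2Tau σ ν K}
    (hS : IsMultipleIntegral σ ν K k S) : S = multInt σ ν K k := by
  refine ContinuousLinearMap.ext_on (Submodule.dense_iff_topologicalClosure_eq_top.2
    (dense_disjointSets σ n)) ?_
  rintro _ ⟨D, rfl⟩
  refine (gns σ ν K).injective ?_
  rw [hS D.set D.meas D.compact D.disj _ (D.elt_ae σ),
    isMultipleIntegral_multInt k D.set D.meas D.compact D.disj _ (D.elt_ae σ)]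

end MultipleIntegrals

/-! ### Orthogonal polynomials of ν -/

section OrthPoly

variable {ν : Measure ℝ}

theorem orthPoly_eq (k : ℕ) :
    (orthPoly ν k = 0 ∧ ∫ x, (Polynomial.X ^ k - ∑ j : Fin k,
      C ((∫ x, x ^ k * (orthPoly ν j).eval x ∂ν) / normC ν j) * orthPoly ν j).eval x ^ 2 ∂ν = 0) ∨
    orthPoly ν k = Polynomial.X ^ k - ∑ j : Fin k,
      C ((∫ x, x ^ k * (orthPoly ν j).eval x ∂ν) / normC ν j) * orthPoly ν j := by
  rw [orthPoly]
  split_ifs with h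
  · exact Or.inl ⟨rfl, h⟩
  · exact Or.inr rfl

theorem orthPoly_eq_zero {k : ℕ} (h : normC ν k = 0) : orthPoly ν k = 0 := by
  rw [normC, orthPoly] at h
  rw [orthPoly]
  split_ifs at h ⊢ with h1
  · rfl
  · exact (h1 h).elim

variable [HasExpMoment ν]

theorem integrable_eval_mul_eval (p q : ℝ[X]) : Integrable (fun x => p.eval x * q.eval x) ν := by
  simpa using integrable_eval ν (p * q)

theorem integral_orthPoly_of_lt {j k : ℕ} (h : j < k) :
    ∫ x, (orthPoly ν j).eval x * (orthPoly ν k).eval x ∂ν = 0 := by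
  induction k using Nat.strong_induction_on generalizing j with
  | _ k ih =>
    rcases orthPoly_eq (ν := ν) k with h1 | h1
    · simp [h1.1]
    rw [h1]
    have e : ∀ x, (orthPoly ν j).eval x * (Polynomial.X ^ k - ∑ i : Fin k,
        C ((∫ x, x ^ k * (orthPoly ν i).eval x ∂ν) / normC ν i) * orthPoly ν i).eval x =
        x ^ k * (orthPoly ν j).eval x - ∑ i : Fin k,
          ((∫ x, x ^ k * (orthPoly ν i).eval x ∂ν) / normC ν i) *
            ((orthPoly ν j).eval x * (orthPoly ν i).eval x) := fun x => by
      simp only [eval_sub, eval_pow, eval_X, eval_finsetSum, eval_mul, eval_C, mul_sub,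
        Finset.mul_sum]
      congr 1
      · ring
      · exact Finset.sum_congr rfl fun i _ => by ring
    simp_rw [e]
    have hi : Integrable (fun x => x ^ k * (orthPoly ν j).eval x) ν := by
      simpa using integrable_eval_mul_eval (ν := ν) (Polynomial.X ^ k) (orthPoly ν j)
    rw [integral_sub hi (integrable_finsetSum _ fun i _ =>
        (integrable_eval_mul_eval _ _).const_mul _), integral_finsetSum _ fun i _ =>
        (integrable_eval_mul_eval _ _).const_mul _]
    simp_rw [integral_const_mul]
    rw [Finset.sum_eq_single (⟨j, h⟩ : Fin k)]
    -- If C_j = 0, the Gram–Schmidt coefficient is a division by zero, but then p⁽ʲ⁾ = 0 and both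
    -- terms vanish.
    · by_cases h0 : normC ν j = 0
      · simp [orthPoly_eq_zero h0]
      · have : ∫ x, (orthPoly ν j).eval x * (orthPoly ν j).eval x ∂ν = normC ν j := by
          simp_rw [normC, sq]
        rw [this, div_mul_cancel₀ _ h0, sub_self]
    · intro i _ hi
      rcases lt_or_gt_of_ne (fun h => hi (Fin.ext h) : (i : ℕ) ≠ j) with h2 | h2
      · simp_rw [mul_comm ((orthPoly ν j).eval _)]
        rw [ih j h h2, mul_zero]
      · rw [ih i i.2 h2, mul_zero]
    · exact fun h => (h (Finset.mem_univ _)).elim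

theorem integral_orthPoly (j k : ℕ) :
    ∫ x, (orthPoly ν j).eval x * (orthPoly ν k).eval x ∂ν = if j = k then normC ν j else 0 := by
  rcases lt_trichotomy j k with h | rfl | h
  · rw [if_neg h.ne, integral_orthPoly_of_lt h]
  · rw [if_pos rfl, normC]
    simp_rw [sq]
  · rw [if_neg h.ne']
    simp_rw [mul_comm ((orthPoly ν j).eval _)]
    exact integral_orthPoly_of_lt h

/-- Inversion of Gram–Schmidt. It holds only almost everywhere: when p⁽ᵏ⁾ is set to zero, the monic
candidate vanishes ν-a.e. but not as a polynomial. -/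
theorem exists_pow_eq_sum_orthPoly (k : ℕ) : ∃ c : ℕ → ℝ,
    ∀ᵐ x ∂ν, x ^ k = ∑ i ∈ Finset.range (k + 1), c i * (orthPoly ν i).eval x := by
  set a : ℕ → ℝ := fun j => (∫ x, x ^ k * (orthPoly ν j).eval x ∂ν) / normC ν j
  have e : ∀ x, (Polynomial.X ^ k - ∑ j : Fin k, C (a j) * orthPoly ν j).eval x =
      x ^ k - ∑ i ∈ Finset.range k, a i * (orthPoly ν i).eval x := fun x => by
    rw [Finset.sum_range]
    simp [eval_finsetSum]
  refine ⟨fun i => if i = k then 1 else a i, ?_⟩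
  have hs : ∀ x, ∑ i ∈ Finset.range (k + 1), (if i = k then 1 else a i) * (orthPoly ν i).eval x =
      ∑ i ∈ Finset.range k, a i * (orthPoly ν i).eval x + (orthPoly ν k).eval x := fun x => by
    rw [Finset.sum_range_succ, if_pos rfl, one_mul]
    congr 1
    exact Finset.sum_congr rfl fun i hi => by rw [if_neg (Finset.mem_range.1 hi).ne]
  simp_rw [hs]
  rcases orthPoly_eq (ν := ν) k with ⟨h1, h2⟩ | h1
  · have hi := integrable_eval ν ((Polynomial.X ^ k - ∑ j : Fin k, C (a j) * orthPoly ν j) ^ 2)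
    simp_rw [eval_pow] at hi
    have := (integral_eq_zero_iff_of_nonneg (fun x => sq_nonneg _) hi).1 h2
    filter_upwards [this] with x hx
    have hx' := pow_eq_zero_iff two_ne_zero |>.1 hx
    rw [e] at hx'
    rw [h1, eval_zero]
    linarith
  · refine Filter.Eventually.of_forall fun x => ?_
    rw [h1, e]
    ring

end OrthPoly

/-! ### Inner products of multiple integrals -/

section InnerProducts

variable {T : Type u} [MeasurableSpace T] {σ : Measure T} [SigmaFinite σ]
  {ν : Measure ℝ} [IsProbabilityMeasure ν] [HasExpMoment ν] (K : HermKernel T) {n : ℕ}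

theorem psi_polyMul (π : Equiv.Perm (Fin n)) (p : Fin n → ℝ[X]) (f : L2 σ n) :
    psi K.lift (σ.prod ν) π (polyMul ν p f) = polyMul ν (fun j => p (π⁻¹ j)) (psi K σ π f) := by
  refine Lp.ext ?_
  filter_upwards [psi_ae K.lift (σ.prod ν) π (polyMul ν p f),
    (measurePreserving_comp_perm (σ.prod ν) π).quasiMeasurePreserving.ae (polyMul_ae ν p f),
    polyMul_ae ν (fun j => p (π⁻¹ j)) (psi K σ π f),
    (quasiMeasurePreserving_fst_pi σ ν n).ae (psi_ae K σ π f)] with z h1 h2 h3 h4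
  have hq : qPerm K.lift π⁻¹ z = qPerm K π⁻¹ (fun j => (z j).1) := rfl
  have hp : ∏ j, (((p (π⁻¹ j)).eval (z j).2 : ℝ) : ℂ) = ∏ j, (((p j).eval (z (π j)).2 : ℝ) : ℂ) := by
    rw [← Equiv.prod_comp π (fun j => (((p (π⁻¹ j)).eval (z j).2 : ℝ) : ℂ))]
    simp
  rw [h1, h2, h3, h4, hq, hp, mul_assoc]

/-- The weight n! cancels the 1/n! of the projection. Each permutation contributes an inner product
over Tⁿ times one integral over ν for each particle, and orthogonality makes this zero unless the
permutation matches the two index sequences. -/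
theorem inner_fockMap_polyMul (k l : Fin n → ℕ) (f g : L2 σ n) :
    (inner ℂ (fockMap K.lift (σ.prod ν) n (polyMul ν (fun j => orthPoly ν (k j)) f))
      (fockMap K.lift (σ.prod ν) n (polyMul ν (fun j => orthPoly ν (l j)) g)) : ℂ) =
    (∏ j, (normC ν (k j) : ℂ)) * ∑ π : Equiv.Perm (Fin n) with ∀ j, k (π j) = l j,
      inner ℂ f (psi K σ π g) := by
  rw [inner_fockMap, symP_apply, inner_smul_right, inner_sum, ← mul_assoc,
    mul_inv_cancel₀ (by exact_mod_cast n.factorial_ne_zero), one_mul, Finset.sum_filter,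
    Finset.mul_sum]
  refine Finset.sum_congr rfl fun π _ => ?_
  rw [psi_polyMul, inner_polyMul]
  simp_rw [integral_orthPoly]
  split_ifs with h
  · have : ∀ j, k j = l (π⁻¹ j) := fun j => by rw [← h]; simp
    rw [mul_comm]
    congr 1
    exact Finset.prod_congr rfl fun j _ => by rw [if_pos (this j)]
  · obtain ⟨j, hj⟩ := not_forall.1 h
    rw [Finset.prod_eq_zero (Finset.mem_univ (π j)), mul_zero, mul_zero]
    rw [if_neg (by simpa using hj), Complex.ofReal_zero]

/-- Pₙ absorbs Ψ_π. This permits sorting the polynomials at the price of permuting the integrand. -/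
theorem fockMap_polyMul_psi (π : Equiv.Perm (Fin n)) (p : Fin n → ℝ[X]) (f : L2 σ n) :
    fockMap K.lift (σ.prod ν) n (polyMul ν (fun j => p (π⁻¹ j)) (psi K σ π f)) =
      fockMap K.lift (σ.prod ν) n (polyMul ν p f) := by
  rw [← psi_polyMul, fockMap_apply, fockMap_apply]
  simp only [symP_psi]

theorem polyMul_eq_zero {p : Fin n → ℝ[X]} {j : Fin n} (h : p j = 0) (f : L2 σ n) :
    polyMul ν p f = 0 := by
  refine Lp.ext ?_
  filter_upwards [polyMul_ae ν p f, Lp.coeFn_zero ℂ 2 (Measure.pi fun _ : Fin n => σ.prod ν)]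
    with z h1 h2
  rw [h1, h2, Finset.prod_eq_zero (Finset.mem_univ j) (by simp [h]), mul_zero]
  rfl

theorem quasiMeasurePreserving_snd_pi (j : Fin n) :
    Measure.QuasiMeasurePreserving (fun z : Fin n → T × ℝ => (z j).2)
      (Measure.pi fun _ : Fin n => σ.prod ν) ν :=
  Measure.quasiMeasurePreserving_snd.comp (Measure.quasiMeasurePreserving_eval _ j)

theorem polyElt_mem_span (i : Fin n → ℕ) (f : L2 σ n) : polyElt ν i f ∈
    Submodule.span ℂ (Set.range fun k : Fin n → ℕ => polyMul ν (fun j => orthPoly ν (k j)) f) := by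
  choose c hc using fun m => exists_pow_eq_sum_orthPoly (ν := ν) m
  have : polyElt ν i f = ∑ k ∈ Fintype.piFinset fun j => Finset.range (i j + 1),
      (∏ j, (c (i j) (k j) : ℂ)) • polyMul ν (fun j => orthPoly ν (k j)) f := by
    refine Lp.ext ?_
    filter_upwards [polyElt_ae σ ν i f, Lp.coeFn_fun_finsetSum
        (Fintype.piFinset fun j => Finset.range (i j + 1))
        fun k : Fin n → ℕ => (∏ j, (c (i j) (k j) : ℂ)) • polyMul ν (fun j => orthPoly ν (k j)) f,
      ae_all_iff.2 fun k : Fin n → ℕ => Lp.coeFn_smul (∏ j, (c (i j) (k j) : ℂ))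
        (polyMul ν (fun j => orthPoly ν (k j)) f),
      ae_all_iff.2 fun k : Fin n → ℕ => polyMul_ae ν (fun j => orthPoly ν (k j)) f,
      ae_all_iff.2 fun j : Fin n => (quasiMeasurePreserving_snd_pi (σ := σ) (ν := ν) j).ae
        (hc (i j))] with z h1 h2 h3 h4 h5
    have h6 : ∀ j, ((z j).2 : ℂ) ^ i j = ∑ m ∈ Finset.range (i j + 1),
        (c (i j) m : ℂ) * (((orthPoly ν m).eval (z j).2 : ℝ) : ℂ) := fun j => by
      exact_mod_cast congrArg (fun x : ℝ => (x : ℂ)) (h5 j)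
    rw [h1, h2]
    simp_rw [h6, Finset.prod_univ_sum, h3, Pi.smul_apply, h4, Finset.prod_mul_distrib,
      Finset.mul_sum, smul_eq_mul]
    exact Finset.sum_congr rfl fun k _ => by ring
  rw [this]
  exact Submodule.sum_mem _ fun k _ => Submodule.smul_mem _ _ (Submodule.subset_span ⟨k, rfl⟩)

end InnerProducts

/-! ### Permutations and symmetrization within blocks of variables -/

section Blocks

theorem finSigmaFinEquiv_lt {b : ℕ} {a : Fin b → ℕ} {i i' : Fin b} (h : i < i') (l : Fin (a i))
    (l' : Fin (a i')) : finSigmaFinEquiv (n := a) ⟨i, l⟩ < finSigmaFinEquiv (n := a) ⟨i', l'⟩ := by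
  rw [Fin.lt_def, finSigmaFinEquiv_apply, finSigmaFinEquiv_apply]
  set s : ℕ → ℕ := fun j => if h : j < b then a ⟨j, h⟩ else 0
  have e : ∀ i : Fin b, ∑ j : Fin (i : ℕ), a (Fin.castLE i.2.le j) = ∑ j ∈ Finset.range i, s j :=
    fun i => by
      rw [Finset.sum_range]
      refine Finset.sum_congr rfl fun j _ => ?_
      simp only [s]
      rw [dif_pos (j.2.trans i.2)]
      rfl
  rw [e i, e i']
  calc ∑ j ∈ Finset.range i, s j + (l : ℕ) < ∑ j ∈ Finset.range i, s j + s i := by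
        have : s i = a i := dif_pos i.2
        rw [this]
        exact Nat.add_lt_add_left l.2 _
    _ = ∑ j ∈ Finset.range (i + 1), s j := (Finset.sum_range_succ _ _).symm
    _ ≤ ∑ j ∈ Finset.range i', s j :=
        Finset.sum_le_sum_of_subset (Finset.range_mono h)
    _ ≤ _ := Nat.le_add_right _ _

theorem finSigmaFinEquiv_lt_iff_of_ne {b : ℕ} {a : Fin b → ℕ} {i i' : Fin b} (h : i ≠ i')
    (l : Fin (a i)) (l' : Fin (a i')) :
    finSigmaFinEquiv (n := a) ⟨i, l⟩ < finSigmaFinEquiv (n := a) ⟨i', l'⟩ ↔ i < i' := by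
  refine ⟨fun h1 => ?_, fun h1 => finSigmaFinEquiv_lt h1 l l'⟩
  by_contra h2
  exact lt_asymm h1 (finSigmaFinEquiv_lt (lt_of_le_of_ne (not_lt.1 h2) h.symm) l' l)

theorem finSigmaFinEquiv_lt_iff {b : ℕ} {a : Fin b → ℕ} {i : Fin b} (l l' : Fin (a i)) :
    finSigmaFinEquiv (n := a) ⟨i, l⟩ < finSigmaFinEquiv (n := a) ⟨i, l'⟩ ↔ l < l' := by
  rw [Fin.lt_def, finSigmaFinEquiv_apply, finSigmaFinEquiv_apply]
  simp

variable {b : ℕ} {a : Fin b → ℕ}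

/-- The permutation that permutes the `i`-th block by `ρ i`. -/
def blockPerm (ρ : ∀ i, Equiv.Perm (Fin (a i))) : Equiv.Perm (Fin (∑ i, a i)) :=
  finSigmaFinEquiv.permCongr (Equiv.sigmaCongrRight ρ)

theorem blockPerm_apply (ρ : ∀ i, Equiv.Perm (Fin (a i))) (i : Fin b) (l : Fin (a i)) :
    blockPerm ρ (finSigmaFinEquiv ⟨i, l⟩) = finSigmaFinEquiv ⟨i, ρ i l⟩ := by
  simp [blockPerm, Equiv.permCongr_apply]

theorem blockPerm_inv (ρ : ∀ i, Equiv.Perm (Fin (a i))) :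
    (blockPerm ρ)⁻¹ = blockPerm fun i => (ρ i)⁻¹ := by
  rw [inv_eq_iff_mul_eq_one]
  refine Equiv.ext fun j => ?_
  obtain ⟨⟨i, l⟩, rfl⟩ := finSigmaFinEquiv.surjective j
  rw [Equiv.Perm.mul_apply, blockPerm_apply, blockPerm_apply]
  simp

theorem blockPerm_injective : Function.Injective (blockPerm (a := a)) := by
  intro ρ ρ' h
  funext i
  refine Equiv.ext fun l => ?_
  have := congrArg (fun π : Equiv.Perm _ => π (finSigmaFinEquiv ⟨i, l⟩)) h
  simp only [blockPerm_apply] at this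
  simpa using finSigmaFinEquiv.injective this

theorem exists_eq_blockPerm {π : Equiv.Perm (Fin (∑ i, a i))}
    (h : ∀ j, (finSigmaFinEquiv.symm (π j)).1 = (finSigmaFinEquiv.symm j).1) :
    ∃ ρ, π = blockPerm ρ := by
  have h1 : ∀ i l, ∃ l', π (finSigmaFinEquiv (n := a) ⟨i, l⟩) = finSigmaFinEquiv ⟨i, l'⟩ := by
    intro i l
    have h2 := h (finSigmaFinEquiv ⟨i, l⟩)
    obtain ⟨⟨i', l'⟩, h3⟩ := finSigmaFinEquiv.surjective (π (finSigmaFinEquiv (n := a) ⟨i, l⟩))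
    rw [← h3, Equiv.symm_apply_apply, Equiv.symm_apply_apply] at h2
    obtain rfl : i' = i := h2
    exact ⟨l', h3.symm⟩
  choose r hr using h1
  have hinj : ∀ i, Function.Injective (r i) := fun i l l' hl => by
    have := (hr i l).trans ((congrArg (fun x => finSigmaFinEquiv (n := a) ⟨i, x⟩) hl).trans
      (hr i l').symm)
    simpa using finSigmaFinEquiv.injective (π.injective this)
  refine ⟨fun i => Equiv.ofBijective (r i) (Finite.injective_iff_bijective.1 (hinj i)), ?_⟩
  refine Equiv.ext fun j => ?_
  obtain ⟨⟨i, l⟩, rfl⟩ := finSigmaFinEquiv.surjective j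
  rw [hr, blockPerm_apply]
  rfl

variable {X : Type u} [MeasurableSpace X] (K : HermKernel X)

/-- The order between different blocks is preserved, so all inversions occur inside blocks. -/
theorem qPerm_blockPerm (ρ : ∀ i, Equiv.Perm (Fin (a i))) (t : Fin (∑ i, a i) → X) :
    qPerm K (blockPerm ρ) t = ∏ i, qPerm K (ρ i) fun l => t (finSigmaFinEquiv ⟨i, l⟩) := by
  unfold qPerm
  rw [← ((finSigmaFinEquiv (n := a)).prodCongr (finSigmaFinEquiv (n := a))).prod_comp,
    Fintype.prod_prod_type, Fintype.prod_sigma]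
  refine Finset.prod_congr rfl fun i _ => ?_
  rw [Fintype.prod_prod_type]
  refine Finset.prod_congr rfl fun l _ => ?_
  rw [Fintype.prod_sigma, Finset.prod_eq_single i]
  · refine Finset.prod_congr rfl fun l' _ => ?_
    simp only [Equiv.prodCongr_apply, Prod.map_apply, blockPerm_apply, finSigmaFinEquiv_lt_iff]
  · intro i' _ hi
    refine Finset.prod_eq_one fun l' _ => if_neg ?_
    simp only [Equiv.prodCongr_apply, Prod.map_apply, blockPerm_apply,
      finSigmaFinEquiv_lt_iff_of_ne hi, finSigmaFinEquiv_lt_iff_of_ne hi.symm]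
    exact fun h => lt_asymm h.1 h.2
  · exact fun h => (h (Finset.mem_univ i)).elim

variable (μ : Measure X) [SigmaFinite μ]

/-- The selected coordinates split off as a factor of the product. The projection is only
quasi-measure-preserving since the other factor need not have mass one. -/
theorem quasiMeasurePreserving_comp_injective {ι κ : Type*} [Fintype ι] [Fintype κ] {j : ι → κ}
    (hj : Function.Injective j) :
    Measure.QuasiMeasurePreserving (fun (t : κ → X) i => t (j i)) (Measure.pi fun _ : κ => μ)
      (Measure.pi fun _ : ι => μ) := by
  classical
  have h1 := (measurePreserving_piEquivPiSubtypeProd (fun _ : κ => μ)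
    (fun x => x ∈ Set.range j)).quasiMeasurePreserving
  let : Fintype (Set.range j) := Subtype.fintype fun x => x ∈ Set.range j
  have h2 := (measurePreserving_piCongrLeft (fun _ : ι => μ)
    (Equiv.ofInjective j hj).symm).quasiMeasurePreserving
  have h3 := h2.comp (Measure.quasiMeasurePreserving_fst.comp h1)
  convert h3 using 1
  ext t i
  have := Equiv.piCongrLeft_apply_apply (P := fun _ : ι => X) (Equiv.ofInjective j hj).symm
    (fun x => t x.1) (Equiv.ofInjective j hj i)
  rw [Equiv.symm_apply_apply] at this
  exact this.symm

theorem quasiMeasurePreserving_block (i : Fin b) :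
    Measure.QuasiMeasurePreserving
      (fun (t : Fin (∑ i, a i) → X) (l : Fin (a i)) => t (finSigmaFinEquiv (n := a) ⟨i, l⟩))
      (Measure.pi fun _ : Fin (∑ i, a i) => μ) (Measure.pi fun _ : Fin (a i) => μ) :=
  quasiMeasurePreserving_comp_injective μ fun l l' h => by
    simpa using finSigmaFinEquiv.injective h

variable {μ}

/-- The function `g` is the product of the functions `fᵢ` of the blocks of variables. -/
def IsBlockProd (g : L2 μ (∑ i, a i)) (f : ∀ i, L2 μ (a i)) : Prop :=
  g =ᵐ[Measure.pi fun _ : Fin (∑ i, a i) => μ] fun t =>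
    ∏ i, (f i) fun l => t (finSigmaFinEquiv (n := a) ⟨i, l⟩)

theorem IsBlockProd.psi {g : L2 μ (∑ i, a i)} {f : ∀ i, L2 μ (a i)} (h : IsBlockProd g f)
    (ρ : ∀ i, Equiv.Perm (Fin (a i))) :
    IsBlockProd (psi K μ (blockPerm ρ) g) fun i => psi K μ (ρ i) (f i) := by
  unfold IsBlockProd at h ⊢
  filter_upwards [psi_ae K μ (blockPerm ρ) g,
    (measurePreserving_comp_perm μ (blockPerm ρ)).quasiMeasurePreserving.ae h,
    ae_all_iff.2 fun i => (quasiMeasurePreserving_block (a := a) μ i).ae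
      (psi_ae K μ (ρ i) (f i))] with t h1 h2 h3
  rw [h1, h2, blockPerm_inv, qPerm_blockPerm, ← Finset.prod_mul_distrib]
  refine Finset.prod_congr rfl fun i _ => ?_
  rw [h3]
  simp only [blockPerm_apply]

theorem IsBlockProd.ext {g g' : L2 μ (∑ i, a i)} {f : ∀ i, L2 μ (a i)} (h : IsBlockProd g f)
    (h' : IsBlockProd g' f) : g = g' :=
  Lp.ext (Filter.EventuallyEq.trans h (Filter.EventuallyEq.symm h'))

variable (a μ) in
/-- The symmetrization of all blocks of variables. -/
def blockP : L2 μ (∑ i, a i) →L[ℂ] L2 μ (∑ i, a i) :=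
  (∏ i, ((a i).factorial : ℂ)⁻¹) • ∑ ρ : ∀ i, Equiv.Perm (Fin (a i)),
    (psi K μ (blockPerm ρ)).toContinuousLinearMap

theorem blockP_apply (g : L2 μ (∑ i, a i)) : blockP a K μ g =
    (∏ i, ((a i).factorial : ℂ)⁻¹) • ∑ ρ : ∀ i, Equiv.Perm (Fin (a i)),
      psi K μ (blockPerm ρ) g := by
  simp [blockP]

/-- Expanding the product of the averages over the single blocks gives the average over all families
of block permutations. -/
theorem IsBlockProd.blockP {g : L2 μ (∑ i, a i)} {f : ∀ i, L2 μ (a i)} (h : IsBlockProd g f) :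
    IsBlockProd (blockP a K μ g) fun i => symP K μ (a i) (f i) := by
  rw [blockP_apply]
  unfold IsBlockProd
  filter_upwards [Lp.coeFn_smul (∏ i, ((a i).factorial : ℂ)⁻¹)
      (∑ ρ : ∀ i, Equiv.Perm (Fin (a i)), QLevy.psi K μ (blockPerm ρ) g),
    Lp.coeFn_fun_finsetSum Finset.univ fun ρ : ∀ i, Equiv.Perm (Fin (a i)) =>
      QLevy.psi K μ (blockPerm ρ) g,
    ae_all_iff.2 fun ρ : ∀ i, Equiv.Perm (Fin (a i)) => h.psi K ρ,
    ae_all_iff.2 fun i => (quasiMeasurePreserving_block (a := a) μ i).ae (symP_ae K (f i)),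
    ae_all_iff.2 fun i => ae_all_iff.2 fun π => (quasiMeasurePreserving_block (a := a) μ i).ae
      (psi_ae K μ π (f i))] with t h1 h2 h3 h4 h5
  rw [h1, Pi.smul_apply, h2, smul_eq_mul]
  simp_rw [h3, h4, h5, Finset.prod_mul_distrib]
  congr 1
  rw [Finset.prod_univ_sum, Fintype.piFinset_univ]
  simp_rw [Finset.prod_mul_distrib]

end Blocks

/-! ### Invariance of block-symmetric functions -/

section BlockSym

variable {T : Type u} [MeasurableSpace T] {σ : Measure T} [SigmaFinite σ] (K : HermKernel T)
  {α : ℕ →₀ ℕ}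

/-- Invariance is a closed linear condition, and it holds for products of Q-symmetric functions. -/
theorem psi_blockPerm_of_mem_blockSym {g : L2 σ (deg α)} (hg : g ∈ blockSym σ K α)
    (ρ : ∀ i : Fin (blocks α), Equiv.Perm (Fin (α i))) :
    psi K σ (blockPerm ρ) g = g := by
  have hc : IsClosed {g : L2 σ (deg α) | psi K σ (blockPerm ρ) g = g} :=
    isClosed_eq (psi K σ (blockPerm ρ)).continuous continuous_id
  have hs : Submodule.span ℂ {g : L2 σ (deg α) | ∃ f : ∀ i : Fin (blocks α), qSym K σ (α i),
      IsBlockProd g fun i => (f i : L2 σ (α i))} ≤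
      LinearMap.eqLocus (psi K σ (blockPerm ρ)).toLinearMap LinearMap.id := by
    refine Submodule.span_le.2 ?_
    rintro g ⟨f, hf⟩
    refine (hf.psi K ρ).ext ?_
    simp_rw [fun i => (mem_qSym K σ).1 (f i).2 (ρ i)]
    exact hf
  exact Submodule.topologicalClosure_minimal _ hs hc hg

end BlockSym

/-! ### Multi-indices and index sequences -/

section MultiIndices

variable {α β : ℕ →₀ ℕ}

theorem apply_eq_zero_of_blocks_le {i : ℕ} (h : blocks α ≤ i) : α i = 0 := by
  by_contra h0
  exact h.not_gt (Finset.le_sup (f := Nat.succ) (Finsupp.mem_support_iff.2 h0))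

theorem idx_finSigmaFinEquiv (i : Fin (blocks α)) (l : Fin (α i)) :
    idx α (finSigmaFinEquiv (n := fun i : Fin (blocks α) => α i) ⟨i, l⟩) = i := by
  simp [idx]

theorem idx_blockPerm (ρ : ∀ i : Fin (blocks α), Equiv.Perm (Fin (α i))) (j : Fin (deg α)) :
    idx α (blockPerm ρ j) = idx α j := by
  obtain ⟨⟨i, l⟩, rfl⟩ := (finSigmaFinEquiv (n := fun i : Fin (blocks α) => α i)).surjective j
  rw [blockPerm_apply, idx_finSigmaFinEquiv, idx_finSigmaFinEquiv]

/-- Recovers α from its index sequence, so distinct multi-indices have sequences with distinct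
multiplicities. -/
theorem sum_single_idx (α : ℕ →₀ ℕ) : ∑ j, Finsupp.single (idx α j) 1 = α := by
  rw [← (finSigmaFinEquiv (n := fun i : Fin (blocks α) => α i)).sum_comp, Fintype.sum_sigma]
  simp_rw [idx_finSigmaFinEquiv, Finset.sum_const, Finset.card_univ, Fintype.card_fin]
  ext x
  rw [Finsupp.finsetSum_apply]
  by_cases hx : x < blocks α
  · rw [Finset.sum_eq_single (⟨x, hx⟩ : Fin (blocks α))]
    · simp
    · intro i _ hi
      have : (i : ℕ) ≠ x := fun h => hi (Fin.ext h)
      simp [Finsupp.single_eq_of_ne this.symm]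
    · exact fun h => (h (Finset.mem_univ _)).elim
  · rw [apply_eq_zero_of_blocks_le (not_lt.1 hx)]
    refine Finset.sum_eq_zero fun i _ => ?_
    have : (i : ℕ) ≠ x := fun h => hx (h ▸ i.2)
    simp [Finsupp.single_eq_of_ne this.symm]

/-- Take for α the multiplicities of the values of `k`; the block of each value is then matched with
the fibre of `k` over it. -/
theorem exists_idx_eq {n : ℕ} (k : Fin n → ℕ) :
    ∃ (α : ℕ →₀ ℕ) (e : Fin (deg α) ≃ Fin n), ∀ j, k (e j) = idx α j := by
  set α : ℕ →₀ ℕ := ∑ j, Finsupp.single (k j) 1 with hα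
  have h1 : ∀ i, α i = Fintype.card {j // k j = i} := fun i => by
    rw [hα, Finsupp.finsetSum_apply, Fintype.card_subtype, Finset.card_eq_sum_ones,
      Finset.sum_filter]
    exact Finset.sum_congr rfl fun j _ => Finsupp.single_apply
  have h2 : ∀ j, k j < blocks α := fun j => by
    by_contra h
    have := apply_eq_zero_of_blocks_le (not_lt.1 h)
    rw [h1, Fintype.card_eq_zero_iff] at this
    exact this.elim ⟨j, rfl⟩
  let e1 : (Σ i : Fin (blocks α), Fin (α i)) ≃ Σ i : Fin (blocks α), {j // (⟨k j, h2 j⟩ : Fin _) = i} :=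
    Equiv.sigmaCongrRight fun i => Fintype.equivOfCardEq (by
      rw [Fintype.card_fin, h1]
      exact Fintype.card_congr (Equiv.subtypeEquivRight fun j => by simp [Fin.ext_iff]))
  refine ⟨α, (finSigmaFinEquiv.symm.trans e1).trans (Equiv.sigmaFiberEquiv _), fun j => ?_⟩
  obtain ⟨⟨i, l⟩, rfl⟩ := (finSigmaFinEquiv (n := fun i : Fin (blocks α) => α i)).surjective j
  rw [idx_finSigmaFinEquiv]
  simp only [Equiv.trans_apply, Equiv.symm_apply_apply]
  have := (e1 ⟨i, l⟩).2.2
  exact congrArg Fin.val this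

end MultiIndices

/-! ### Orthogonal decomposition of L²(τ) -/

section ChaosDecomposition

variable {T : Type u} [MeasurableSpace T]
  {σ : Measure T} [SigmaFinite σ]
  {ν : Measure ℝ} [IsProbabilityMeasure ν] [HasExpMoment ν] {K : HermKernel T} {α β : ℕ →₀ ℕ}

/-- The stabilizer of the sorted index sequence is the Young subgroup ∏ S_{α_i}. -/
theorem filter_idx_eq_image [DecidableEq (Equiv.Perm (Fin (deg α)))] :
    (Finset.univ.filter fun π : Equiv.Perm (Fin (deg α)) => ∀ j, idx α (π j) = idx α j) =
      Finset.univ.image (blockPerm (a := fun i : Fin (blocks α) => α i)) := by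
  ext π
  simp only [Finset.mem_filter, Finset.mem_univ, true_and, Finset.mem_image]
  constructor
  · intro h
    obtain ⟨ρ, hρ⟩ := exists_eq_blockPerm (a := fun i : Fin (blocks α) => α i) (π := π)
      fun j => Fin.ext (h j)
    exact ⟨ρ, hρ.symm⟩
  · rintro ⟨ρ, rfl⟩ j
    exact idx_blockPerm ρ j

/-- Every element of the stabilizer fixes `g`, so each surviving term equals ⟨f, g⟩. There are ∏
α_i! of them, and the polynomial norms give ∏ C_i^{α_i}. -/
theorem inner_fockMap_idx (f : L2 σ (deg α)) {g : L2 σ (deg α)} (hg : g ∈ blockSym σ K α) :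
    (inner ℂ (fockMap K.lift (σ.prod ν) _ (polyMul ν (fun j => orthPoly ν (idx α j)) f))
      (fockMap K.lift (σ.prod ν) _ (polyMul ν (fun j => orthPoly ν (idx α j)) g)) : ℂ) =
    ((∏ i : Fin (blocks α), ((α i).factorial : ℝ) * normC ν i ^ α i : ℝ) : ℂ) * inner ℂ f g := by
  classical
  rw [inner_fockMap_polyMul, filter_idx_eq_image, Finset.sum_image blockPerm_injective.injOn,
    Finset.sum_congr rfl fun ρ _ => by rw [psi_blockPerm_of_mem_blockSym K hg ρ],
    Finset.sum_const, Finset.card_univ, Fintype.card_pi,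
    ← (finSigmaFinEquiv (n := fun i : Fin (blocks α) => α i)).prod_comp, Fintype.prod_sigma]
  simp_rw [idx_finSigmaFinEquiv, Finset.prod_const, Finset.card_univ, Fintype.card_perm,
    Fintype.card_fin]
  rw [nsmul_eq_mul, ← mul_assoc, Finset.prod_mul_distrib, mul_comm (∏ i, _ : ℂ)]
  push_cast
  rfl

/-- A permutation carrying one index sequence to the other would preserve multiplicities; sequences
of different lengths belong to different particle numbers. -/
theorem inner_fockMap_eq_zero {n m : ℕ} {k : Fin n → ℕ} {l : Fin m → ℕ}
    (h : ∑ j, Finsupp.single (k j) 1 ≠ ∑ j, Finsupp.single (l j) 1) (f : L2 σ n) (g : L2 σ m) :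
    (inner ℂ (fockMap K.lift (σ.prod ν) n (polyMul ν (fun j => orthPoly ν (k j)) f))
      (fockMap K.lift (σ.prod ν) m (polyMul ν (fun j => orthPoly ν (l j)) g)) : ℂ) = 0 := by
  by_cases hnm : n = m
  · subst hnm
    rw [inner_fockMap_polyMul, Finset.filter_eq_empty_iff.2, Finset.sum_empty, mul_zero]
    intro π _ hπ
    refine h ?_
    rw [← Equiv.sum_comp π]
    simp_rw [hπ]
  · exact inner_fockMap_of_ne _ _ hnm _ _

/-- Block permutations do not move the polynomials, so Pₙ absorbs them and hence their average. -/
theorem fockMap_blockP (f : L2 σ (deg α)) :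
    fockMap K.lift (σ.prod ν) _ (polyMul ν (fun j => orthPoly ν (idx α j))
      (blockP (fun i : Fin (blocks α) => α i) K σ f)) =
    fockMap K.lift (σ.prod ν) _ (polyMul ν (fun j => orthPoly ν (idx α j)) f) := by
  have h1 : ∀ ρ : ∀ i : Fin (blocks α), Equiv.Perm (Fin (α i)),
      fockMap K.lift (σ.prod ν) _ (polyMul ν (fun j => orthPoly ν (idx α j))
        (psi K σ (blockPerm ρ) f)) =
      fockMap K.lift (σ.prod ν) _ (polyMul ν (fun j => orthPoly ν (idx α j)) f) := fun ρ => by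
    have := fockMap_polyMul_psi K (ν := ν) (blockPerm ρ) (fun j => orthPoly ν (idx α j)) f
    rw [blockPerm_inv] at this
    simpa only [idx_blockPerm] using this
  rw [blockP_apply, map_smul, map_smul, map_sum, map_sum, Finset.sum_congr rfl fun ρ _ => h1 ρ,
    Finset.sum_const, Finset.card_univ, Fintype.card_pi]
  simp only [Fintype.card_perm, Fintype.card_fin]
  rw [← Nat.cast_smul_eq_nsmul ℂ, smul_smul, Nat.cast_prod, ← Finset.prod_mul_distrib,
    Finset.prod_eq_one fun i _ => inv_mul_cancel₀
      (by exact_mod_cast (α i).factorial_ne_zero), one_smul]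

theorem exists_idx_eq_of_ne_zero {i : ℕ} (h : α i ≠ 0) : ∃ j, idx α j = i := by
  have hi : i < blocks α := by
    by_contra h'
    exact h (apply_eq_zero_of_blocks_le (not_lt.1 h'))
  exact ⟨_, idx_finSigmaFinEquiv ⟨i, hi⟩ ⟨0, Nat.pos_of_ne_zero h⟩⟩

variable [TopologicalSpace T] [PolishSpace T] [LocallyCompactSpace T] [BorelSpace T]
  [IsFiniteMeasureOnCompacts σ]

theorem isBlockProd_elt {b : ℕ} {a : Fin b → ℕ} (D : DisjointSets T (∑ i, a i)) :
    IsBlockProd (D.elt σ) fun i => DisjointSets.elt σ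
      (⟨fun l => D.set (finSigmaFinEquiv ⟨i, l⟩), fun _ => D.meas _, fun _ => D.compact _,
        fun l l' h => D.disj fun h' => h (by simpa using finSigmaFinEquiv.injective h')⟩ :
        DisjointSets T (a i)) := by
  unfold IsBlockProd
  filter_upwards [D.elt_ae σ, ae_all_iff.2 fun i => (quasiMeasurePreserving_block (a := a) σ i).ae
    (DisjointSets.elt_ae σ (⟨fun l => D.set (finSigmaFinEquiv ⟨i, l⟩), fun _ => D.meas _,
      fun _ => D.compact _, fun l l' h => D.disj fun h' => h
        (by simpa using finSigmaFinEquiv.injective h')⟩ : DisjointSets T (a i)))] with t h1 h2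
  rw [h1]
  simp_rw [h2, DisjointSets.fn]
  rw [← (finSigmaFinEquiv (n := a)).prod_comp, Fintype.prod_sigma]

variable [NullSingletonClass σ]

/-- The indicator of a disjoint box is a product over the blocks and its image symmetrizes each
factor; such indicators are total. -/
theorem blockP_mem_blockSym (f : L2 σ (deg α)) :
    blockP (fun i : Fin (blocks α) => α i) K σ f ∈ blockSym σ K α := by
  refine mem_of_dense _ (dense_disjointSets σ (deg α)) (Submodule.isClosed_topologicalClosure _)
    ?_ f
  rintro _ ⟨D, rfl⟩
  refine Submodule.le_topologicalClosure _ (Submodule.subset_span ?_)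
  exact ⟨fun i => ⟨_, symP_mem K σ _⟩, (isBlockProd_elt (a := fun i : Fin (blocks α) => α i) D).blockP K⟩

/-- An arbitrary index sequence is sorted and the integrand is then symmetrized in blocks; neither
operation changes the vector in the Fock space. -/
theorem fockMap_polyMul_mem {R : Submodule ℂ (QFock K.lift (σ.prod ν))}
    (h : ∀ α : Multi ν, ∀ g ∈ blockSym σ K α.1, fockMap K.lift (σ.prod ν) _
      (polyMul ν (fun j => orthPoly ν (idx α.1 j)) g) ∈ R) {n : ℕ} (k : Fin n → ℕ) (f : L2 σ n) :
    fockMap K.lift (σ.prod ν) n (polyMul ν (fun j => orthPoly ν (k j)) f) ∈ R := by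
  obtain ⟨α, e, he⟩ := exists_idx_eq k
  have hn : deg α = n := by simpa using Fintype.card_congr e
  subst hn
  have h1 := fockMap_polyMul_psi K (ν := ν) (e⁻¹ : Equiv.Perm (Fin (deg α)))
    (fun j => orthPoly ν (k j)) f
  rw [inv_inv] at h1
  simp_rw [he] at h1
  rw [← h1, ← fockMap_blockP]
  by_cases hα : ∀ i, α i ≠ 0 → 0 < normC ν i
  · exact h ⟨α, hα⟩ _ (blockP_mem_blockSym _)
  -- An excluded multi-index involves a vanishing polynomial, so its vector is zero.
  · push Not at hα
    obtain ⟨i, hi, hi'⟩ := hα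
    have h0 : normC ν i = 0 := le_antisymm hi' (integral_nonneg fun x => sq_nonneg _)
    obtain ⟨j, hj⟩ := exists_idx_eq_of_ne_zero hi
    rw [polyMul_eq_zero (j := j) (by rw [hj, orthPoly_eq_zero h0]), map_zero]
    exact R.zero_mem

theorem multInt_idx_eq_zero {i : ℕ} (h : α i ≠ 0) (h0 : normC ν i = 0) :
    multInt σ ν K (idx α) = 0 := by
  obtain ⟨j, hj⟩ := exists_idx_eq_of_ne_zero h
  refine ContinuousLinearMap.ext fun f => (gns σ ν K).injective ?_
  rw [gns_multInt, polyMul_eq_zero (j := j) (by rw [hj, orthPoly_eq_zero h0]), map_zero]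
  exact (map_zero _).symm

theorem norm_multInt_idx (α : Multi ν) (f : FAlpha σ ν K α) :
    ‖multInt σ ν K (idx α.1) f.fn‖ = ‖f‖ := by
  obtain ⟨f, rfl⟩ := (Scaled.of (weight ν α) (blockSym σ K α.1)).surjective f
  have h1 : ‖(Scaled.of (weight ν α) (blockSym σ K α.1) f : FAlpha σ ν K α)‖ =
      √(weight ν α : ℝ) * ‖(f : L2 σ (deg α.1))‖ := Scaled.norm_of _ _ f
  refine Eq.trans ?_ h1.symm
  have h2 : (0 : ℝ) ≤ weight ν α := le_of_lt (weight ν α).2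
  rw [← sq_eq_sq₀ (norm_nonneg _) (by positivity), mul_pow, Real.sq_sqrt h2,
    ← (gns σ ν K).norm_map, gns_multInt]
  have h3 := inner_fockMap_idx (ν := ν) (f : L2 σ (deg α.1)) f.2
  rw [inner_self_eq_norm_sq_to_K, inner_self_eq_norm_sq_to_K] at h3
  refine Complex.ofReal_injective ?_
  rw [Complex.ofReal_mul, Complex.ofReal_pow, Complex.ofReal_pow]
  exact h3

variable (σ ν K) in
/-- The multiple stochastic integral `J_α` as an isometry of `𝔽_α`. -/
def chaosIsom (α : Multi ν) : FAlpha σ ν K α →ₗᵢ[ℂ] L2Tau σ ν K where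
  toLinearMap := (multInt σ ν K (idx α.1)).toLinearMap ∘ₗ (blockSym σ K α.1).subtype ∘ₗ
    (Scaled.of (weight ν α) (blockSym σ K α.1)).symm.toLinearMap
  norm_map' f := norm_multInt_idx α f

theorem chaosIsom_apply (α : Multi ν) (f : FAlpha σ ν K α) :
    chaosIsom σ ν K α f = multInt σ ν K (idx α.1) f.fn := rfl

/-- Orthogonality comes from the different multiplicities. For density, the closed span of the
ranges is transported to the Fock space, where it contains all monomial functions because each
monomial is ν-a.e. a combination of the p⁽ᵏ⁾. -/
theorem isHilbertSum_chaosIsom :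
    IsHilbertSum ℂ (fun α : Multi ν => FAlpha σ ν K α) (chaosIsom σ ν K) := by
  refine IsHilbertSum.mk (fun α β h f g => ?_) ?_
  · rw [← (gns σ ν K).inner_map_map, chaosIsom_apply, chaosIsom_apply, gns_multInt, gns_multInt]
    refine inner_fockMap_eq_zero ?_ _ _
    rw [sum_single_idx, sum_single_idx]
    exact fun h' => h (Subtype.ext h')
  · set W := (⨆ α, LinearMap.range (chaosIsom σ ν K α).toLinearMap).topologicalClosure
    have hW : IsClosed (W : Set (L2Tau σ ν K)) := Submodule.isClosed_topologicalClosure _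
    set R := W.comap (gnsEquiv σ ν K).symm.toLinearEquiv.toLinearMap
    have hR : IsClosed (R : Set (QFock K.lift (σ.prod ν))) :=
      hW.preimage (gnsEquiv σ ν K).symm.continuous
    have hα : ∀ α : Multi ν, ∀ g ∈ blockSym σ K α.1, fockMap K.lift (σ.prod ν) _
        (polyMul ν (fun j => orthPoly ν (idx α.1 j)) g) ∈ R := fun α g hg => by
      change (gnsEquiv σ ν K).symm _ ∈ W
      exact Submodule.le_topologicalClosure _ (Submodule.mem_iSup_of_mem α
        ⟨Scaled.of (weight ν α) (blockSym σ K α.1) ⟨g, hg⟩, rfl⟩)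
    have hT : R = ⊤ := eq_top_of_polyElt_mem hR fun n i f => by
      have h1 : Submodule.span ℂ (Set.range fun k : Fin n → ℕ =>
          polyMul ν (fun j => orthPoly ν (k j)) f) ≤
            R.comap (fockMapL K.lift (σ.prod ν) n).toLinearMap := by
        refine Submodule.span_le.2 ?_
        rintro _ ⟨k, rfl⟩
        exact fockMap_polyMul_mem hα k f
      exact h1 (polyElt_mem_span i f)
    intro x _
    have : gnsEquiv σ ν K x ∈ R := hT ▸ Submodule.mem_top
    have h2 : (gnsEquiv σ ν K).symm (gnsEquiv σ ν K x) ∈ W := this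
    rwa [LinearIsometryEquiv.symm_apply_apply] at h2

end ChaosDecomposition

end QLevy

end

open QLevy

theorem mainTheorem1 {T : Type*} [TopologicalSpace T] [PolishSpace T] [LocallyCompactSpace T]
    [MeasurableSpace T] [BorelSpace T] (σ : Measure T) [IsLocallyFiniteMeasure σ]
    [NullSingletonClass σ] (Q : QFunction σ)
    (ν : Measure ℝ) [IsProbabilityMeasure ν] [HasExpMoment ν] :
    Function.Surjective (gns σ ν Q.kernel) ∧
    (∀ (n : ℕ) (k : Fin n → ℕ),
      ∃! S : L2 σ n →L[ℂ] L2Tau σ ν Q.kernel, IsMultipleIntegral σ ν Q.kernel k S) ∧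
    ∀ S : ∀ (n : ℕ), (Fin n → ℕ) → (L2 σ n →L[ℂ] L2Tau σ ν Q.kernel),
      (∀ (n : ℕ) (k : Fin n → ℕ), IsMultipleIntegral σ ν Q.kernel k (S n k)) →
      (∀ α : ℕ →₀ ℕ, (∃ i, α i ≠ 0 ∧ normC ν i = 0) → S (deg α) (idx α) = 0) ∧
      ∃ U : ChaosSpace σ ν Q.kernel ≃ₗᵢ[ℂ] L2Tau σ ν Q.kernel,
        ∀ F : ChaosSpace σ ν Q.kernel,
          HasSum (fun α : Multi ν => S (deg α.1) (idx α.1) (FAlpha.fn (F α))) (U F) := by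
  -- By uniqueness any family `S` of multiple integrals equals `multInt`, so the remaining claims
  -- need only be checked there.
  refine ⟨surjective_gns, fun n k => ⟨multInt σ ν Q.kernel k, isMultipleIntegral_multInt k,
    fun S hS => hS.eq_multInt⟩, fun S hS => ⟨fun α ⟨i, hi, h0⟩ => ?_, ?_⟩⟩
  · rw [(hS _ _).eq_multInt]
    exact multInt_idx_eq_zero hi h0
  · refine ⟨isHilbertSum_chaosIsom.linearIsometryEquiv.symm, fun F => ?_⟩
    simp_rw [fun α : Multi ν => (hS _ (idx α.1)).eq_multInt]
    exact isHilbertSum_chaosIsom.hasSum_linearIsometryEquiv_symm F
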